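/- Let $d\ge 1$, let $L_{1},\dots,L_{K}$ (signal) and $R_1,\dots,R_N$ (noise) be operators on $\mathbb C^d$, let $\gamma_{1}',\dots,\gamma_{N}'>0$ be noise decay rates and $T>0$ a total time. For $\theta=\sqrt{\gamma_1}>0$ consider the master equation $$\dot\rho=\theta^2\sum_{j=1}^K\mathcal D[L_j](\rho)+\sum_{k=1}^N\gamma_k'\,\mathcal D[R_k](\rho),\qquad \mathcal D[L](\rho)=L\rho L^\dagger-\tfrac12\{L^\dagger L,\rho\},$$ and let $\Lambda_{t,\theta}$ be the channel of evolution for time $t$. The quantum Fisher information (QFI) about $\theta$ of a family of states is the supremum over all (finite-outcome) POVMs of the classical Fisher information of the outcome. Let $\mathcal I_M(\theta)$ be the supremum of the QFI of the final state over all sequential strategies with $M$ queries of $\Lambda_{T/M,\theta}\otimes\mathrm{id}$: arbitrary finite-dimensional noiseless ancilla, arbitrary initial state of system and ancilla, arbitrary $\theta$-independent control channels on system and ancilla after each query. Let $\mathcal S=\operatorname{span}_{\mathbb C}\{I,R_1,\dots,R_N\}$. (a) In the fast-control limit followed by the vanishing-signal limit, the optimal QFI is nonzero if and only if some signal operator lies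 outside $\mathcal S$: $$\liminf_{\theta\to0^+}\,\liminf_{M\to\infty}\mathcal I_M(\theta)>0\iff \exists j:\ L_j\notin\mathcal S\iff \limsup_{\theta\to0^+}\,\sup_{M}\mathcal I_M(\theta)>0 .$$ (b) Let $L_{j,\perp}$ be the component of $L_j$ orthogonal to $\mathcal S$ for the inner product $\operatorname{tr}(X^\dagger Y)$. For every orthonormal basis $\{e_j\}$ of $\mathbb C^d$, the measure-and-reset strategy with the Bell state $|\psi\rangle=d^{-1/2}\sum_j e_j\otimes e_j$, whose total QFI is $M$ times the QFI of $(\Lambda_{T/M,\theta}\otimes\mathrm{id})(|\psi\rangle\langle\psi|)$, satisfies $$\lim_{\theta\to0^+}\lim_{M\to\infty}M\,\mathcal I_Q\big[(\Lambda_{T/M,\theta}\otimes\mathrm{id})(|\psi\rangle\langle\psi|)\big]=4T\,\frac1d\sum_{j=1}^K\operatorname{tr}\big(L_{j,\perp}^\dagger L_{j,\perp}\big),$$ where the inner limit exists for every $\theta>0$; and the right-hand side is positive if some $L_j\notin\mathcal S$. -/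

import Mathlib

open Filter
open scoped Matrix Kronecker ENNReal Topology ComplexOrder

noncomputable section

namespace LindbladEstimation

/-- The Lindblad superoperator `ρ ↦ L ρ L† - ½ {L† L, ρ}` of a jump operator `L`. -/
def dissipator {ι : Type} [Fintype ι] (L ρ : Matrix ι ι ℂ) : Matrix ι ι ℂ :=
  L * ρ * Lᴴ - (1 / 2 : ℂ) • (Lᴴ * L * ρ + ρ * (Lᴴ * L))

/-- Right-hand side of the master equation (no Hamiltonian) with signal jump operators `Ls`, all
with the same decay rate `γ₁ = θ ^ 2`, and noise jump operators `Ln k` with decay rates `γ k`. -/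
def generator {ι : Type} [Fintype ι] {K N : ℕ} (Ls : Fin K → Matrix ι ι ℂ)
    (Ln : Fin N → Matrix ι ι ℂ) (γ : Fin N → ℝ) (θ : ℝ) (ρ : Matrix ι ι ℂ) : Matrix ι ι ℂ :=
  ((θ ^ 2 : ℝ) : ℂ) • ∑ j, dissipator (Ls j) ρ + ∑ k, (γ k : ℂ) • dissipator (Ln k) ρ

/-- The state after time `t` of evolution under the master equation: `exp (t 𝓛) ρ`, written as its
(always convergent) power series. -/
def evolve {ι : Type} [Fintype ι] {K N : ℕ} (Ls : Fin K → Matrix ι ι ℂ)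
    (Ln : Fin N → Matrix ι ι ℂ) (γ : Fin N → ℝ) (t θ : ℝ) (ρ : Matrix ι ι ℂ) : Matrix ι ι ℂ :=
  ∑' n : ℕ, ((t ^ n / (n.factorial : ℝ) : ℝ) : ℂ) • (generator Ls Ln γ θ)^[n] ρ

/-- One use of the encoding channel `Λ ⊗ id` for a duration `t`: the jump operators act on the
system `Fin d`, and the ancilla `A` is noiseless (every jump operator is `L ⊗ 1`). -/
def encode {d K N : ℕ} (A : Type) [Fintype A] [DecidableEq A]
    (Ls : Fin K → Matrix (Fin d) (Fin d) ℂ) (Ln : Fin N → Matrix (Fin d) (Fin d) ℂ)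
    (γ : Fin N → ℝ) (t θ : ℝ) (ρ : Matrix (Fin d × A) (Fin d × A) ℂ) :
    Matrix (Fin d × A) (Fin d × A) ℂ :=
  evolve (fun j => Ls j ⊗ₖ (1 : Matrix A A ℂ)) (fun k => Ln k ⊗ₖ (1 : Matrix A A ℂ)) γ t θ ρ

/-- Density matrices. -/
def IsDensity {ι : Type} [Fintype ι] (ρ : Matrix ι ι ℂ) : Prop :=
  ρ.PosSemidef ∧ ρ.trace = 1

/-- Quantum channels, i.e. maps with a Kraus representation. -/
def IsChannel {ι : Type} [Fintype ι] [DecidableEq ι] (Φ : Matrix ι ι ℂ → Matrix ι ι ℂ) : Prop :=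
  ∃ (r : ℕ) (V : Fin r → Matrix ι ι ℂ),
    ∑ i, (V i)ᴴ * V i = 1 ∧ ∀ ρ, Φ ρ = ∑ i, V i * ρ * (V i)ᴴ

/-- Measurements with `m` outcomes (positive operator-valued measures). -/
structure POVM (ι : Type) [Fintype ι] [DecidableEq ι] (m : ℕ) where
  effect : Fin m → Matrix ι ι ℂ
  posSemidef : ∀ x, (effect x).PosSemidef
  sum_eq_one : ∑ x, effect x = 1

/-- The Born probability of the outcome `x`. -/
def POVM.prob {ι : Type} [Fintype ι] [DecidableEq ι] {m : ℕ} (E : POVM ι m)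
    (ρ : Matrix ι ι ℂ) (x : Fin m) : ℝ :=
  (ρ * E.effect x).trace.re

/-- The classical Fisher information about `θ` of a family of distributions `p θ`.  Outcomes of
probability zero are excluded from the sum, as `y / 0 = 0`. -/
def classicalFisher {m : ℕ} (p : ℝ → Fin m → ℝ) (θ : ℝ) : ℝ :=
  ∑ x, (deriv (fun s => p s x) θ) ^ 2 / p θ x

/-- The quantum Fisher information about `θ` of a family of states `ρ θ`: the supremum of the
classical Fisher information over all measurements. -/
def quantumFisher {ι : Type} [Fintype ι] [DecidableEq ι] (ρ : ℝ → Matrix ι ι ℂ) (θ : ℝ) : ℝ≥0∞ :=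
  ⨆ (m : ℕ) (E : POVM ι m), ENNReal.ofReal (classicalFisher (fun s => E.prob (ρ s)) θ)

/-- A sequential strategy: a noiseless ancilla, an initial state of system and ancilla, and
arbitrary (signal-independent) control channels on system and ancilla, `control i` being applied
right after query number `i` of the encoding channel. -/
structure Strategy (d : ℕ) where
  Ancilla : Type
  [fintypeAncilla : Fintype Ancilla]
  [decEqAncilla : DecidableEq Ancilla]
  init : Matrix (Fin d × Ancilla) (Fin d × Ancilla) ℂ
  isDensity_init : IsDensity init
  control : ℕ → Matrix (Fin d × Ancilla) (Fin d × Ancilla) ℂ →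
    Matrix (Fin d × Ancilla) (Fin d × Ancilla) ℂ
  isChannel_control : ∀ i, IsChannel (control i)

attribute [instance] Strategy.fintypeAncilla Strategy.decEqAncilla

/-- The state produced by a strategy after `M` rounds, each consisting of a query of duration `t`
followed by a control operation. -/
def Strategy.state {d K N : ℕ} (σ : Strategy d)
    (Ls : Fin K → Matrix (Fin d) (Fin d) ℂ) (Ln : Fin N → Matrix (Fin d) (Fin d) ℂ)
    (γ : Fin N → ℝ) (t θ : ℝ) : ℕ → Matrix (Fin d × σ.Ancilla) (Fin d × σ.Ancilla) ℂ
  | 0 => σ.init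
  | M + 1 => σ.control M (encode σ.Ancilla Ls Ln γ t θ (σ.state Ls Ln γ t θ M))

/-- The optimal quantum Fisher information about `θ = √γ₁` over all sequential strategies with `M`
queries of duration `T / M`, i.e. of total time `T`. -/
def sequentialQFI {d K N : ℕ} (Ls : Fin K → Matrix (Fin d) (Fin d) ℂ)
    (Ln : Fin N → Matrix (Fin d) (Fin d) ℂ) (γ : Fin N → ℝ) (T : ℝ) (M : ℕ) (θ : ℝ) : ℝ≥0∞ :=
  ⨆ σ : Strategy d, quantumFisher (fun s => σ.state Ls Ln γ (T / M) s M) θ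

/-- The total quantum Fisher information of the measure-and-reset strategy with initial state `ρ`:
`M` times that of the state `Λ ⊗ id (ρ)` after a single query of duration `T / M`. -/
def measureResetQFI {d K N : ℕ} {A : Type} [Fintype A] [DecidableEq A]
    (Ls : Fin K → Matrix (Fin d) (Fin d) ℂ) (Ln : Fin N → Matrix (Fin d) (Fin d) ℂ)
    (γ : Fin N → ℝ) (T : ℝ) (ρ : Matrix (Fin d × A) (Fin d × A) ℂ) (M : ℕ) (θ : ℝ) : ℝ≥0∞ :=
  M * quantumFisher (fun s => encode A Ls Ln γ (T / M) s ρ) θ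

/-- The Bell state `|ψ⟩⟨ψ|` with `|ψ⟩ = d ^ (-1/2) ∑ j, e j ⊗ e j`. -/
def bellState {d : ℕ} (e : OrthonormalBasis (Fin d) ℂ (EuclideanSpace ℂ (Fin d))) :
    Matrix (Fin d × Fin d) (Fin d × Fin d) ℂ :=
  let ψ : Fin d × Fin d → ℂ := fun p => ((1 / Real.sqrt d : ℝ) : ℂ) * ∑ j, e j p.1 * e j p.2
  Matrix.vecMulVec ψ (star ψ)

/-- The complex span of the identity and the noise operators. -/
def noiseSpan {d N : ℕ} (Ln : Fin N → Matrix (Fin d) (Fin d) ℂ) :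
    Submodule ℂ (Matrix (Fin d) (Fin d) ℂ) :=
  Submodule.span ℂ (insert 1 (Set.range Ln))

/-- `B` is the component of `L` orthogonal to `S` for the inner product `⟨X, Y⟩ = tr (X† Y)`. -/
def IsOrthogonalComponent {d : ℕ} (S : Submodule ℂ (Matrix (Fin d) (Fin d) ℂ))
    (L B : Matrix (Fin d) (Fin d) ℂ) : Prop :=
  L - B ∈ S ∧ ∀ X ∈ S, (Xᴴ * B).trace = 0

end LindbladEstimation

end

open Filter
open scoped Matrix Kronecker ENNReal Topology ComplexOrder

noncomputable section

namespace LindbladEstimation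

/-! Measurements are eliminated by a variational formula: the QFI of a family ρ with derivative ρ'
is the supremum of 2 tr(ρ'X) - tr(ρX²) over Hermitian X (`quantumFisher_le`, `le_quantumFisher`). In
the parameter s = θ² the generator is affine, and the chain rule contributes a factor 4θ².

All L_j in S: write L_j = c_j + Σ a_jk R_k. The scalars c_j only change the drift, and the jump part
is a quadratic form in the R_k with coefficient matrix s Σ_j a_j a_j† + diag γ', still positive
semidefinite for slightly negative s. The evolution therefore stays completely positive on a
two-sided interval around s = 0, where every outcome probability is nonnegative and analytic, so
that its squared derivative is at most a constant times its value (`sq_deriv_le`). Uniformity in M,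
ancilla, controls and outcomes comes from complex s: the imaginary part is a bounded perturbation of
a contraction semigroup, so the total variation of the outcomes is at most exp(δωT) for every M. The
information about s is bounded, hence that about θ is O(θ²) (`exists_sequentialQFI_bound`).

Some L_j outside S: on a maximally entangled ψ the vectors (X ⊗ 1)ψ carry the geometry of tr(X†Y),
so a projector P annihilates them for X in S and fixes (L_{j,⊥} ⊗ 1)ψ (`exists_detector`). Noise
jumps are invisible to P, the no-jump evolution contributes only O(t²), and clicks occur at rate θ²b
with b = (1/d) Σ tr(L_{j,⊥}† L_{j,⊥}). A click process of rate θ²b carries information 4b per unit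
time about θ. In a sequential strategy the click is stored in a flag level of the ancilla, which the
dynamics preserves; as M → ∞ this gives at least 4Tb exp(-2Tbθ²) (`exists_le_liminf_sequentialQFI`).

The exact rate of the Bell state needs an upper bound for all measurements. The state after a short
time t is split into its no-jump part, which contributes O(t²), and a positive remainder, against
which X is propagated in the Heisenberg picture (`exists_fisher_bound`). With Φ(s) the supremum of
`jumpFisher`, M times the QFI tends to 4θ²TΦ(θ²) (`tendsto_mul_quantumFisher`). Weighted
Cauchy–Schwarz (`exists_jumpFisher_bound`) and the test matrix s⁻¹P (`jumpFisher_projector`) give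
s⁻¹b ≤ Φ(s) ≤ s⁻¹b + C, and the limit 4Tb follows. -/

open scoped Matrix.Norms.L2Operator

/-! ### Partial derivatives of maps on ℂ × ℂ. -/

section PartialDerivatives

variable {E F : Type*} [NormedAddCommGroup E] [NormedSpace ℂ E] [NormedAddCommGroup F]
  [NormedSpace ℂ F]

theorem hasDerivAt_comp_prodMk_left {u : ℂ × ℂ → E} {r s : ℂ}
    (hu : DifferentiableAt ℂ u (r, s)) :
    HasDerivAt (fun r => u (r, s)) (fderiv ℂ u (r, s) (1, 0)) r :=
  HasFDerivAt.comp_hasDerivAt (f := fun r => (r, s)) r hu.hasFDerivAt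
    ((hasDerivAt_id r).prodMk (hasDerivAt_const r s))

theorem hasDerivAt_comp_prodMk_right {u : ℂ × ℂ → E} {r s : ℂ}
    (hu : DifferentiableAt ℂ u (r, s)) :
    HasDerivAt (fun s => u (r, s)) (fderiv ℂ u (r, s) (0, 1)) s :=
  HasFDerivAt.comp_hasDerivAt (f := fun s => (r, s)) s hu.hasFDerivAt
    ((hasDerivAt_const s r).prodMk (hasDerivAt_id s))

theorem hasDerivAt_apply_const {g : ℂ → E →L[ℂ] F} {g' : E →L[ℂ] F} {r : ℂ}
    (hg : HasDerivAt g g' r) (v : E) : HasDerivAt (fun r => g r v) (g' v) r := by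
  simpa using hg.clm_apply (hasDerivAt_const r v)

end PartialDerivatives

/-! ### Exponentials in Banach algebras: Chernoff's formula, growth bounds, parameter derivative. -/

section BanachAlgebra

variable {𝔸 : Type*} [NormedRing 𝔸]

/-- Telescoping: aⁿ - bⁿ is the sum of the n terms a^i (a - b) b^(n-1-i). -/
theorem norm_pow_sub_pow_le {a b : 𝔸} {A B : ℝ} {n : ℕ} (hA0 : 0 ≤ A)
    (hA : ∀ k ≤ n, ‖a ^ k‖ ≤ A) (hB : ∀ k ≤ n, ‖b ^ k‖ ≤ B) :
    ‖a ^ n - b ^ n‖ ≤ n * (A * ‖a - b‖ * B) := by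
  have key : ∀ m j, m + j ≤ n → ‖(a ^ m - b ^ m) * b ^ j‖ ≤ m * (A * ‖a - b‖ * B) := by
    intro m
    induction m with
    | zero => intro j _; simp
    | succ m ih =>
      intro j hj
      have e : (a ^ (m + 1) - b ^ (m + 1)) * b ^ j
          = a ^ m * (a - b) * b ^ j + (a ^ m - b ^ m) * b ^ (j + 1) := by
        rw [pow_succ, pow_succ, pow_succ']; noncomm_ring
      rw [e]
      refine (norm_add_le _ _).trans ?_
      have h1 : ‖a ^ m * (a - b) * b ^ j‖ ≤ A * ‖a - b‖ * B := by
        refine (norm_mul_le _ _).trans ?_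
        refine mul_le_mul ((norm_mul_le _ _).trans ?_) (hB j (by omega)) (norm_nonneg _)
          (by positivity)
        exact mul_le_mul_of_nonneg_right (hA m (by omega)) (norm_nonneg _)
      have h2 := ih (j + 1) (by omega)
      push_cast
      linarith
  simpa using key n 0 (by omega)

variable [NormedAlgebra ℂ 𝔸] [CompleteSpace 𝔸]

theorem exp_natCast_smul (n : ℕ) (x : 𝔸) :
    NormedSpace.exp ((n : ℂ) • x) = NormedSpace.exp x ^ n := by
  let _ : NormedAlgebra ℚ 𝔸 := NormedAlgebra.restrictScalars ℚ ℂ 𝔸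
  rw [← NormedSpace.exp_nsmul, Nat.cast_smul_eq_nsmul]

theorem continuous_exp_complex : Continuous (NormedSpace.exp : 𝔸 → 𝔸) := by
  let _ : NormedAlgebra ℚ 𝔸 := NormedAlgebra.restrictScalars ℚ ℂ 𝔸
  exact NormedSpace.exp_continuous

/-- Chernoff's product formula in a Banach algebra. -/
theorem tendsto_pow_exp [NormOneClass 𝔸] {G : 𝔸} {Φ : ℂ → 𝔸} (h1 : Φ 0 = 1)
    (hΦ : HasDerivAt Φ G 0) {t : ℝ} (ht : 0 ≤ t) :
    Tendsto (fun n : ℕ => Φ ((t / n : ℝ) : ℂ) ^ n) atTop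
      (𝓝 (NormedSpace.exp ((t : ℂ) • G))) := by
  have hexp : HasDerivAt (fun z : ℂ => NormedSpace.exp (z • G)) G 0 := by
    simpa using hasDerivAt_exp_smul_const (𝕂 := ℂ) G 0
  have hz : Tendsto (fun n : ℕ => ((t / n : ℝ) : ℂ)) atTop (𝓝 0) := by
    have : Tendsto (fun n : ℕ => t / (n : ℝ)) atTop (𝓝 0) :=
      tendsto_const_nhds.div_atTop tendsto_natCast_atTop_atTop
    simpa [Function.comp_def] using (Complex.continuous_ofReal.tendsto 0).comp this
  have hd : (fun z : ℂ => Φ z - NormedSpace.exp (z • G)) =o[𝓝 0] fun z => z := by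
    have := (hΦ.sub hexp).isLittleO
    simpa [h1] using this
  obtain ⟨B, hB⟩ : ∃ B, ∀ r ∈ Set.Icc (0 : ℝ) t, ‖NormedSpace.exp ((r : ℂ) • G)‖ ≤ B := by
    have hc : Continuous fun r : ℝ => NormedSpace.exp ((r : ℂ) • G) :=
      continuous_exp_complex.comp (Complex.continuous_ofReal.smul continuous_const)
    exact isCompact_Icc.exists_bound_of_continuousOn hc.continuousOn
  obtain ⟨c, hc0, hc⟩ : ∃ c > 0, ∀ᶠ z in 𝓝 (0 : ℂ), ‖Φ z‖ ≤ 1 + c * ‖z‖ := by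
    obtain ⟨c, hc0, hc⟩ := hΦ.isBigO_sub.exists_pos
    refine ⟨c, hc0, ?_⟩
    filter_upwards [hc.bound] with z hz
    have e : Φ z = (Φ z - Φ 0) + 1 := by rw [h1]; abel
    rw [e]
    refine (norm_add_le _ _).trans ?_
    rw [norm_one]
    simp only [sub_zero] at hz
    linarith
  have hB0 : 0 ≤ B := (norm_nonneg _).trans (hB 0 ⟨le_rfl, ht⟩)
  rw [tendsto_iff_norm_sub_tendsto_zero]
  rw [Metric.tendsto_nhds]
  intro ε hε
  -- A bounds the powers of Φ(t/n) up to the n-th, as (1 + ct/n)ⁿ ≤ exp(ct). The value of η makes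
  -- the telescoped error n · A · η(t/n) · B smaller than ε.
  set A := Real.exp (c * t)
  have hA0 : 0 < A := Real.exp_pos _
  set η := ε / (A * (B + 1) * (t + 1))
  have hη : 0 < η := by positivity
  filter_upwards [hz.eventually hc, hz.eventually (hd.def hη), eventually_gt_atTop 0]
    with n hn1 hn2 hn3
  have hn : (0 : ℝ) < n := by exact_mod_cast hn3
  have hnorm : ‖((t / n : ℝ) : ℂ)‖ = t / n := by
    rw [Complex.norm_real, Real.norm_of_nonneg (by positivity)]
  rw [hnorm] at hn1 hn2
  have eb : ∀ k : ℕ, NormedSpace.exp (((t / n : ℝ) : ℂ) • G) ^ k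
      = NormedSpace.exp (((k * (t / n) : ℝ) : ℂ) • G) := by
    intro k
    rw [← exp_natCast_smul, smul_smul]; push_cast; rfl
  have e1 : NormedSpace.exp ((t : ℂ) • G) = NormedSpace.exp (((t / n : ℝ) : ℂ) • G) ^ n := by
    rw [eb]; congr 3; field_simp
  have hle := norm_pow_sub_pow_le (a := Φ ((t / n : ℝ) : ℂ))
    (b := NormedSpace.exp (((t / n : ℝ) : ℂ) • G)) (A := A) (B := B) (n := n) hA0.le ?_ ?_
  · rw [← e1] at hle
    rw [dist_zero_right, norm_norm]
    refine hle.trans_lt ?_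
    calc (n : ℝ) * (A * ‖_‖ * B) ≤ n * (A * (η * (t / n)) * B) := by gcongr
      _ = (A * B * t) * η := by field_simp
      _ < (A * (B + 1) * (t + 1)) * η := by
        apply mul_lt_mul_of_pos_right _ hη
        nlinarith [mul_nonneg hA0.le hB0, mul_nonneg hA0.le ht]
      _ = ε := by simp only [η]; field_simp
  · intro k hk
    refine (norm_pow_le _ _).trans ?_
    calc ‖Φ ((t / n : ℝ) : ℂ)‖ ^ k ≤ (1 + c * (t / n)) ^ k := by gcongr
      _ ≤ (1 + c * (t / n)) ^ n := pow_le_pow_right₀ (by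
        have : 0 ≤ c * (t / n) := by positivity
        linarith) hk
      _ ≤ (Real.exp (c * (t / n))) ^ n := by
        gcongr
        linarith [Real.add_one_le_exp (c * (t / n))]
      _ = A := by
        rw [← Real.exp_nat_mul]; congr 1; field_simp
  · intro k hk
    rw [eb]
    refine hB _ ⟨by positivity, ?_⟩
    calc (k : ℝ) * (t / n) ≤ n * (t / n) := by gcongr
      _ = t := by field_simp

/-- Chernoff's formula with Φ z = 1 + zG: the n-th power has norm at most exp(ωt + Ct²/n), and the
C-term disappears in the limit. The growth rate is thus read off from 1 + hG to first order in h. -/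
theorem norm_exp_smul_le [NormOneClass 𝔸] {G : 𝔸} {ω C : ℝ}
    (hG : ∀ h : ℝ, 0 ≤ h → ‖1 + (h : ℂ) • G‖ ≤ 1 + ω * h + C * h ^ 2) {t : ℝ} (ht : 0 ≤ t) :
    ‖NormedSpace.exp ((t : ℂ) • G)‖ ≤ Real.exp (ω * t) := by
  have hΦ : HasDerivAt (fun z : ℂ => 1 + z • G) G 0 := by
    simpa using ((hasDerivAt_id (0 : ℂ)).smul_const G).const_add 1
  have h := (tendsto_pow_exp (by simp) hΦ ht).norm
  have h2 : Tendsto (fun n : ℕ => Real.exp (ω * t + C * t ^ 2 / n)) atTop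
      (𝓝 (Real.exp (ω * t))) := by
    have : Tendsto (fun n : ℕ => C * t ^ 2 / (n : ℝ)) atTop (𝓝 0) :=
      tendsto_const_nhds.div_atTop tendsto_natCast_atTop_atTop
    simpa [Function.comp_def] using (Real.continuous_exp.tendsto _).comp (this.const_add (ω * t))
  refine le_of_tendsto_of_tendsto h h2 ?_
  filter_upwards [eventually_gt_atTop 0] with n hn
  have hn : (0 : ℝ) < n := by exact_mod_cast hn
  refine (norm_pow_le _ _).trans ?_
  calc _ ≤ (1 + ω * (t / n) + C * (t / n) ^ 2) ^ n := by
        gcongr; exact hG _ (by positivity)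
    _ ≤ (Real.exp (ω * (t / n) + C * (t / n) ^ 2)) ^ n := by
        have := (norm_nonneg _).trans (hG (t / n) (by positivity))
        gcongr
        linarith [Real.add_one_le_exp (ω * (t / n) + C * (t / n) ^ 2)]
    _ = _ := by
        rw [← Real.exp_nat_mul]; congr 1; field_simp

theorem norm_exp_smul_le_exp_norm [NormOneClass 𝔸] (G : 𝔸) {t : ℝ} (ht : 0 ≤ t) :
    ‖NormedSpace.exp ((t : ℂ) • G)‖ ≤ Real.exp (‖G‖ * t) := by
  refine norm_exp_smul_le (C := 0) (fun h hh => ?_) ht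
  refine (norm_add_le _ _).trans ?_
  rw [norm_one, norm_smul, Complex.norm_real, Real.norm_of_nonneg hh]
  linarith [mul_comm h ‖G‖]

theorem contDiff_exp : ContDiff ℂ ⊤ (NormedSpace.exp : 𝔸 → 𝔸) := by
  rw [contDiff_iff_contDiffAt]
  intro x
  exact (NormedSpace.exp_analytic (𝕂 := ℂ) x).contDiffAt

/-- The parameter derivative of `exp (r (G₀ + s G₁))` solves the linearized equation. -/
theorem exists_parameter_deriv (G₀ G₁ : 𝔸) : ∃ D : ℂ → ℂ → 𝔸,
    (∀ r s, HasDerivAt (fun s => NormedSpace.exp (r • (G₀ + s • G₁))) (D r s) s) ∧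
    (∀ s, D 0 s = 0) ∧
    ∀ r s, HasDerivAt (fun r => D r s)
      ((G₀ + s • G₁) * D r s + G₁ * NormedSpace.exp (r • (G₀ + s • G₁))) r := by
  set u : ℂ × ℂ → 𝔸 := fun p => NormedSpace.exp (p.1 • (G₀ + p.2 • G₁)) with hu
  have hu2 : ContDiff ℂ ⊤ u := contDiff_exp.comp (by fun_prop)
  have hdu : Differentiable ℂ u := hu2.differentiable (by simp)
  have hdu2 : Differentiable ℂ (fderiv ℂ u) :=
    (hu2.fderiv_right (m := 1) (by simp)).differentiable (by simp)
  have h1 : ∀ r s : ℂ, HasDerivAt (fun r => u (r, s)) (fderiv ℂ u (r, s) (1, 0)) r := fun r s =>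
    hasDerivAt_comp_prodMk_left (hdu (r, s))
  have h2 : ∀ r s : ℂ, HasDerivAt (fun s => u (r, s)) (fderiv ℂ u (r, s) (0, 1)) s := fun r s =>
    hasDerivAt_comp_prodMk_right (hdu (r, s))
  have h1' : ∀ r s : ℂ, fderiv ℂ u (r, s) (1, 0) = (G₀ + s • G₁) * u (r, s) := fun r s =>
    (h1 r s).unique (hasDerivAt_exp_smul_const' (𝕂 := ℂ) (G₀ + s • G₁) r)
  refine ⟨fun r s => fderiv ℂ u (r, s) (0, 1), h2, fun s => ?_, fun r s => ?_⟩
  · refine (h2 0 s).unique ?_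
    simpa [hu] using hasDerivAt_const s (1 : 𝔸)
  · have hr := hasDerivAt_apply_const
      (hasDerivAt_comp_prodMk_left (u := fderiv ℂ u) (hdu2 (r, s))) ((0, 1) : ℂ × ℂ)
    have hs := hasDerivAt_apply_const
      (hasDerivAt_comp_prodMk_right (u := fderiv ℂ u) (hdu2 (r, s))) ((1, 0) : ℂ × ℂ)
    -- Mixed partial derivatives commute, so differentiating ∂_r u = (G₀ + sG₁)u in s yields the
    -- r-derivative of ∂_s u.
    have hsym : IsSymmSndFDerivAt ℂ u (r, s) :=
      (hu2.contDiffAt (x := (r, s))).isSymmSndFDerivAt (by simp)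
    rw [hsym.eq (1, 0) (0, 1)] at hr
    have hs' : HasDerivAt (fun s => (G₀ + s • G₁) * u (r, s))
        (G₁ * u (r, s) + (G₀ + s • G₁) * fderiv ℂ u (r, s) (0, 1)) s := by
      have := (((hasDerivAt_id s).smul_const G₁).const_add G₀).mul (h2 r s)
      simpa [Pi.mul_def] using this
    simp_rw [h1'] at hs
    rw [hs.unique hs'] at hr
    rw [add_comm]
    exact hr

end BanachAlgebra

/-! ### Superoperators and Lindblad generators in the Schrödinger and Heisenberg pictures. -/

section SuperOperators

variable {ι : Type} [Fintype ι] [DecidableEq ι]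

/-- Superoperators, as bounded linear maps on matrices with the operator norm. -/
def SuperOp (ι : Type) [Fintype ι] [DecidableEq ι] : Type :=
  Matrix ι ι ℂ →L[ℂ] Matrix ι ι ℂ

namespace SuperOp

instance : NormedRing (SuperOp ι) := ContinuousLinearMap.toNormedRing (𝕜 := ℂ) (E := Matrix ι ι ℂ)

instance : NormedAlgebra ℂ (SuperOp ι) :=
  ContinuousLinearMap.toNormedAlgebra (𝕜 := ℂ) (E := Matrix ι ι ℂ)

instance : CompleteSpace (SuperOp ι) :=
  inferInstanceAs (CompleteSpace (Matrix ι ι ℂ →L[ℂ] Matrix ι ι ℂ))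

instance [Nonempty ι] : NormOneClass (SuperOp ι) :=
  ContinuousLinearMap.normOneClass (𝕜 := ℂ) (E := Matrix ι ι ℂ)

instance : FunLike (SuperOp ι) (Matrix ι ι ℂ) (Matrix ι ι ℂ) :=
  inferInstanceAs (FunLike (Matrix ι ι ℂ →L[ℂ] Matrix ι ι ℂ) (Matrix ι ι ℂ) (Matrix ι ι ℂ))

@[ext]
theorem ext {G H : SuperOp ι} (h : ∀ ρ, G ρ = H ρ) : G = H := DFunLike.ext _ _ h

/-- Evaluation of superoperators at a matrix. -/
def eval (ρ : Matrix ι ι ℂ) : SuperOp ι →L[ℂ] Matrix ι ι ℂ :=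
  ContinuousLinearMap.apply ℂ (Matrix ι ι ℂ) ρ

@[simp] theorem eval_apply (ρ : Matrix ι ι ℂ) (G : SuperOp ι) : eval ρ G = G ρ := rfl

@[simp] theorem add_apply (G H : SuperOp ι) (ρ : Matrix ι ι ℂ) : (G + H) ρ = G ρ + H ρ := rfl

@[simp] theorem sub_apply (G H : SuperOp ι) (ρ : Matrix ι ι ℂ) : (G - H) ρ = G ρ - H ρ := rfl

@[simp] theorem smul_apply (z : ℂ) (G : SuperOp ι) (ρ : Matrix ι ι ℂ) : (z • G) ρ = z • G ρ := rfl

@[simp] theorem mul_apply (G H : SuperOp ι) (ρ : Matrix ι ι ℂ) : (G * H) ρ = G (H ρ) := rfl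

@[simp] theorem one_apply (ρ : Matrix ι ι ℂ) : (1 : SuperOp ι) ρ = ρ := rfl

@[simp] theorem zero_apply (ρ : Matrix ι ι ℂ) : (0 : SuperOp ι) ρ = 0 := rfl

theorem pow_apply (G : SuperOp ι) (n : ℕ) (ρ : Matrix ι ι ℂ) : (G ^ n) ρ = G^[n] ρ := by
  induction n generalizing ρ with
  | zero => rfl
  | succ n ih => rw [pow_succ, mul_apply, ih, Function.iterate_succ_apply]

@[simp] theorem sum_apply {κ : Type*} (s : Finset κ) (G : κ → SuperOp ι) (ρ : Matrix ι ι ℂ) :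
    (∑ i ∈ s, G i) ρ = ∑ i ∈ s, G i ρ := map_sum (eval ρ) G s

theorem map_add (G : SuperOp ι) (ρ σ : Matrix ι ι ℂ) : G (ρ + σ) = G ρ + G σ :=
  ContinuousLinearMap.map_add (M₁ := Matrix ι ι ℂ) G ρ σ

theorem map_sub (G : SuperOp ι) (ρ σ : Matrix ι ι ℂ) : G (ρ - σ) = G ρ - G σ :=
  ContinuousLinearMap.map_sub (M := Matrix ι ι ℂ) G ρ σ

theorem map_smul (G : SuperOp ι) (c : ℂ) (ρ : Matrix ι ι ℂ) : G (c • ρ) = c • G ρ :=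
  ContinuousLinearMap.map_smul (M₁ := Matrix ι ι ℂ) (M₂ := Matrix ι ι ℂ) G c ρ

theorem le_opNorm (G : SuperOp ι) (ρ : Matrix ι ι ℂ) : ‖G ρ‖ ≤ ‖G‖ * ‖ρ‖ :=
  ContinuousLinearMap.le_opNorm (E := Matrix ι ι ℂ) G ρ

theorem opNorm_le_bound (G : SuperOp ι) {C : ℝ} (hC : 0 ≤ C) (h : ∀ ρ, ‖G ρ‖ ≤ C * ‖ρ‖) :
    ‖G‖ ≤ C :=
  ContinuousLinearMap.opNorm_le_bound (E := Matrix ι ι ℂ) G hC h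

theorem hasDerivAt_apply_const {G : ℂ → SuperOp ι} {G' : SuperOp ι} {z : ℂ}
    (hG : HasDerivAt G G' z) (ρ : Matrix ι ι ℂ) : HasDerivAt (fun z => G z ρ) (G' ρ) z :=
  (eval ρ).hasFDerivAt.comp_hasDerivAt z hG

theorem hasDerivAt_apply {G : ℂ → SuperOp ι} {G' : SuperOp ι} {ρ : ℂ → Matrix ι ι ℂ}
    {ρ' : Matrix ι ι ℂ} {z : ℂ} (hG : HasDerivAt G G' z) (hρ : HasDerivAt ρ ρ' z) :
    HasDerivAt (fun z => G z (ρ z)) (G' (ρ z) + G z ρ') z :=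
  HasDerivAt.clm_apply (F := Matrix ι ι ℂ) (G := Matrix ι ι ℂ) hG hρ

end SuperOp

/-- The superoperator `X ↦ A X B`. -/
def sandwich (A B : Matrix ι ι ℂ) : SuperOp ι :=
  LinearMap.toContinuousLinearMap (E := Matrix ι ι ℂ) (F' := Matrix ι ι ℂ)
    { toFun := fun X => A * X * B
      map_add' := fun X Y => by rw [mul_add, add_mul]
      map_smul' := fun c X => by simp }

@[simp]
theorem sandwich_apply (A B X : Matrix ι ι ℂ) : sandwich A B X = A * X * B := rfl

theorem norm_sandwich_le (A B : Matrix ι ι ℂ) : ‖sandwich A B‖ ≤ ‖A‖ * ‖B‖ := by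
  refine SuperOp.opNorm_le_bound _ (by positivity) fun X => ?_
  refine (norm_mul_le _ _).trans ?_
  have := mul_le_mul_of_nonneg_right (norm_mul_le A X) (norm_nonneg B)
  calc _ ≤ _ := this
    _ = _ := by ring

/-- The Lindblad superoperator of a jump operator. -/
def dissOp (L : Matrix ι ι ℂ) : SuperOp ι :=
  sandwich L Lᴴ - (1 / 2 : ℂ) • (sandwich (Lᴴ * L) 1 + sandwich 1 (Lᴴ * L))

/-- The Lindblad superoperator of a jump operator in the Heisenberg picture. -/
def dissAdj (L : Matrix ι ι ℂ) : SuperOp ι :=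
  sandwich Lᴴ L - (1 / 2 : ℂ) • (sandwich (Lᴴ * L) 1 + sandwich 1 (Lᴴ * L))

theorem dissOp_apply (L ρ : Matrix ι ι ℂ) : dissOp L ρ = dissipator L ρ := by
  simp [dissOp, dissipator]

theorem dissAdj_apply (L X : Matrix ι ι ℂ) :
    dissAdj L X = Lᴴ * X * L - (1 / 2 : ℂ) • (Lᴴ * L * X + X * (Lᴴ * L)) := by
  simp [dissAdj]

theorem norm_dissAdj_le [Nonempty ι] (L : Matrix ι ι ℂ) : ‖dissAdj L‖ ≤ 2 * ‖L‖ ^ 2 := by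
  have h1 : ‖sandwich Lᴴ L‖ ≤ ‖L‖ ^ 2 := by
    refine (norm_sandwich_le _ _).trans ?_
    rw [Matrix.l2_opNorm_conjTranspose]; exact (sq _).ge
  have h0 : ‖Lᴴ * L‖ = ‖L‖ ^ 2 := by rw [Matrix.l2_opNorm_conjTranspose_mul_self, sq]
  have h2 : ‖sandwich (Lᴴ * L) 1‖ ≤ ‖L‖ ^ 2 := by
    refine (norm_sandwich_le _ _).trans ?_
    rw [h0, norm_one, mul_one]
  have h3 : ‖sandwich 1 (Lᴴ * L)‖ ≤ ‖L‖ ^ 2 := by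
    refine (norm_sandwich_le _ _).trans ?_
    rw [h0, norm_one, one_mul]
  have h4 := norm_add_le (sandwich (Lᴴ * L) 1) (sandwich 1 (Lᴴ * L))
  refine (norm_sub_le _ _).trans ?_
  rw [norm_smul]
  norm_num
  linarith

variable {κ : Type*} [Fintype κ]

/-- The Lindblad generator with jump operators `L i` and (complex) rates `w i`. -/
def genOp (L : κ → Matrix ι ι ℂ) (w : κ → ℂ) : SuperOp ι := ∑ i, w i • dissOp (L i)

/-- The Lindblad generator in the Heisenberg picture. -/
def genAdj (L : κ → Matrix ι ι ℂ) (w : κ → ℂ) : SuperOp ι := ∑ i, w i • dissAdj (L i)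

theorem genOp_apply (L : κ → Matrix ι ι ℂ) (w : κ → ℂ) (ρ : Matrix ι ι ℂ) :
    genOp L w ρ = ∑ i, w i • dissOp (L i) ρ := by
  simp [genOp]

theorem genAdj_apply (L : κ → Matrix ι ι ℂ) (w : κ → ℂ) (ρ : Matrix ι ι ℂ) :
    genAdj L w ρ = ∑ i, w i • dissAdj (L i) ρ := by
  simp [genAdj]

theorem genOp_add_smul (L : κ → Matrix ι ι ℂ) (w v : κ → ℂ) (z : ℂ) :
    genOp L (fun i => w i + z * v i) = genOp L w + z • genOp L v := by
  rw [genOp, genOp, genOp, Finset.smul_sum, ← Finset.sum_add_distrib]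
  refine Finset.sum_congr rfl fun i _ => ?_
  rw [smul_smul, add_smul]

theorem genAdj_add_smul (L : κ → Matrix ι ι ℂ) (w v : κ → ℂ) (z : ℂ) :
    genAdj L (fun i => w i + z * v i) = genAdj L w + z • genAdj L v := by
  rw [genAdj, genAdj, genAdj, Finset.smul_sum, ← Finset.sum_add_distrib]
  refine Finset.sum_congr rfl fun i _ => ?_
  rw [smul_smul, add_smul]

theorem trace_dissOp_mul (L ρ X : Matrix ι ι ℂ) :
    (dissOp L ρ * X).trace = (ρ * dissAdj L X).trace := by
  rw [dissOp_apply, dissAdj_apply, dissipator]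
  simp only [sub_mul, mul_sub, Matrix.trace_sub, Matrix.smul_mul, Matrix.mul_smul,
    Matrix.trace_smul, add_mul, mul_add, Matrix.trace_add]
  congr 1
  · rw [mul_assoc, mul_assoc, Matrix.trace_mul_comm]; simp only [mul_assoc]
  · congr 1
    rw [add_comm]
    congr 1
    · simp only [mul_assoc]
    · rw [mul_assoc, Matrix.trace_mul_comm]; simp only [mul_assoc]

theorem trace_genOp_mul (L : κ → Matrix ι ι ℂ) (w : κ → ℂ) (ρ X : Matrix ι ι ℂ) :
    (genOp L w ρ * X).trace = (ρ * genAdj L w X).trace := by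
  rw [genOp_apply, genAdj_apply, Finset.sum_mul, Finset.mul_sum, Matrix.trace_sum,
    Matrix.trace_sum]
  refine Finset.sum_congr rfl fun i _ => ?_
  rw [Matrix.smul_mul, Matrix.mul_smul, Matrix.trace_smul, Matrix.trace_smul, trace_dissOp_mul]

theorem conjTranspose_dissAdj (L X : Matrix ι ι ℂ) : (dissAdj L X)ᴴ = dissAdj L Xᴴ := by
  simp only [dissAdj_apply, Matrix.conjTranspose_sub, Matrix.conjTranspose_mul,
    Matrix.conjTranspose_smul, Matrix.conjTranspose_add, Matrix.conjTranspose_conjTranspose,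
    mul_assoc]
  rw [add_comm (Xᴴ * _)]
  simp

theorem generator_eq {K N : ℕ} (Ls : Fin K → Matrix ι ι ℂ) (Ln : Fin N → Matrix ι ι ℂ)
    (γ : Fin N → ℝ) (θ : ℝ) (ρ : Matrix ι ι ℂ) :
    generator Ls Ln γ θ ρ =
      genOp (Sum.elim Ls Ln) (Sum.elim (fun _ => ((θ ^ 2 : ℝ) : ℂ)) (fun k => (γ k : ℂ))) ρ := by
  rw [genOp_apply, generator, Fintype.sum_sum_type, Finset.smul_sum]
  simp only [Sum.elim_inl, Sum.elim_inr, dissOp_apply]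

theorem exp_smul_apply (G : SuperOp ι) (z : ℂ) (ρ : Matrix ι ι ℂ) :
    HasSum (fun n : ℕ => (z ^ n / (n.factorial : ℂ)) • (G ^ n) ρ)
      (NormedSpace.exp (z • G) ρ) := by
  have h := NormedSpace.exp_series_hasSum_exp' (𝕂 := ℂ) (z • G)
  have h2 := (SuperOp.eval ρ).hasSum h
  convert h2 using 2 with n
  · rw [smul_pow, smul_smul, SuperOp.eval_apply, SuperOp.smul_apply, div_eq_inv_mul]
  · rfl

theorem evolve_eq_exp {K N : ℕ} (Ls : Fin K → Matrix ι ι ℂ) (Ln : Fin N → Matrix ι ι ℂ)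
    (γ : Fin N → ℝ) (t θ : ℝ) (ρ : Matrix ι ι ℂ) :
    evolve Ls Ln γ t θ ρ = NormedSpace.exp ((t : ℂ) • genOp (Sum.elim Ls Ln)
      (Sum.elim (fun _ => ((θ ^ 2 : ℝ) : ℂ)) (fun k => (γ k : ℂ)))) ρ := by
  rw [evolve, ← (exp_smul_apply _ _ _).tsum_eq]
  congr 1
  funext n
  congr 1
  · push_cast; rfl
  · have : generator Ls Ln γ θ = ⇑(genOp (Sum.elim Ls Ln)
        (Sum.elim (fun _ => ((θ ^ 2 : ℝ) : ℂ)) (fun k => (γ k : ℂ)))) :=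
      funext fun ρ => generator_eq Ls Ln γ θ ρ
    rw [this, SuperOp.pow_apply]

omit [DecidableEq ι] in
theorem continuous_trace_mul (X : Matrix ι ι ℂ) :
    Continuous fun M : Matrix ι ι ℂ => (M * X).trace :=
  (continuous_id.matrix_mul continuous_const).matrix_trace

omit [DecidableEq ι] in
/-- The functional `M ↦ tr (M X)`. -/
def traceMul (X : Matrix ι ι ℂ) : Matrix ι ι ℂ →L[ℂ] ℂ where
  toFun := fun M => (M * X).trace
  map_add' := fun M N => by rw [add_mul, Matrix.trace_add]
  map_smul' := fun c M => by simp
  cont := continuous_trace_mul X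

@[simp]
theorem traceMul_apply (X M : Matrix ι ι ℂ) : traceMul X M = (M * X).trace := rfl

/-- Duality passes from the generators to the semigroups term by term in the power series. -/
theorem trace_exp_mul {G G' : SuperOp ι}
    (h : ∀ ρ X, (G ρ * X).trace = (ρ * G' X).trace) (z : ℂ) (ρ X : Matrix ι ι ℂ) :
    (NormedSpace.exp (z • G) ρ * X).trace = (ρ * NormedSpace.exp (z • G') X).trace := by
  have hn : ∀ n : ℕ, ∀ ρ X, ((G ^ n) ρ * X).trace = (ρ * (G' ^ n) X).trace := by
    intro n
    induction n with
    | zero => intro ρ X; simp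
    | succ n ih =>
      intro ρ X
      rw [pow_succ', pow_succ]
      change (G ((G ^ n) ρ) * X).trace = (ρ * (G' ^ n) (G' X)).trace
      rw [h, ih]
  have h1 := (traceMul X).hasSum (exp_smul_apply G z ρ)
  have h2 := (traceMul ρ).hasSum (exp_smul_apply G' z X)
  have e : (NormedSpace.exp (z • G) ρ * X).trace = (NormedSpace.exp (z • G') X * ρ).trace := by
    refine h1.unique ?_
    convert h2 using 2 with n
    · simp only [map_smul, traceMul_apply]
      rw [hn, Matrix.trace_mul_comm]
    · rfl
  rw [e, Matrix.trace_mul_comm]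

omit [DecidableEq ι] in
theorem isClosed_setOf_posSemidef : IsClosed {M : Matrix ι ι ℂ | M.PosSemidef} := by
  have : {M : Matrix ι ι ℂ | M.PosSemidef}
      = {M | Mᴴ = M} ∩ ⋂ x : ι → ℂ, {M | 0 ≤ star x ⬝ᵥ (M *ᵥ x)} := by
    ext M
    simp only [Matrix.posSemidef_iff_dotProduct_mulVec, Matrix.IsHermitian, Set.mem_ofPred_eq,
      Set.mem_inter_iff, Set.mem_iInter]
  rw [this]
  refine (isClosed_eq continuous_id.matrix_conjTranspose continuous_id).inter
    (isClosed_iInter fun x => isClosed_le continuous_const ?_)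
  exact continuous_const.dotProduct (continuous_id.matrix_mulVec continuous_const)

/-! ### Positivity of the evolution and its no-jump lower bound. -/

section Positivity

variable {G : SuperOp ι} {J : κ → Matrix ι ι ℂ} {w : κ → ℝ} {K : Matrix ι ι ℂ}

omit [DecidableEq ι] in
theorem posSemidef_smul_sandwich_sum (hw : ∀ i, 0 ≤ w i) {ρ : Matrix ι ι ℂ}
    (hρ : ρ.PosSemidef) : (∑ i, (w i : ℂ) • (J i * ρ * (J i)ᴴ)).PosSemidef :=
  Matrix.posSemidef_sum _ fun i _ =>
    (hρ.mul_mul_conjTranspose_same (J i)).smul (by exact_mod_cast hw i)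

/-- The evolution of a positive matrix dominates its evolution without jumps. -/
theorem posSemidef_exp_sub [Nonempty ι] (hw : ∀ i, 0 ≤ w i)
    (hG : ∀ ρ, G ρ = ∑ i, (w i : ℂ) • (J i * ρ * (J i)ᴴ) - (K * ρ + ρ * Kᴴ))
    {t : ℝ} (ht : 0 ≤ t) {ρ : Matrix ι ι ℂ} (hρ : ρ.PosSemidef) :
    (NormedSpace.exp ((t : ℂ) • G) ρ - NormedSpace.exp ((t : ℂ) • -K) * ρ *
      NormedSpace.exp ((t : ℂ) • -Kᴴ)).PosSemidef := by
  -- The quadratic correction does not change the derivative at 0 and turns the Euler step 1 + hG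
  -- into a sum of congruences, by 1 - hK and by the jump operators, hence into a positive map to
  -- which Chernoff's formula applies.
  set Φ : ℂ → SuperOp ι := fun z => 1 + z • G + z ^ 2 • sandwich K Kᴴ
  have hΦ : HasDerivAt Φ G 0 := by
    have := (((hasDerivAt_id (0 : ℂ)).smul_const G).const_add 1).add
      (((hasDerivAt_id (0 : ℂ)).pow 2).smul_const (sandwich K Kᴴ))
    simpa [Pi.add_def] using this
  have hd : ∀ A : Matrix ι ι ℂ, HasDerivAt (fun z : ℂ => 1 + z • A) A 0 := fun A => by
    simpa using ((hasDerivAt_id (0 : ℂ)).smul_const A).const_add 1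
  have hstep : ∀ (h : ℝ) (X : Matrix ι ι ℂ), Φ h X
      = (1 + (h : ℂ) • -K) * X * (1 + (h : ℂ) • -K)ᴴ
        + (h : ℂ) • ∑ i, (w i : ℂ) • (J i * X * (J i)ᴴ) := by
    intro h X
    change X + (h : ℂ) • G X + (h : ℂ) ^ 2 • (K * X * Kᴴ) = _
    rw [hG]
    simp only [Matrix.conjTranspose_add, Matrix.conjTranspose_one, Matrix.conjTranspose_smul,
      Matrix.conjTranspose_neg, Complex.star_def, Complex.conj_ofReal, mul_add, add_mul, mul_one,
      one_mul, Matrix.smul_mul, Matrix.mul_smul, neg_mul, mul_neg, smul_sub, smul_add, smul_neg,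
      smul_smul, sq]
    abel
  -- Both claims go through one induction: the jump term gained over the no-jump evolution in each
  -- step is positive because the current iterate is.
  have hpos : ∀ (h : ℝ), 0 ≤ h → ∀ n : ℕ, ((Φ h ^ n) ρ).PosSemidef ∧
      ((Φ h ^ n) ρ - (1 + (h : ℂ) • -K) ^ n * ρ * ((1 + (h : ℂ) • -K) ^ n)ᴴ).PosSemidef := by
    intro h hh n
    have hh' : (0 : ℂ) ≤ h := by exact_mod_cast hh
    induction n with
    | zero => simpa using ⟨hρ, Matrix.PosSemidef.zero⟩
    | succ n ih =>
      obtain ⟨ih1, ih2⟩ := ih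
      have e : (Φ h ^ (n + 1)) ρ = Φ h ((Φ h ^ n) ρ) := by rw [pow_succ']; rfl
      have hj := (posSemidef_smul_sandwich_sum (J := J) hw ih1).smul hh'
      rw [e]
      refine ⟨?_, ?_⟩
      · rw [hstep]
        exact (ih1.mul_mul_conjTranspose_same _).add hj
      · have := (ih2.mul_mul_conjTranspose_same (1 + (h : ℂ) • -K)).add hj
        convert this using 1
        rw [hstep, pow_succ', Matrix.conjTranspose_mul, mul_sub, sub_mul]
        simp only [mul_assoc]
        abel
  have hlim1 := ((SuperOp.eval ρ).continuous.tendsto _).comp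
    (tendsto_pow_exp (by simp [Φ]) hΦ ht)
  have hlim2 := tendsto_pow_exp (by simp) (hd (-K)) ht
  have hlim3 := tendsto_pow_exp (by simp) (hd (-Kᴴ)) ht
  refine isClosed_setOf_posSemidef.mem_of_tendsto
    (hlim1.sub ((hlim2.mul_const ρ).mul hlim3)) (Eventually.of_forall fun n => ?_)
  have := (hpos (t / n) (by positivity) n).2
  rw [Matrix.conjTranspose_pow] at this
  simpa using this

theorem posSemidef_exp [Nonempty ι] (hw : ∀ i, 0 ≤ w i)
    (hG : ∀ ρ, G ρ = ∑ i, (w i : ℂ) • (J i * ρ * (J i)ᴴ) - (K * ρ + ρ * Kᴴ))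
    {t : ℝ} (ht : 0 ≤ t) {ρ : Matrix ι ι ℂ} (hρ : ρ.PosSemidef) :
    (NormedSpace.exp ((t : ℂ) • G) ρ).PosSemidef := by
  have h := posSemidef_exp_sub hw hG ht hρ
  have e : NormedSpace.exp ((t : ℂ) • -Kᴴ) = (NormedSpace.exp ((t : ℂ) • -K))ᴴ := by
    rw [← Matrix.star_eq_conjTranspose (NormedSpace.exp _), NormedSpace.star_exp]
    simp [Matrix.star_eq_conjTranspose]
  have h2 := hρ.mul_mul_conjTranspose_same (NormedSpace.exp ((t : ℂ) • -K))
  rw [e] at h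
  simpa using h.add h2

end Positivity

/-- The drift `½ L† L - c̄ L + ½ |c|²` accompanying the shifted jump operator `L - c`. -/
def shiftedDrift (L : Matrix ι ι ℂ) (c : ℂ) : Matrix ι ι ℂ :=
  (1 / 2 : ℂ) • (Lᴴ * L) - (star c) • L + (1 / 2 * (star c * c)) • 1

/-- A jump operator may be shifted by any scalar if the drift compensates. The freedom in c serves
to centre the jumps at a given state and to remove the identity component of signal operators. -/
theorem dissOp_eq_shifted (L : Matrix ι ι ℂ) (c : ℂ) (ρ : Matrix ι ι ℂ) :
    dissOp L ρ = (L - c • 1) * ρ * (L - c • 1)ᴴ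
      - (shiftedDrift L c * ρ + ρ * (shiftedDrift L c)ᴴ) := by
  rw [dissOp_apply, dissipator, shiftedDrift]
  simp only [Matrix.conjTranspose_add, Matrix.conjTranspose_sub, Matrix.conjTranspose_smul,
    Matrix.conjTranspose_one, Matrix.conjTranspose_mul, Matrix.conjTranspose_conjTranspose,
    sub_mul, mul_sub, add_mul, mul_add, Matrix.smul_mul, Matrix.mul_smul, one_mul, mul_one,
    smul_smul, smul_add, star_star, star_mul', star_div₀, star_one, star_ofNat]
  module

theorem genOp_apply_eq_shifted (L : κ → Matrix ι ι ℂ) (w : κ → ℝ) (c : κ → ℂ)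
    (ρ : Matrix ι ι ℂ) :
    genOp L (fun i => (w i : ℂ)) ρ
      = ∑ i, (w i : ℂ) • ((L i - c i • 1) * ρ * (L i - c i • 1)ᴴ)
        - ((∑ i, (w i : ℂ) • shiftedDrift (L i) (c i)) * ρ
          + ρ * (∑ i, (w i : ℂ) • shiftedDrift (L i) (c i))ᴴ) := by
  rw [genOp_apply, Matrix.conjTranspose_sum, Finset.sum_mul, Finset.mul_sum,
    ← Finset.sum_add_distrib, ← Finset.sum_sub_distrib]
  refine Finset.sum_congr rfl fun i _ => ?_
  rw [dissOp_eq_shifted _ (c i)]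
  simp [smul_sub]

end SuperOperators

/-! ### Trace inequalities for positive semidefinite matrices. -/

section Traces

variable {ι : Type} [Fintype ι] [DecidableEq ι]

omit [DecidableEq ι] in
theorem trace_mul_conjTranspose_mul_nonneg {τ : Matrix ι ι ℂ} (hτ : τ.PosSemidef)
    (C : Matrix ι ι ℂ) : 0 ≤ (τ * (Cᴴ * C)).trace.re := by
  have h := (hτ.mul_mul_conjTranspose_same C).trace_nonneg
  rw [← mul_assoc, Matrix.trace_mul_comm, ← mul_assoc]
  exact (Complex.le_def.1 h).1

theorem exists_conjTranspose_mul_self {τ : Matrix ι ι ℂ} (hτ : τ.PosSemidef) :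
    ∃ B : Matrix ι ι ℂ, τ = Bᴴ * B := by
  open scoped MatrixOrder in
  obtain ⟨B, hB⟩ := CStarAlgebra.nonneg_iff_eq_star_mul_self.1 (Matrix.nonneg_iff_posSemidef.2 hτ)
  exact ⟨B, hB⟩

theorem trace_mul_re_nonneg {τ E : Matrix ι ι ℂ} (hτ : τ.PosSemidef) (hE : E.PosSemidef) :
    0 ≤ (τ * E).trace.re := by
  obtain ⟨B, rfl⟩ := exists_conjTranspose_mul_self hE
  exact trace_mul_conjTranspose_mul_nonneg hτ B

omit [DecidableEq ι] in
theorem trace_mul_im_eq_zero {τ E : Matrix ι ι ℂ} (hτ : τ.IsHermitian) (hE : E.IsHermitian) :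
    (τ * E).trace.im = 0 := by
  rw [← Complex.conj_eq_iff_im, ← Complex.star_def, ← Matrix.trace_conjTranspose,
    Matrix.conjTranspose_mul, hτ.eq, hE.eq, Matrix.trace_mul_comm]

omit [DecidableEq ι] in
theorem trace_mul_conjTranspose_mul_re_comm {τ : Matrix ι ι ℂ} (hτ : τ.IsHermitian)
    (A B : Matrix ι ι ℂ) : (τ * (Bᴴ * A)).trace.re = (τ * (Aᴴ * B)).trace.re := by
  have : (τ * (Bᴴ * A)).trace = star (τ * (Aᴴ * B)).trace := by
    rw [← Matrix.trace_conjTranspose, Matrix.conjTranspose_mul, Matrix.conjTranspose_mul,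
      Matrix.conjTranspose_conjTranspose, hτ.eq, Matrix.trace_mul_comm]
  rw [this]; simp

/-- Weighted Cauchy-Schwarz inequality for `⟨A, B⟩ = tr (τ A† B)`. -/
theorem two_mul_trace_re_le {τ : Matrix ι ι ℂ} (hτ : τ.PosSemidef) (A B : Matrix ι ι ℂ) {ε : ℝ}
    (hε : 0 < ε) : 2 * (τ * (Aᴴ * B)).trace.re
      ≤ ε * (τ * (Aᴴ * A)).trace.re + ε⁻¹ * (τ * (Bᴴ * B)).trace.re := by
  have h := trace_mul_conjTranspose_mul_nonneg hτ ((ε : ℂ) • A - B)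
  have e : (((ε : ℂ) • A - B)ᴴ * ((ε : ℂ) • A - B))
      = ((ε ^ 2 : ℝ) : ℂ) • (Aᴴ * A) - (ε : ℂ) • (Aᴴ * B) - (ε : ℂ) • (Bᴴ * A) + Bᴴ * B := by
    simp only [Matrix.conjTranspose_sub, Matrix.conjTranspose_smul, Complex.star_def,
      Complex.conj_ofReal, sub_mul, mul_sub, Matrix.smul_mul, Matrix.mul_smul, smul_smul]
    push_cast
    rw [sq]; abel
  rw [e] at h
  simp only [mul_add, mul_sub, Matrix.mul_smul, Matrix.trace_add, Matrix.trace_sub,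
    Matrix.trace_smul, smul_eq_mul, Complex.add_re, Complex.sub_re, Complex.re_ofReal_mul] at h
  rw [trace_mul_conjTranspose_mul_re_comm hτ.isHermitian A B] at h
  have h2 := mul_le_mul_of_nonneg_left h (inv_pos.2 hε).le
  field_simp at h2 ⊢
  linarith

end Traces

/-! ### Variational formula for the quantum Fisher information. -/

section Fisher

variable {ι : Type} [Fintype ι] [DecidableEq ι]

/-- Kadison's inequality for a POVM: with X the mean operator, the difference equals Σ (c x - X) E_x
(c x - X), a sum of congruences of effects. -/
theorem POVM.sum_smul_sq_sub_posSemidef {m : ℕ} (E : POVM ι m) (c : Fin m → ℝ) :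
    ((∑ x, ((c x ^ 2 : ℝ) : ℂ) • E.effect x)
      - (∑ x, (c x : ℂ) • E.effect x) * (∑ x, (c x : ℂ) • E.effect x)).PosSemidef := by
  set X := ∑ x, (c x : ℂ) • E.effect x with hX
  have hXh : Xᴴ = X := by
    rw [hX, Matrix.conjTranspose_sum]
    refine Finset.sum_congr rfl fun x _ => ?_
    rw [Matrix.conjTranspose_smul, (E.posSemidef x).isHermitian.eq]
    simp
  have h : (∑ x, ((c x : ℂ) • 1 - X) * E.effect x * ((c x : ℂ) • 1 - X)ᴴ).PosSemidef :=
    Matrix.posSemidef_sum _ fun x _ => (E.posSemidef x).mul_mul_conjTranspose_same _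
  convert h using 1
  have e : ∀ x, ((c x : ℂ) • 1 - X) * E.effect x * ((c x : ℂ) • 1 - X)ᴴ
      = ((c x ^ 2 : ℝ) : ℂ) • E.effect x - X * ((c x : ℂ) • E.effect x)
        - ((c x : ℂ) • E.effect x) * X + X * E.effect x * X := by
    intro x
    simp only [Matrix.conjTranspose_sub, Matrix.conjTranspose_smul, Complex.star_def,
      Complex.conj_ofReal, Matrix.conjTranspose_one, hXh, sub_mul, mul_sub, Matrix.smul_mul,
      Matrix.mul_smul, smul_smul, one_mul, mul_one]
    push_cast
    rw [sq]; abel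
  simp_rw [e]
  rw [Finset.sum_add_distrib, Finset.sum_sub_distrib, Finset.sum_sub_distrib, ← Finset.sum_mul,
    ← Finset.mul_sum, ← Finset.sum_mul, ← Finset.mul_sum, E.sum_eq_one, ← hX]
  simp

/-- The classical Fisher information of every measurement is bounded by the supremum of
`2 tr (ρ' X) - tr (ρ X²)` over Hermitian `X`. -/
theorem classicalFisher_le {ρ : ℝ → Matrix ι ι ℂ} {ρ' : Matrix ι ι ℂ} {θ B : ℝ}
    (hd : ∀ X, HasDerivAt (fun s => (ρ s * X).trace.re) (ρ' * X).trace.re θ)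
    (hρ : (ρ θ).PosSemidef)
    (hB : ∀ X : Matrix ι ι ℂ, X.IsHermitian →
      2 * (ρ' * X).trace.re - (ρ θ * (X * X)).trace.re ≤ B)
    {m : ℕ} (E : POVM ι m) : classicalFisher (fun s => E.prob (ρ s)) θ ≤ B := by
  -- The outcome values are the classical score p'/p. Outcomes of probability zero get the value 0,
  -- in agreement with the convention in the Fisher sum.
  set c : Fin m → ℝ := fun x => (ρ' * E.effect x).trace.re / E.prob (ρ θ) x with hc
  set X := ∑ x, (c x : ℂ) • E.effect x with hX
  have hXh : X.IsHermitian := by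
    rw [Matrix.IsHermitian, hX, Matrix.conjTranspose_sum]
    refine Finset.sum_congr rfl fun x _ => ?_
    rw [Matrix.conjTranspose_smul, (E.posSemidef x).isHermitian.eq]
    simp
  refine le_trans ?_ (hB X hXh)
  have h1 := trace_mul_re_nonneg hρ (E.sum_smul_sq_sub_posSemidef c)
  rw [← hX, mul_sub, Matrix.trace_sub, Complex.sub_re, sub_nonneg] at h1
  have h2 : (ρ θ * ∑ x, ((c x ^ 2 : ℝ) : ℂ) • E.effect x).trace.re
      = ∑ x, c x ^ 2 * E.prob (ρ θ) x := by
    rw [Finset.mul_sum, Matrix.trace_sum, Complex.re_sum]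
    refine Finset.sum_congr rfl fun x _ => ?_
    rw [Matrix.mul_smul, Matrix.trace_smul, smul_eq_mul, Complex.re_ofReal_mul, POVM.prob]
  have h3 : (ρ' * X).trace.re = ∑ x, c x * (ρ' * E.effect x).trace.re := by
    rw [hX, Finset.mul_sum, Matrix.trace_sum, Complex.re_sum]
    refine Finset.sum_congr rfl fun x _ => ?_
    rw [Matrix.mul_smul, Matrix.trace_smul, smul_eq_mul, Complex.re_ofReal_mul]
  have h4 : classicalFisher (fun s => E.prob (ρ s)) θ
      = 2 * ∑ x, c x * (ρ' * E.effect x).trace.re - ∑ x, c x ^ 2 * E.prob (ρ θ) x := by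
    rw [classicalFisher, Finset.mul_sum, ← Finset.sum_sub_distrib]
    refine Finset.sum_congr rfl fun x _ => ?_
    have : deriv (fun s => E.prob (ρ s) x) θ = (ρ' * E.effect x).trace.re :=
      (hd (E.effect x)).deriv
    rw [this, hc]
    by_cases h0 : E.prob (ρ θ) x = 0
    · simp [h0]
    · field_simp; ring
  rw [h4, h3, ← h2]
  linarith

theorem quantumFisher_le {ρ : ℝ → Matrix ι ι ℂ} {ρ' : Matrix ι ι ℂ} {θ B : ℝ}
    (hd : ∀ X, HasDerivAt (fun s => (ρ s * X).trace.re) (ρ' * X).trace.re θ)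
    (hρ : (ρ θ).PosSemidef)
    (hB : ∀ X : Matrix ι ι ℂ, X.IsHermitian →
      2 * (ρ' * X).trace.re - (ρ θ * (X * X)).trace.re ≤ B) :
    quantumFisher ρ θ ≤ ENNReal.ofReal B :=
  iSup_le fun _ => iSup_le fun E => ENNReal.ofReal_le_ofReal (classicalFisher_le hd hρ hB E)

/-- The projective measurement of the eigenbasis of a Hermitian matrix. -/
theorem exists_spectral_povm {X : Matrix ι ι ℂ} (hX : X.IsHermitian) :
    ∃ (m : ℕ) (E : POVM ι m) (c : Fin m → ℝ), ∑ x, (c x : ℂ) • E.effect x = X ∧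
      ∑ x, ((c x ^ 2 : ℝ) : ℂ) • E.effect x = X * X := by
  set U : Matrix ι ι ℂ := hX.eigenvectorUnitary.1 with hU
  have hUU : U * Uᴴ = 1 := Unitary.mul_star_self_of_mem hX.eigenvectorUnitary.2
  have hUU' : Uᴴ * U = 1 := Unitary.star_mul_self_of_mem hX.eigenvectorUnitary.2
  set e := Fintype.equivFin ι
  have hsum : ∀ c : ι → ℂ, ∑ x : Fin (Fintype.card ι), c (e.symm x) •
      (U * Matrix.diagonal (Pi.single (e.symm x) 1) * Uᴴ) = U * Matrix.diagonal c * Uᴴ := by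
    intro c
    rw [e.symm.sum_comp fun i => c i • (U * Matrix.diagonal (Pi.single i (1 : ℂ)) * Uᴴ)]
    have : Matrix.diagonal c = ∑ i, c i • Matrix.diagonal (Pi.single i (1 : ℂ)) := by
      ext i j
      simp only [Matrix.sum_apply, Matrix.smul_apply, Matrix.diagonal_apply, smul_eq_mul]
      split_ifs with h
      · simp [Pi.single_apply]
      · simp
    rw [this, Finset.mul_sum, Finset.sum_mul]
    simp
  have hXd : X = U * Matrix.diagonal (fun i => (hX.eigenvalues i : ℂ)) * Uᴴ := by
    conv_lhs => rw [hX.spectral_theorem, Unitary.conjStarAlgAut_apply]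
    rfl
  refine ⟨Fintype.card ι, ⟨fun x => U * Matrix.diagonal (Pi.single (e.symm x) 1) * Uᴴ,
    fun x => ?_, ?_⟩, fun x => hX.eigenvalues (e.symm x), ?_, ?_⟩
  · refine Matrix.PosSemidef.mul_mul_conjTranspose_same (Matrix.PosSemidef.diagonal ?_) U
    exact Pi.single_nonneg.2 zero_le_one
  · have := hsum fun _ => 1
    simp only [one_smul] at this
    rw [this, Matrix.diagonal_one, mul_one, hUU]
  · exact (hsum _).trans hXd.symm
  · refine (hsum fun i => ((hX.eigenvalues i ^ 2 : ℝ) : ℂ)).trans ?_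
    conv_rhs => rw [hXd]
    rw [show U * Matrix.diagonal (fun i => (hX.eigenvalues i : ℂ)) * Uᴴ *
      (U * Matrix.diagonal (fun i => (hX.eigenvalues i : ℂ)) * Uᴴ) =
      U * Matrix.diagonal (fun i => (hX.eigenvalues i : ℂ)) * (Uᴴ * U) *
        Matrix.diagonal (fun i => (hX.eigenvalues i : ℂ)) * Uᴴ by simp only [mul_assoc], hUU',
      mul_one, mul_assoc U (Matrix.diagonal _) (Matrix.diagonal _), Matrix.diagonal_mul_diagonal]
    congr 3
    funext i
    push_cast; ring

/-- Measuring in the eigenbasis of X turns the objective into a sum over outcomes of 2cp' - c²p,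
each at most p'²/p. -/
theorem le_quantumFisher {ρ : ℝ → Matrix ι ι ℂ} {ρ' : Matrix ι ι ℂ} {θ : ℝ}
    (hd : ∀ X, HasDerivAt (fun s => (ρ s * X).trace.re) (ρ' * X).trace.re θ)
    (hρ : ∀ s, (ρ s).PosSemidef) {X : Matrix ι ι ℂ} (hX : X.IsHermitian) :
    ENNReal.ofReal (2 * (ρ' * X).trace.re - (ρ θ * (X * X)).trace.re) ≤ quantumFisher ρ θ := by
  obtain ⟨m, E, c, h1, h2⟩ := exists_spectral_povm hX
  refine le_trans (ENNReal.ofReal_le_ofReal ?_) (le_iSup_of_le m (le_iSup_of_le E le_rfl))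
  rw [← h2, ← h1, Finset.mul_sum, Finset.mul_sum, Matrix.trace_sum, Matrix.trace_sum,
    Complex.re_sum, Complex.re_sum, Finset.mul_sum, ← Finset.sum_sub_distrib, classicalFisher]
  refine Finset.sum_le_sum fun x _ => ?_
  rw [Matrix.mul_smul, Matrix.trace_smul, smul_eq_mul, Complex.re_ofReal_mul, Matrix.mul_smul,
    Matrix.trace_smul, smul_eq_mul, Complex.re_ofReal_mul]
  have hdx : HasDerivAt (fun s => E.prob (ρ s) x) (ρ' * E.effect x).trace.re θ := hd _
  rw [hdx.deriv]
  have hp : ∀ s, 0 ≤ E.prob (ρ s) x := fun s => trace_mul_re_nonneg (hρ s) (E.posSemidef x)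
  change 2 * (c x * _) - c x ^ 2 * E.prob (ρ θ) x ≤ _
  set a := (ρ' * E.effect x).trace.re
  rcases (hp θ).eq_or_lt with h0 | h0
  -- A probability vanishing at θ has a minimum there, so its derivative is 0 and the convention y /
  -- 0 = 0 loses nothing.
  · have hmin : IsLocalMin (fun s => E.prob (ρ s) x) θ :=
      Eventually.of_forall fun s => by change E.prob (ρ θ) x ≤ E.prob (ρ s) x; rw [← h0]; exact hp s
    have ha : a = 0 := by rw [← hdx.deriv]; exact hmin.deriv_eq_zero
    rw [← h0, ha]; simp
  · rw [le_div_iff₀ h0]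
    nlinarith [sq_nonneg (c x * E.prob (ρ θ) x - a)]

end Fisher

/-! ### Exponentials depending on a parameter and acting on a fixed element. -/

section ParameterDerivative

variable {𝔸 : Type*} [NormedRing 𝔸] [NormedAlgebra ℂ 𝔸] [CompleteSpace 𝔸]

/-- The derivative of `exp (r (G₀ + s G₁))` with respect to `s`. -/
def expDeriv (G₀ G₁ : 𝔸) : ℂ → ℂ → 𝔸 := (exists_parameter_deriv G₀ G₁).choose

theorem hasDerivAt_exp_parameter (G₀ G₁ : 𝔸) (r s : ℂ) :
    HasDerivAt (fun s => NormedSpace.exp (r • (G₀ + s • G₁))) (expDeriv G₀ G₁ r s) s :=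
  (exists_parameter_deriv G₀ G₁).choose_spec.1 r s

theorem expDeriv_zero (G₀ G₁ : 𝔸) (s : ℂ) : expDeriv G₀ G₁ 0 s = 0 :=
  (exists_parameter_deriv G₀ G₁).choose_spec.2.1 s

theorem hasDerivAt_expDeriv (G₀ G₁ : 𝔸) (r s : ℂ) :
    HasDerivAt (fun r => expDeriv G₀ G₁ r s)
      ((G₀ + s • G₁) * expDeriv G₀ G₁ r s + G₁ * NormedSpace.exp (r • (G₀ + s • G₁))) r :=
  (exists_parameter_deriv G₀ G₁).choose_spec.2.2 r s

theorem hasDerivAt_exp_time (G : 𝔸) (r : ℂ) :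
    HasDerivAt (fun r : ℂ => NormedSpace.exp (r • G)) (G * NormedSpace.exp (r • G)) r :=
  hasDerivAt_exp_smul_const' (𝕂 := ℂ) G r

theorem exp_mul_eq_self {C ρ : 𝔸} (h : C * ρ = 0) : NormedSpace.exp C * ρ = ρ := by
  have h1 := (NormedSpace.exp_series_hasSum_exp' (𝕂 := ℂ) C).mul_right ρ
  refine h1.unique ?_
  have h2 := hasSum_single (f := fun n : ℕ => ((n.factorial : ℂ)⁻¹ • C ^ n) * ρ) 0 (by
    intro n hn
    obtain ⟨k, rfl⟩ := Nat.exists_eq_succ_of_ne_zero hn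
    rw [pow_succ, smul_mul_assoc, mul_assoc, h, mul_zero, smul_zero])
  simpa using h2

/-- H - M commutes with M and kills ρ, so its exponential fixes ρ. This trades the drift for an
operator M that can be moved past the jump operators. -/
theorem exp_smul_mul_eq {H M ρ : 𝔸} (hc : Commute H M) (h : H * ρ = M * ρ) (r : ℂ) :
    NormedSpace.exp (r • H) * ρ = NormedSpace.exp (r • M) * ρ := by
  let _ : NormedAlgebra ℚ 𝔸 := NormedAlgebra.restrictScalars ℚ ℂ 𝔸
  have e : r • H = r • M + r • (H - M) := by rw [smul_sub]; abel
  have hc' : Commute (r • M) (r • (H - M)) :=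
    ((hc.symm.sub_right (Commute.refl M)).smul_right r).smul_left r
  rw [e, NormedSpace.exp_add_of_commute hc', mul_assoc, exp_mul_eq_self (C := r • (H - M))]
  rw [smul_mul_assoc, sub_mul, h, sub_self, smul_zero]

end ParameterDerivative

/-! ### Information gained per unit time and information in the first jump. -/

section RateBound

variable {ι : Type} [Fintype ι] [DecidableEq ι] {κ : Type*} [Fintype κ]

/-- The carré du champ of the dissipator: the Leibniz rule on X² fails by the square of the
commutator [X, L]. This is the quadratic term at disposal in `rate_bound`. -/
theorem dissAdj_sq_sub {L X : Matrix ι ι ℂ} (hX : X.IsHermitian) :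
    dissAdj L (X * X) - (dissAdj L X * X + X * dissAdj L X)
      = (X * L - L * X)ᴴ * (X * L - L * X) := by
  simp only [dissAdj_apply, Matrix.conjTranspose_sub, Matrix.conjTranspose_mul, hX.eq, sub_mul,
    mul_sub, Matrix.smul_mul, Matrix.mul_smul, mul_add, add_mul, smul_add, mul_assoc]
  module

/-- The linear term, too, involves X only through [X, L], so Cauchy–Schwarz can play it off against
the carré du champ. -/
theorem trace_mul_dissAdj_re {τ L X : Matrix ι ι ℂ} (hτ : τ.IsHermitian) (hX : X.IsHermitian) :
    (τ * dissAdj L X).trace.re = (τ * (Lᴴ * (X * L - L * X))).trace.re := by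
  have h : (τ * (X * (Lᴴ * L))).trace.re = (τ * (Lᴴ * L * X)).trace.re := by
    have := trace_mul_conjTranspose_mul_re_comm hτ (Lᴴ * L) X
    rw [hX.eq, Matrix.conjTranspose_mul, Matrix.conjTranspose_conjTranspose] at this
    exact this
  rw [dissAdj_apply, mul_sub, Matrix.trace_sub, Complex.sub_re, Matrix.mul_smul, Matrix.trace_smul,
    mul_add, Matrix.trace_add, mul_sub, mul_sub, Matrix.trace_sub, Complex.sub_re]
  have h2 : ((1 / 2 : ℂ) • ((τ * (Lᴴ * L * X)).trace + (τ * (X * (Lᴴ * L))).trace)).re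
      = (τ * (Lᴴ * L * X)).trace.re := by
    rw [smul_eq_mul, show (1 / 2 : ℂ) = ((1 / 2 : ℝ) : ℂ) by push_cast; rfl,
      Complex.re_ofReal_mul, Complex.add_re, h]
    ring
  rw [h2]
  simp only [mul_assoc]

/-- The information gained per unit time from the state `τ` is bounded. -/
theorem rate_bound {L : κ → Matrix ι ι ℂ} {α β : κ → ℝ} (hα : ∀ i, 0 ≤ α i) (hβ : ∀ i, 0 ≤ β i)
    {s : ℝ} (hs : 0 < s) {τ X : Matrix ι ι ℂ} (hτ : τ.PosSemidef) (hX : X.IsHermitian) :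
    2 * (genOp L (fun i => (α i : ℂ)) τ * X).trace.re
      - (τ * (genAdj L (fun i => ((β i + s * α i : ℝ) : ℂ)) (X * X)
        - (genAdj L (fun i => ((β i + s * α i : ℝ) : ℂ)) X * X
          + X * genAdj L (fun i => ((β i + s * α i : ℝ) : ℂ)) X))).trace.re
      ≤ s⁻¹ * ∑ i, α i * (τ * ((L i)ᴴ * L i)).trace.re := by
  have e1 : (genOp L (fun i => (α i : ℂ)) τ * X).trace.re
      = ∑ i, α i * (τ * ((L i)ᴴ * (X * L i - L i * X))).trace.re := by
    rw [trace_genOp_mul, genAdj_apply, Finset.mul_sum, Matrix.trace_sum, Complex.re_sum]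
    refine Finset.sum_congr rfl fun i _ => ?_
    rw [Matrix.mul_smul, Matrix.trace_smul, smul_eq_mul, Complex.re_ofReal_mul,
      trace_mul_dissAdj_re hτ.isHermitian hX]
  have e2 : genAdj L (fun i => ((β i + s * α i : ℝ) : ℂ)) (X * X)
        - (genAdj L (fun i => ((β i + s * α i : ℝ) : ℂ)) X * X
          + X * genAdj L (fun i => ((β i + s * α i : ℝ) : ℂ)) X)
      = ∑ i, ((β i + s * α i : ℝ) : ℂ) • ((X * L i - L i * X)ᴴ * (X * L i - L i * X)) := by
    rw [genAdj_apply, genAdj_apply, Finset.sum_mul, Finset.mul_sum, ← Finset.sum_add_distrib,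
      ← Finset.sum_sub_distrib]
    refine Finset.sum_congr rfl fun i _ => ?_
    rw [← dissAdj_sq_sub hX, Matrix.smul_mul, Matrix.mul_smul, smul_sub, smul_add]
  rw [e1, e2, Finset.mul_sum _ _ τ, Matrix.trace_sum, Complex.re_sum, Finset.mul_sum,
    Finset.mul_sum,
    ← Finset.sum_sub_distrib]
  refine Finset.sum_le_sum fun i _ => ?_
  rw [Matrix.mul_smul, Matrix.trace_smul, smul_eq_mul, Complex.re_ofReal_mul]
  -- Weight s⁻¹ on L leaves weight s on the commutator, which is what the part sα of the rates
  -- supplies.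
  have h1 := two_mul_trace_re_le hτ (L i) (X * L i - L i * X) (inv_pos.2 hs)
  rw [inv_inv] at h1
  have h2 := mul_le_mul_of_nonneg_left h1 (hα i)
  have h3 := mul_nonneg (hβ i) (trace_mul_conjTranspose_mul_nonneg hτ (X * L i - L i * X))
  linarith

theorem posSemidef_smul_one_sub {B : Matrix ι ι ℂ} {b : ℝ} (hb : ‖B‖ ≤ b) :
    (((b ^ 2 : ℝ) : ℂ) • (1 : Matrix ι ι ℂ) - B * Bᴴ).PosSemidef := by
  open scoped MatrixOrder in
  have h : B * Bᴴ ≤ algebraMap ℝ (Matrix ι ι ℂ) ‖B * Bᴴ‖ :=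
    IsSelfAdjoint.le_algebraMap_norm_self (Matrix.isHermitian_mul_conjTranspose_self B)
  have hn : ‖B * Bᴴ‖ ≤ b ^ 2 := by
    refine (norm_mul_le _ _).trans ?_
    rw [Matrix.l2_opNorm_conjTranspose, ← sq]
    gcongr
  have h2 : (((b ^ 2 - ‖B * Bᴴ‖ : ℝ) : ℂ) • (1 : Matrix ι ι ℂ)).PosSemidef :=
    Matrix.PosSemidef.one.smul (by exact_mod_cast sub_nonneg.2 hn)
  have e : (algebraMap ℝ (Matrix ι ι ℂ)) ‖B * Bᴴ‖ = ((‖B * Bᴴ‖ : ℝ) : ℂ) • 1 := by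
    rw [Algebra.algebraMap_eq_smul_one]; ext; simp
  rw [e] at h
  have h1 : (((‖B * Bᴴ‖ : ℝ) : ℂ) • (1 : Matrix ι ι ℂ) - B * Bᴴ).PosSemidef := Matrix.le_iff.1 h
  have e2 : ((b ^ 2 : ℝ) : ℂ) • (1 : Matrix ι ι ℂ) - B * Bᴴ
      = (((‖B * Bᴴ‖ : ℝ) : ℂ) • (1 : Matrix ι ι ℂ) - B * Bᴴ)
        + ((b ^ 2 - ‖B * Bᴴ‖ : ℝ) : ℂ) • (1 : Matrix ι ι ℂ) := by
    push_cast
    rw [sub_smul]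
    abel
  rw [e2]
  exact h1.add h2

/-- Comparison of the information in the first jump with that of the undisturbed state. -/
theorem jump_bound {Y : κ → Matrix ι ι ℂ} {α w : κ → ℝ} (hw : ∀ i, 0 ≤ w i)
    {ρ B V V' : Matrix ι ι ℂ} (hρ : ρ.PosSemidef) (hV : V * ρ = B * ρ)
    (hB : ∀ i, Commute B (Y i)) {Φ b : ℝ} (hb : ‖B‖ ≤ b) (hb0 : 0 < b)
    (hΦ : ∀ X : Matrix ι ι ℂ, X.IsHermitian →
      2 * ∑ i, α i * (Y i * ρ * (Y i)ᴴ * X).trace.re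
        - ∑ i, w i * (Y i * ρ * (Y i)ᴴ * (X * X)).trace.re ≤ Φ)
    {δ : ℝ} (hδ : 0 < δ) (hδ1 : δ < 1) {X : Matrix ι ι ℂ} (hX : X.IsHermitian) :
    2 * (∑ i, α i * (Y i * (V * ρ * Vᴴ) * (Y i)ᴴ * X).trace.re
        + ∑ i, w i * (Y i * (V' * ρ * Vᴴ + V * ρ * V'ᴴ) * (Y i)ᴴ * X).trace.re)
      - ∑ i, w i * (Y i * (V * ρ * Vᴴ) * (Y i)ᴴ * (X * X)).trace.re
      ≤ b ^ 2 / (1 - δ) * Φ + 4 / δ * ∑ i, w i * (ρ * ((Y i * V')ᴴ * (Y i * V'))).trace.re := by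
  -- A fraction δ of the quadratic term pays for the terms containing V', the parameter derivative
  -- of the no-jump amplitude.
  have hA : ∀ i, 2 * (w i * (Y i * (V' * ρ * Vᴴ + V * ρ * V'ᴴ) * (Y i)ᴴ * X).trace.re)
      ≤ δ * (w i * (Y i * (V * ρ * Vᴴ) * (Y i)ᴴ * (X * X)).trace.re)
        + 4 / δ * (w i * (ρ * ((Y i * V')ᴴ * (Y i * V'))).trace.re) := by
    intro i
    have h1 := two_mul_trace_re_le hρ (X * Y i * V) (Y i * V') (half_pos hδ)
    have e1 : (Y i * (V' * ρ * Vᴴ + V * ρ * V'ᴴ) * (Y i)ᴴ * X).trace.re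
        = 2 * (ρ * ((X * Y i * V)ᴴ * (Y i * V'))).trace.re := by
      have a1 : (Y i * (V' * ρ * Vᴴ) * (Y i)ᴴ * X).trace
          = (ρ * ((X * Y i * V)ᴴ * (Y i * V'))).trace := by
        rw [show Y i * (V' * ρ * Vᴴ) * (Y i)ᴴ * X = (Y i * V') * (ρ * (Vᴴ * (Y i)ᴴ * X)) by
          simp only [mul_assoc], Matrix.trace_mul_comm]
        simp only [Matrix.conjTranspose_mul, hX.eq, mul_assoc]
      have a2 : (Y i * (V * ρ * V'ᴴ) * (Y i)ᴴ * X).trace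
          = (ρ * ((Y i * V')ᴴ * (X * Y i * V))).trace := by
        rw [show Y i * (V * ρ * V'ᴴ) * (Y i)ᴴ * X = (Y i * V) * (ρ * (V'ᴴ * (Y i)ᴴ * X)) by
          simp only [mul_assoc], Matrix.trace_mul_comm]
        simp only [Matrix.conjTranspose_mul, mul_assoc]
      rw [mul_add, add_mul, add_mul, Matrix.trace_add, Complex.add_re, a1, a2,
        trace_mul_conjTranspose_mul_re_comm hρ.isHermitian (X * Y i * V) (Y i * V')]
      ring
    have e2 : (Y i * (V * ρ * Vᴴ) * (Y i)ᴴ * (X * X)).trace.re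
        = (ρ * ((X * Y i * V)ᴴ * (X * Y i * V))).trace.re := by
      rw [show Y i * (V * ρ * Vᴴ) * (Y i)ᴴ * (X * X) = (Y i * V) * (ρ * (Vᴴ * (Y i)ᴴ * (X * X))) by
        simp only [mul_assoc], Matrix.trace_mul_comm]
      simp only [Matrix.conjTranspose_mul, hX.eq, mul_assoc]
    rw [e1, e2]
    have h2 := mul_le_mul_of_nonneg_left h1 (mul_nonneg zero_le_two (hw i))
    have e3 : (δ / 2)⁻¹ = 2 / δ := by rw [inv_div]
    rw [e3] at h2
    calc _ = 2 * w i * (2 * (ρ * ((X * Y i * V)ᴴ * (Y i * V'))).trace.re) := by ring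
      _ ≤ _ := h2
      _ = _ := by ring
  -- V acts on ρ as B, and B commutes with every Y i, so B moves from the state to the observable: X
  -- becomes B†XB, at the cost of a factor b² in the quadratic term.
  set Z := Bᴴ * X * B with hZ
  have hN : V * ρ * Vᴴ = B * ρ * Bᴴ := by
    have := congrArg Matrix.conjTranspose hV
    rw [Matrix.conjTranspose_mul, Matrix.conjTranspose_mul, hρ.isHermitian.eq] at this
    rw [hV, mul_assoc, this, mul_assoc]
  have hYB : ∀ i, Y i * (V * ρ * Vᴴ) * (Y i)ᴴ = B * (Y i * ρ * (Y i)ᴴ) * Bᴴ := by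
    intro i
    have h1 : Y i * B = B * Y i := (hB i).symm.eq
    have h2 := congrArg Matrix.conjTranspose h1
    rw [Matrix.conjTranspose_mul, Matrix.conjTranspose_mul] at h2
    rw [hN]
    calc Y i * (B * ρ * Bᴴ) * (Y i)ᴴ = (Y i * B) * ρ * (Bᴴ * (Y i)ᴴ) := by simp only [mul_assoc]
      _ = _ := by rw [h1, h2]; simp only [mul_assoc]
  have hlin : ∀ i, (Y i * (V * ρ * Vᴴ) * (Y i)ᴴ * X).trace.re
      = (Y i * ρ * (Y i)ᴴ * Z).trace.re := by
    intro i
    rw [hYB, show B * (Y i * ρ * (Y i)ᴴ) * Bᴴ * X = B * (Y i * ρ * (Y i)ᴴ * (Bᴴ * X)) by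
      simp only [mul_assoc], Matrix.trace_mul_comm, hZ]
    simp only [mul_assoc]
  have hquad : ∀ i, (Y i * ρ * (Y i)ᴴ * (Z * Z)).trace.re
      ≤ b ^ 2 * (Y i * (V * ρ * Vᴴ) * (Y i)ᴴ * (X * X)).trace.re := by
    intro i
    have hp := trace_mul_re_nonneg (hρ.mul_mul_conjTranspose_same (Y i))
      ((posSemidef_smul_one_sub hb).conjTranspose_mul_mul_same (X * B))
    have e : (X * B)ᴴ * (((b ^ 2 : ℝ) : ℂ) • 1 - B * Bᴴ) * (X * B)
        = ((b ^ 2 : ℝ) : ℂ) • (Bᴴ * (X * X) * B) - Z * Z := by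
      simp only [Matrix.conjTranspose_mul, hX.eq, mul_sub, sub_mul, Matrix.mul_smul,
        Matrix.smul_mul, mul_one, hZ, mul_assoc]
    rw [e, mul_sub, Matrix.trace_sub, Complex.sub_re, Matrix.mul_smul, Matrix.trace_smul,
      smul_eq_mul, Complex.re_ofReal_mul] at hp
    have e2 : (Y i * (V * ρ * Vᴴ) * (Y i)ᴴ * (X * X)).trace
        = (Y i * ρ * (Y i)ᴴ * (Bᴴ * (X * X) * B)).trace := by
      rw [hYB, show B * (Y i * ρ * (Y i)ᴴ) * Bᴴ * (X * X)
        = B * (Y i * ρ * (Y i)ᴴ * (Bᴴ * (X * X))) by simp only [mul_assoc], Matrix.trace_mul_comm]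
      simp only [mul_assoc]
    rw [e2]
    linarith
  -- The hypothesis on Φ is tested on l • Z; this l balances the loss b² of `hquad` against the
  -- fraction 1 - δ of the quadratic term that is left.
  set l := (1 - δ) / b ^ 2 with hl
  have hl0 : 0 < l := div_pos (by linarith) (by positivity)
  have hZh : ((l : ℂ) • Z).IsHermitian := by
    rw [Matrix.IsHermitian, hZ]
    simp only [Matrix.conjTranspose_smul, Matrix.conjTranspose_mul, hX.eq,
      Matrix.conjTranspose_conjTranspose, Complex.star_def, Complex.conj_ofReal, mul_assoc]
  have hΦ' := hΦ _ hZh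
  simp only [Matrix.mul_smul, Matrix.smul_mul, Matrix.trace_smul, smul_eq_mul,
    Complex.re_ofReal_mul] at hΦ'
  have hsum1 : 2 * ∑ i, w i * (Y i * (V' * ρ * Vᴴ + V * ρ * V'ᴴ) * (Y i)ᴴ * X).trace.re
      ≤ δ * ∑ i, w i * (Y i * (V * ρ * Vᴴ) * (Y i)ᴴ * (X * X)).trace.re
        + 4 / δ * ∑ i, w i * (ρ * ((Y i * V')ᴴ * (Y i * V'))).trace.re := by
    rw [Finset.mul_sum, Finset.mul_sum, Finset.mul_sum, ← Finset.sum_add_distrib]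
    exact Finset.sum_le_sum fun i _ => hA i
  have hsum2 : ∑ i, w i * (Y i * ρ * (Y i)ᴴ * (Z * Z)).trace.re
      ≤ b ^ 2 * ∑ i, w i * (Y i * (V * ρ * Vᴴ) * (Y i)ᴴ * (X * X)).trace.re := by
    rw [Finset.mul_sum]
    refine Finset.sum_le_sum fun i _ => ?_
    have := mul_le_mul_of_nonneg_left (hquad i) (hw i)
    linarith
  simp_rw [hlin]
  set S1 := ∑ i, α i * (Y i * ρ * (Y i)ᴴ * Z).trace.re
  set S2 := ∑ i, w i * (Y i * ρ * (Y i)ᴴ * (Z * Z)).trace.re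
  set S3 := ∑ i, w i * (Y i * (V * ρ * Vᴴ) * (Y i)ᴴ * (X * X)).trace.re
  have e1 : ∑ i, α i * (l * (Y i * ρ * (Y i)ᴴ * Z).trace.re) = l * S1 := by
    rw [Finset.mul_sum]; exact Finset.sum_congr rfl fun i _ => by ring
  have e2 : ∑ i, w i * (l * (l * (Y i * ρ * (Y i)ᴴ * (Z * Z)).trace.re)) = l ^ 2 * S2 := by
    rw [Finset.mul_sum]; exact Finset.sum_congr rfl fun i _ => by ring
  rw [e1, e2] at hΦ'
  have h3 : 2 * S1 - l * S2 ≤ l⁻¹ * Φ := by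
    rw [inv_mul_eq_div, le_div_iff₀ hl0]; linarith
  have h4 : l⁻¹ = b ^ 2 / (1 - δ) := by rw [hl, inv_div]
  have h5 : l * S2 ≤ (1 - δ) * S3 := by
    have := mul_le_mul_of_nonneg_left hsum2 hl0.le
    calc _ ≤ _ := this
      _ = _ := by rw [hl]; field_simp
  rw [← h4]
  linarith

end RateBound

/-! ### Upper bound on the Fisher information after a short evolution. -/

section FisherBound

variable {ι : Type} [Fintype ι] [DecidableEq ι] {κ : Type*} [Fintype κ]

/-- The total drift of the shifted jump operators `L i - c i` with rates `w i`. -/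
def drift (L : κ → Matrix ι ι ℂ) (c : κ → ℂ) (w : κ → ℝ) : Matrix ι ι ℂ :=
  ∑ i, (w i : ℂ) • shiftedDrift (L i) (c i)

omit [Fintype κ] in
theorem isHermitian_exp_apply {G : SuperOp ι} (h : ∀ X, (G X)ᴴ = G Xᴴ) (t : ℝ)
    {X : Matrix ι ι ℂ} (hX : X.IsHermitian) :
    (NormedSpace.exp ((t : ℂ) • G) X).IsHermitian := by
  have hn : ∀ n : ℕ, ((G ^ n) X)ᴴ = (G ^ n) X := by
    intro n
    induction n with
    | zero => simpa using hX.eq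
    | succ n ih => rw [pow_succ', SuperOp.mul_apply, h, ih]
  have h1 := (exp_smul_apply G t X).matrix_conjTranspose
  refine h1.unique ?_
  convert exp_smul_apply G t X using 2 with n
  rw [Matrix.conjTranspose_smul, hn]
  congr 1
  simp

theorem conjTranspose_genAdj (L : κ → Matrix ι ι ℂ) (w : κ → ℝ) (X : Matrix ι ι ℂ) :
    (genAdj L (fun i => (w i : ℂ)) X)ᴴ = genAdj L (fun i => (w i : ℂ)) Xᴴ := by
  rw [genAdj_apply, genAdj_apply, Matrix.conjTranspose_sum]
  refine Finset.sum_congr rfl fun i _ => ?_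
  rw [Matrix.conjTranspose_smul, conjTranspose_dissAdj]
  simp

omit [DecidableEq ι] [Fintype κ] in
theorem exists_trace_mul_bound (ρ : Matrix ι ι ℂ) [DecidableEq ι] :
    ∃ c : ℝ, 0 ≤ c ∧ ∀ M : Matrix ι ι ℂ, |(M * ρ).trace.re| ≤ c * ‖M‖ := by
  obtain ⟨c, hc, h⟩ := (traceMul ρ).isBoundedLinearMap.bound
  exact ⟨c, hc.le, fun M => (Complex.abs_re_le_norm _).trans (h M)⟩

theorem hasDerivAt_trace_mul {A B : ℂ → Matrix ι ι ℂ} {A' B' : Matrix ι ι ℂ} {z : ℂ}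
    (hA : HasDerivAt A A' z) (hB : HasDerivAt B B' z) :
    HasDerivAt (fun z => (A z * B z).trace) ((A' * B z).trace + (A z * B').trace) z := by
  have h := (traceMul (1 : Matrix ι ι ℂ)).hasFDerivAt.comp_hasDerivAt z (hA.mul hB)
  simpa [Function.comp_def, Matrix.trace_add] using h

theorem conjTranspose_exp (A : Matrix ι ι ℂ) (r : ℝ) :
    (NormedSpace.exp ((r : ℂ) • A))ᴴ = NormedSpace.exp ((r : ℂ) • Aᴴ) := by
  rw [← Matrix.star_eq_conjTranspose, NormedSpace.star_exp]
  simp [Matrix.star_eq_conjTranspose]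

omit [Fintype ι] [DecidableEq ι] [Fintype κ] in
theorem exists_linear_bound {E : Type*} [NormedAddCommGroup E] [NormedSpace ℂ E] {F : ℂ → E}
    {F' : E} (hF : HasDerivAt F F' 0) (h0 : F 0 = 0) :
    ∃ C ε : ℝ, 0 < C ∧ 0 < ε ∧ ∀ r : ℝ, 0 ≤ r → r ≤ ε → ‖F r‖ ≤ C * r := by
  obtain ⟨C, hC, hb⟩ := hF.isBigO_sub.exists_pos
  obtain ⟨ε, hε, hball⟩ := Metric.eventually_nhds_iff.1 hb.bound
  refine ⟨C, ε / 2, hC, by positivity, fun r hr hrε => ?_⟩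
  have hn : ‖(r : ℂ)‖ = r := by rw [Complex.norm_real, Real.norm_of_nonneg hr]
  have := hball (y := (r : ℂ)) (by rw [dist_zero_right, hn]; linarith)
  simpa [h0, abs_of_nonneg hr] using this

theorem drift_add (L : κ → Matrix ι ι ℂ) (c : κ → ℂ) (α β : κ → ℝ) (s : ℝ) :
    drift L c (fun i => β i + s * α i) = drift L c β + (s : ℂ) • drift L c α := by
  rw [drift, drift, drift, Finset.smul_sum, ← Finset.sum_add_distrib]
  refine Finset.sum_congr rfl fun i _ => ?_
  rw [smul_smul, ← add_smul]
  push_cast; rfl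

theorem genOp_real_add (L : κ → Matrix ι ι ℂ) (α β : κ → ℝ) (s : ℝ) :
    genOp L (fun i => ((β i + s * α i : ℝ) : ℂ))
      = genOp L (fun i => (β i : ℂ)) + (s : ℂ) • genOp L (fun i => (α i : ℂ)) := by
  rw [← genOp_add_smul]
  push_cast; rfl

variable [Nonempty ι]

/-- Upper bound on the quantum Fisher information of a state after a short evolution, if the drift
acts on the initial state as a matrix commuting with the jump operators. -/
theorem exists_fisher_bound {L : κ → Matrix ι ι ℂ} {c : κ → ℂ} {α β : κ → ℝ}
    (hα : ∀ i, 0 ≤ α i) (hβ : ∀ i, 0 ≤ β i) {s : ℝ} (hs : 0 < s) {ρ M : Matrix ι ι ℂ}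
    (hρ : ρ.PosSemidef) (hML : ∀ i, Commute M (L i))
    (hMK : Commute (drift L c fun i => β i + s * α i) M)
    (hMρ : (drift L c fun i => β i + s * α i) * ρ = M * ρ) {Φ : ℝ}
    (hΦ : ∀ X : Matrix ι ι ℂ, X.IsHermitian →
      2 * ∑ i, α i * ((L i - c i • 1) * ρ * (L i - c i • 1)ᴴ * X).trace.re
        - ∑ i, (β i + s * α i) * ((L i - c i • 1) * ρ * (L i - c i • 1)ᴴ * (X * X)).trace.re
        ≤ Φ) :
    ∃ C k t₀ : ℝ, 0 < t₀ ∧ ∀ t : ℝ, 0 < t → t ≤ t₀ → t < 1 ∧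
      ∀ X : Matrix ι ι ℂ, X.IsHermitian →
        2 * (expDeriv (genOp L fun i => (β i : ℂ)) (genOp L fun i => (α i : ℂ)) t s ρ
          * X).trace.re
        - (NormedSpace.exp ((t : ℂ) • ((genOp L fun i => (β i : ℂ)) +
            (s : ℂ) • genOp L fun i => (α i : ℂ))) ρ * (X * X)).trace.re
        ≤ t * (Real.exp (k * t) / (1 - t) * Φ + C * t) := by
  set G₀ := genOp L fun i => (β i : ℂ) with hG₀
  set G₁ := genOp L fun i => (α i : ℂ) with hG₁
  set w : κ → ℝ := fun i => β i + s * α i with hw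
  have hw0 : ∀ i, 0 ≤ w i := fun i => add_nonneg (hβ i) (mul_nonneg hs.le (hα i))
  set G := G₀ + (s : ℂ) • G₁ with hG
  have hGw : G = genOp L fun i => (w i : ℂ) := (genOp_real_add L α β s).symm
  set A₀ := -drift L c β with hA₀
  set A₁ := -drift L c α with hA₁
  set A := A₀ + (s : ℂ) • A₁ with hA
  have hAw : A = -drift L c w := by
    rw [hA, hA₀, hA₁, hw, drift_add, smul_neg, neg_add]
  set Y : κ → Matrix ι ι ℂ := fun i => L i - c i • 1 with hY
  set G' := genAdj L fun i => (w i : ℂ) with hG'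
  have hdual : ∀ ρ X, (G ρ * X).trace = (ρ * G' X).trace := fun ρ X => by
    rw [hGw, trace_genOp_mul]
  have hGY : ∀ (v : κ → ℝ) (ρ : Matrix ι ι ℂ), genOp L (fun i => (v i : ℂ)) ρ
      = ∑ i, (v i : ℂ) • (Y i * ρ * (Y i)ᴴ) - (drift L c v * ρ + ρ * (drift L c v)ᴴ) :=
    fun v ρ => genOp_apply_eq_shifted L v c ρ
  set u : ℂ → SuperOp ι := fun r => NormedSpace.exp (r • G) with hu
  set D : ℂ → SuperOp ι := fun r => expDeriv G₀ G₁ r s with hD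
  set V : ℂ → Matrix ι ι ℂ := fun r => NormedSpace.exp (r • A) with hV
  set E : ℂ → Matrix ι ι ℂ := fun r => expDeriv A₀ A₁ r s with hE
  have hdu : ∀ r, HasDerivAt u (G * u r) r := fun r => hasDerivAt_exp_time G r
  have hdD : ∀ r, HasDerivAt D (G * D r + G₁ * u r) r := fun r => hasDerivAt_expDeriv G₀ G₁ r s
  have hdV : ∀ r, HasDerivAt V (A * V r) r := fun r => hasDerivAt_exp_time A r
  have hdE : ∀ r, HasDerivAt E (A * E r + A₁ * V r) r := fun r => hasDerivAt_expDeriv A₀ A₁ r s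
  -- The adjoint is antiholomorphic; composing with conjugation restores complex differentiability
  -- and keeps the values at real arguments.
  set Vb : ℂ → Matrix ι ι ℂ := star ∘ V ∘ (starRingEnd ℂ) with hVb
  set Eb : ℂ → Matrix ι ι ℂ := star ∘ E ∘ (starRingEnd ℂ) with hEb
  have hVb' : ∀ r : ℝ, Vb r = (V r)ᴴ := fun r => by
    simp [hVb, Matrix.star_eq_conjTranspose]
  have hEb' : ∀ r : ℝ, Eb r = (E r)ᴴ := fun r => by
    simp [hEb, Matrix.star_eq_conjTranspose]
  have hdVb : ∀ r : ℝ, HasDerivAt Vb ((V r)ᴴ * Aᴴ) r := fun r => by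
    have := (hdV r).star_conj
    rwa [Complex.conj_ofReal, Matrix.star_eq_conjTranspose, Matrix.conjTranspose_mul] at this
  have hdEb : ∀ r : ℝ, HasDerivAt Eb ((E r)ᴴ * Aᴴ + (V r)ᴴ * A₁ᴴ) r := fun r => by
    have := (hdE r).star_conj
    rwa [Complex.conj_ofReal, Matrix.star_eq_conjTranspose, Matrix.conjTranspose_add,
      Matrix.conjTranspose_mul, Matrix.conjTranspose_mul] at this
  -- At real times N is the no-jump part of the state and N' its derivative in s.
  set N : ℂ → Matrix ι ι ℂ := fun r => V r * ρ * Vb r with hN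
  set N' : ℂ → Matrix ι ι ℂ := fun r => E r * ρ * Vb r + V r * ρ * Eb r with hN'
  have hNr : ∀ r : ℝ, N r = V r * ρ * (V r)ᴴ := fun r => by rw [← hVb']
  have hN'r : ∀ r : ℝ, N' r = E r * ρ * (V r)ᴴ + V r * ρ * (E r)ᴴ := fun r => by
    rw [← hVb', ← hEb']
  have hdN : ∀ r : ℝ, HasDerivAt N (A * N r + N r * Aᴴ) r := fun r => by
    refine (((hdV r).mul_const ρ).mul (hdVb r)).congr_deriv ?_
    rw [hNr, hVb']
    simp only [mul_assoc]
  have hdN' : ∀ r : ℝ, HasDerivAt N' (A * N' r + N' r * Aᴴ + (A₁ * N r + N r * A₁ᴴ)) r := by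
    intro r
    refine ((((hdE r).mul_const ρ).mul (hdVb r)).add
      (((hdV r).mul_const ρ).mul (hdEb r))).congr_deriv ?_
    rw [hNr, hN'r, hVb', hEb']
    simp only [mul_assoc, mul_add, add_mul]
    abel
  -- The remainder after subtracting the no-jump part: τ is positive, and τ and σ start from 0. They
  -- are driven by J, the jumps out of the no-jump part, and by Q, the derivative of J in s.
  set τ : ℂ → Matrix ι ι ℂ := fun r => u r ρ - N r with hτ
  set σ : ℂ → Matrix ι ι ℂ := fun r => D r ρ - N' r with hσ
  set J : ℝ → Matrix ι ι ℂ := fun r => ∑ i, (w i : ℂ) • (Y i * N r * (Y i)ᴴ) with hJ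
  set Q : ℝ → Matrix ι ι ℂ := fun r => ∑ i, (α i : ℂ) • (Y i * N r * (Y i)ᴴ)
    + ∑ i, (w i : ℂ) • (Y i * N' r * (Y i)ᴴ) with hQ
  have hdτ : ∀ r : ℝ, HasDerivAt τ (G (τ r) + J r) r := by
    intro r
    refine ((SuperOp.hasDerivAt_apply_const (hdu r) ρ).sub (hdN r)).congr_deriv ?_
    have h1 : G (N r) = J r + (A * N r + N r * Aᴴ) := by
      rw [hGw, hGY, hAw, Matrix.conjTranspose_neg, neg_mul, mul_neg, ← neg_add, sub_eq_add_neg]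
    simp only [hτ]
    rw [SuperOp.mul_apply, SuperOp.map_sub, h1]
    abel
  have hdσ : ∀ r : ℝ, HasDerivAt σ (G (σ r) + G₁ (τ r) + Q r) r := by
    intro r
    refine ((SuperOp.hasDerivAt_apply_const (hdD r) ρ).sub (hdN' r)).congr_deriv ?_
    have h1 : G (N' r) = ∑ i, (w i : ℂ) • (Y i * N' r * (Y i)ᴴ) + (A * N' r + N' r * Aᴴ) := by
      rw [hGw, hGY, hAw, Matrix.conjTranspose_neg, neg_mul, mul_neg, ← neg_add, sub_eq_add_neg]
    have h2 : G₁ (N r) = ∑ i, (α i : ℂ) • (Y i * N r * (Y i)ᴴ) + (A₁ * N r + N r * A₁ᴴ) := by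
      rw [hG₁, hGY, hA₁, Matrix.conjTranspose_neg, neg_mul, mul_neg, ← neg_add, sub_eq_add_neg]
    simp only [hτ, hσ, hQ]
    rw [SuperOp.add_apply, SuperOp.mul_apply, SuperOp.mul_apply, SuperOp.map_sub,
      SuperOp.map_sub, h1, h2]
    abel
  have hV0 : V 0 = 1 := by simp [hV]
  have hE0 : E 0 = 0 := expDeriv_zero _ _ _
  have hτ0 : τ 0 = 0 := by
    have h0 : u 0 = 1 := by simp [hu]
    have := hNr 0
    rw [Complex.ofReal_zero, hV0] at this
    simp only [hτ]
    rw [this, h0]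
    simp
  have hσ0 : σ 0 = 0 := by
    have h0 : D 0 = 0 := expDeriv_zero _ _ _
    have := hN'r 0
    rw [Complex.ofReal_zero, hE0] at this
    simp only [hσ]
    rw [this, h0]
    simp
  have hτpos : ∀ r : ℝ, 0 ≤ r → (τ r).PosSemidef := by
    intro r hr
    have h := posSemidef_exp_sub (G := G) (J := Y) (K := drift L c w) hw0
      (fun ρ => by rw [hGw, hGY]) hr hρ
    have e1 : V r = NormedSpace.exp ((r : ℂ) • -drift L c w) := by rw [← hAw]
    have e2 : (V r)ᴴ = NormedSpace.exp ((r : ℂ) • -(drift L c w)ᴴ) := by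
      rw [← Matrix.conjTranspose_neg, ← hAw]; exact conjTranspose_exp A r
    simp only [hτ]
    rw [hNr, e2, e1]
    exact h
  obtain ⟨Cτ, ετ, hCτ, hετ, hτb⟩ := exists_linear_bound (by simpa using hdτ 0) hτ0
  obtain ⟨CE, εE, hCE, hεE, hEb0⟩ := exists_linear_bound (hdE 0) hE0
  choose b hb0 hb using fun i => exists_trace_mul_bound ((L i)ᴴ * L i)
  obtain ⟨cρ, hcρ0, hcρ⟩ := exists_trace_mul_bound ρ
  have htr : ∀ (r : ℝ) (Z : Matrix ι ι ℂ), 0 ≤ r → r ≤ εE →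
      (ρ * ((Z * E r)ᴴ * (Z * E r))).trace.re ≤ cρ * (‖Z‖ ^ 2 * CE ^ 2) * r ^ 2 := by
    intro r Z hr hrε
    rw [Matrix.trace_mul_comm]
    refine (le_abs_self _).trans ((hcρ _).trans ?_)
    rw [mul_assoc]
    refine mul_le_mul_of_nonneg_left ?_ hcρ0
    rw [Matrix.l2_opNorm_conjTranspose_mul_self]
    have h1 : ‖Z * E r‖ ≤ ‖Z‖ * (CE * r) :=
      (norm_mul_le _ _).trans (mul_le_mul_of_nonneg_left (hEb0 r hr hrε) (norm_nonneg _))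
    calc ‖Z * E r‖ * ‖Z * E r‖ ≤ (‖Z‖ * (CE * r)) * (‖Z‖ * (CE * r)) := by gcongr
      _ = _ := by ring
  have hΦ0 : 0 ≤ Φ := by simpa using hΦ 0 Matrix.isHermitian_zero
  set C1 := s⁻¹ * ∑ i, α i * (b i * Cτ) with hC1
  set C2 := ∑ i, w i * (cρ * (‖Y i‖ ^ 2 * CE ^ 2)) with hC2
  set C3 := cρ * (‖(1 : Matrix ι ι ℂ)‖ ^ 2 * CE ^ 2) with hC3
  have hC10 : 0 ≤ C1 := mul_nonneg (inv_pos.2 hs).le (Finset.sum_nonneg fun i _ =>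
    mul_nonneg (hα i) (mul_nonneg (hb0 i) hCτ.le))
  have hC20 : 0 ≤ C2 := Finset.sum_nonneg fun i _ => mul_nonneg (hw0 i) (by positivity)
  refine ⟨C1 + 4 * C2 + 4 * C3, 2 * ‖M‖, min (1 / 2) (min ετ εE), by positivity,
    fun t ht htt => ?_⟩
  have ht1 : t < 1 := lt_of_le_of_lt (htt.trans (min_le_left _ _)) (by norm_num)
  have htτ : t ≤ ετ := htt.trans ((min_le_right _ _).trans (min_le_left _ _))
  have htE : t ≤ εE := htt.trans ((min_le_right _ _).trans (min_le_right _ _))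
  refine ⟨ht1, fun X hX => ?_⟩
  -- Propagating X backwards cancels G in the linear term of f' below; in the quadratic term the
  -- carré du champ survives.
  set x : ℂ → Matrix ι ι ℂ := fun r => NormedSpace.exp (((t : ℂ) - r) • G') X with hx
  have hdx : ∀ r, HasDerivAt x (-G' (x r)) r := by
    intro r
    have h1 := SuperOp.hasDerivAt_apply_const
      ((hasDerivAt_exp_time G' ((t : ℂ) - r)).comp_const_sub (t : ℂ) r) X
    refine h1.congr_deriv ?_
    rfl
  have hxh : ∀ r : ℝ, (x r).IsHermitian := by
    intro r
    have := isHermitian_exp_apply (fun X => conjTranspose_genAdj L w X) (t - r) hX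
    simpa [hx] using this
  have hxt : x t = X := by simp [hx]
  -- f runs from 0 at r = 0 to the objective of the remainder (τ, σ) at r = t. In its derivative,
  -- `rate_bound` handles the terms containing τ and `jump_bound` those containing J and Q.
  set f : ℂ → ℂ := fun r => 2 * (σ r * x r).trace - (τ r * (x r * x r)).trace with hf
  have hdf : ∀ r : ℝ, HasDerivAt f (2 * ((G₁ (τ r) * x r).trace + (Q r * x r).trace)
      - (J r * (x r * x r)).trace
      - (τ r * (G' (x r * x r) - (G' (x r) * x r + x r * G' (x r)))).trace) r := by
    intro r
    refine (((hasDerivAt_trace_mul (hdσ r) (hdx r)).const_mul 2).sub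
      (hasDerivAt_trace_mul (hdτ r) ((hdx r).mul (hdx r)))).congr_deriv ?_
    simp only [add_mul, mul_neg, neg_mul, Matrix.trace_add, Matrix.trace_neg, hdual, mul_sub,
      mul_add, Matrix.trace_sub, Pi.mul_apply]
    ring
  have hbound : ∀ r : ℝ, 0 < r → r < t → (2 * ((G₁ (τ r) * x r).trace + (Q r * x r).trace)
      - (J r * (x r * x r)).trace
      - (τ r * (G' (x r * x r) - (G' (x r) * x r + x r * G' (x r)))).trace).re
      ≤ Real.exp (2 * ‖M‖ * t) / (1 - t) * Φ + (C1 + 4 * C2) * t := by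
    intro r hr hrt
    have h1 : 2 * (G₁ (τ r) * x r).trace.re
        - (τ r * (G' (x r * x r) - (G' (x r) * x r + x r * G' (x r)))).trace.re
        ≤ s⁻¹ * ∑ i, α i * (τ r * ((L i)ᴴ * L i)).trace.re :=
          rate_bound hα hβ hs (hτpos r hr.le) (hxh r)
    have hB : V r * ρ = NormedSpace.exp ((r : ℂ) • -M) * ρ := by
      refine exp_smul_mul_eq ?_ ?_ _
      · rw [hAw]; exact (hMK.neg_left).neg_right
      · rw [hAw, neg_mul, neg_mul, hMρ]
    have hBY : ∀ i, Commute (NormedSpace.exp ((r : ℂ) • -M)) (Y i) := by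
      intro i
      refine Commute.exp_left ?_
      refine Commute.smul_left (Commute.neg_left ?_) _
      exact (hML i).sub_right ((Commute.one_right M).smul_right _)
    have hBn : ‖NormedSpace.exp ((r : ℂ) • -M)‖ ≤ Real.exp (‖M‖ * t) := by
      refine (norm_exp_smul_le_exp_norm _ hr.le).trans ?_
      rw [norm_neg]
      gcongr
    -- The choice δ = t: the factor 1/(1 - t) tends to 1, and the error 4/t times O(t²) is O(t).
    have h2 := jump_bound (V' := E r) hw0 hρ hB hBY hBn (Real.exp_pos _) hΦ ht ht1 (hxh r)
    rw [← hNr, ← hN'r] at h2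
    have h3 : (Q r * x r).trace.re = ∑ i, α i * (Y i * N r * (Y i)ᴴ * x r).trace.re
        + ∑ i, w i * (Y i * N' r * (Y i)ᴴ * x r).trace.re := by
      simp only [hQ, add_mul, Finset.sum_mul, Matrix.trace_add, Matrix.trace_sum, Matrix.smul_mul,
        Matrix.trace_smul, smul_eq_mul, Complex.add_re, Complex.re_sum, Complex.re_ofReal_mul]
    have h4 : (J r * (x r * x r)).trace.re
        = ∑ i, w i * (Y i * N r * (Y i)ᴴ * (x r * x r)).trace.re := by
      simp only [hJ, Finset.sum_mul, Matrix.trace_sum, Matrix.smul_mul,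
        Matrix.trace_smul, smul_eq_mul, Complex.re_sum, Complex.re_ofReal_mul]
    have h5 : s⁻¹ * ∑ i, α i * (τ r * ((L i)ᴴ * L i)).trace.re ≤ C1 * r := by
      rw [hC1, mul_assoc, Finset.sum_mul]
      refine mul_le_mul_of_nonneg_left (Finset.sum_le_sum fun i _ => ?_) (inv_pos.2 hs).le
      rw [mul_assoc, mul_assoc]
      refine mul_le_mul_of_nonneg_left ?_ (hα i)
      exact (le_abs_self _).trans ((hb i _).trans
        (mul_le_mul_of_nonneg_left (hτb r hr.le (hrt.le.trans htτ)) (hb0 i)))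
    have h6 : ∑ i, w i * (ρ * ((Y i * E r)ᴴ * (Y i * E r))).trace.re ≤ C2 * t ^ 2 := by
      have h61 : ∑ i, w i * (ρ * ((Y i * E r)ᴴ * (Y i * E r))).trace.re ≤ C2 * r ^ 2 := by
        rw [hC2, Finset.sum_mul]
        refine Finset.sum_le_sum fun i _ => ?_
        rw [mul_assoc]
        exact mul_le_mul_of_nonneg_left (htr r (Y i) hr.le (hrt.le.trans htE)) (hw0 i)
      exact h61.trans (mul_le_mul_of_nonneg_left (by gcongr) hC20)
    have h7 : 4 / t * ∑ i, w i * (ρ * ((Y i * E r)ᴴ * (Y i * E r))).trace.re ≤ 4 * C2 * t := by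
      calc _ ≤ 4 / t * (C2 * t ^ 2) := mul_le_mul_of_nonneg_left h6 (by positivity)
        _ = _ := by field_simp
    have h8 : Real.exp (‖M‖ * t) ^ 2 = Real.exp (2 * ‖M‖ * t) := by
      rw [← Real.exp_nat_mul]; congr 1; push_cast; ring
    rw [h8] at h2
    have h9 : C1 * r ≤ C1 * t := mul_le_mul_of_nonneg_left hrt.le hC10
    have e : (2 * ((G₁ (τ r) * x r).trace + (Q r * x r).trace)
      - (J r * (x r * x r)).trace
      - (τ r * (G' (x r * x r) - (G' (x r) * x r + x r * G' (x r)))).trace).re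
      = 2 * ((G₁ (τ r) * x r).trace.re + (Q r * x r).trace.re) - (J r * (x r * x r)).trace.re
        - (τ r * (G' (x r * x r) - (G' (x r) * x r + x r * G' (x r)))).trace.re := by
      simp only [Complex.sub_re, Complex.add_re, Complex.mul_re, Complex.re_ofNat,
        Complex.im_ofNat, zero_mul, sub_zero]
    rw [e, h3, h4]
    linarith
  have hmvt := (convex_Icc (0 : ℝ) t).image_sub_le_mul_sub_of_deriv_le
    (f := fun r : ℝ => (f r).re)
    (C := Real.exp (2 * ‖M‖ * t) / (1 - t) * Φ + (C1 + 4 * C2) * t)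
    (fun r _ => (hdf r).real_of_complex.continuousAt.continuousWithinAt)
    (fun r _ => (hdf r).real_of_complex.differentiableAt.differentiableWithinAt)
    (fun r hr => by
      rw [interior_Icc] at hr
      rw [(hdf r).real_of_complex.deriv]
      exact hbound r hr.1 hr.2) 0 (Set.left_mem_Icc.2 ht.le) t (Set.right_mem_Icc.2 ht.le) ht.le
  have hf0 : (f ((0 : ℝ) : ℂ)).re = 0 := by
    simp only [hf, Complex.ofReal_zero, hσ0, hτ0]
    simp
  -- The no-jump part carries no information to first order: its objective is at most 4 tr(ρE†E),
  -- and E = O(t).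
  have hNt : 2 * (N' t * X).trace.re - (N t * (X * X)).trace.re ≤ 4 * C3 * t ^ 2 := by
    have h1 := two_mul_trace_re_le hρ (X * V t) (E t) (one_half_pos (α := ℝ))
    have a1 : (E t * ρ * (V t)ᴴ * X).trace = (ρ * ((X * V t)ᴴ * E t)).trace := by
      rw [show E t * ρ * (V t)ᴴ * X = E t * (ρ * ((V t)ᴴ * X)) by simp only [mul_assoc],
        Matrix.trace_mul_comm]
      simp only [Matrix.conjTranspose_mul, hX.eq, mul_assoc]
    have a2 : (V t * ρ * (E t)ᴴ * X).trace = (ρ * ((E t)ᴴ * (X * V t))).trace := by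
      rw [show V t * ρ * (E t)ᴴ * X = V t * (ρ * ((E t)ᴴ * X)) by simp only [mul_assoc],
        Matrix.trace_mul_comm]
      simp only [mul_assoc]
    have a3 : (V t * ρ * (V t)ᴴ * (X * X)).trace = (ρ * ((X * V t)ᴴ * (X * V t))).trace := by
      rw [show V t * ρ * (V t)ᴴ * (X * X) = V t * (ρ * ((V t)ᴴ * (X * X))) by
        simp only [mul_assoc], Matrix.trace_mul_comm]
      simp only [Matrix.conjTranspose_mul, hX.eq, mul_assoc]
    rw [hN'r, hNr, add_mul, Matrix.trace_add, Complex.add_re, a1, a2, a3,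
      trace_mul_conjTranspose_mul_re_comm hρ.isHermitian (X * V t) (E t)]
    have h2 := htr t 1 ht.le htE
    rw [one_mul] at h2
    linarith
  have hft : (f t).re = 2 * (D t ρ * X).trace.re - (u t ρ * (X * X)).trace.re
      - (2 * (N' t * X).trace.re - (N t * (X * X)).trace.re) := by
    simp only [hf, hxt, hσ, hτ, sub_mul, Matrix.trace_sub, Complex.sub_re, Complex.mul_re,
      Complex.re_ofNat, Complex.im_ofNat, zero_mul, sub_zero]
    ring
  simp only [hf0] at hmvt
  rw [hft] at hmvt
  linarith

end FisherBound

/-! ### Measure-and-reset in the limit of many short rounds. -/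

section MeasureReset

variable {ι : Type} [Fintype ι] [DecidableEq ι] {κ : Type*} [Fintype κ]

/-- The state after time `t` when the rates are `β i + z * α i`. -/
def flow (L : κ → Matrix ι ι ℂ) (α β : κ → ℝ) (t z : ℂ) : SuperOp ι :=
  NormedSpace.exp (t • ((genOp L fun i => (β i : ℂ)) + z • genOp L fun i => (α i : ℂ)))

/-- The derivative of `flow` with respect to the parameter `z`. -/
def flowDeriv (L : κ → Matrix ι ι ℂ) (α β : κ → ℝ) (t z : ℂ) : SuperOp ι :=
  expDeriv (genOp L fun i => (β i : ℂ)) (genOp L fun i => (α i : ℂ)) t z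

/-- The objective whose supremum over Hermitian `X` is the Fisher information rate about `s`. -/
def jumpFisher (Y : κ → Matrix ι ι ℂ) (α β : κ → ℝ) (ρ : Matrix ι ι ℂ) (s : ℝ)
    (X : Matrix ι ι ℂ) : ℝ :=
  2 * ∑ i, α i * (Y i * ρ * (Y i)ᴴ * X).trace.re
    - ∑ i, (β i + s * α i) * (Y i * ρ * (Y i)ᴴ * (X * X)).trace.re

theorem hasDerivAt_flow_sq (L : κ → Matrix ι ι ℂ) (α β : κ → ℝ) (t θ : ℝ) (ρ X : Matrix ι ι ℂ) :
    HasDerivAt (fun θ : ℝ => (flow L α β t ((θ ^ 2 : ℝ) : ℂ) ρ * X).trace.re)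
      ((((2 * θ : ℝ) : ℂ) • flowDeriv L α β t ((θ ^ 2 : ℝ) : ℂ) ρ) * X).trace.re θ := by
  have h1 : HasDerivAt (fun z : ℂ => flow L α β t z) (flowDeriv L α β t ((θ : ℂ) ^ 2))
      ((θ : ℂ) ^ 2) := hasDerivAt_exp_parameter _ _ _ _
  have h2 : HasDerivAt (fun z : ℂ => z ^ 2) (2 * (θ : ℂ)) (θ : ℂ) := by
    simpa using hasDerivAt_pow 2 (θ : ℂ)
  have h3 := HasDerivAt.scomp (h := fun z : ℂ => z ^ 2) (θ : ℂ) h1 h2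
  have h4 := (SuperOp.hasDerivAt_apply_const h3 ρ)
  have h5 := ((traceMul X).hasFDerivAt.comp_hasDerivAt (θ : ℂ) h4).real_of_complex
  convert h5 using 1
  · funext x
    simp
  · simp

theorem posSemidef_flow [Nonempty ι] {L : κ → Matrix ι ι ℂ} {α β : κ → ℝ} (hα : ∀ i, 0 ≤ α i)
    (hβ : ∀ i, 0 ≤ β i) {t s : ℝ} (ht : 0 ≤ t) (hs : 0 ≤ s) {ρ : Matrix ι ι ℂ}
    (hρ : ρ.PosSemidef) : (flow L α β t s ρ).PosSemidef := by
  rw [flow, ← genOp_real_add]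
  exact posSemidef_exp (w := fun i => β i + s * α i)
    (fun i => add_nonneg (hβ i) (mul_nonneg hs (hα i)))
    (fun ρ => genOp_apply_eq_shifted L _ 0 ρ) ht hρ

section QuantumFisher

variable [Nonempty ι] {L : κ → Matrix ι ι ℂ} {α β : κ → ℝ} (hα : ∀ i, 0 ≤ α i)
  (hβ : ∀ i, 0 ≤ β i) {t θ : ℝ} (ht : 0 ≤ t) {ρ : Matrix ι ι ℂ}
  (hρ : ρ.PosSemidef)

include hα hβ ht hρ

/-- Rescaling X by 2θ turns the objective for the parameter θ into 4θ² times the objective for θ².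
-/
theorem quantumFisher_flow_le (hθ : 0 < θ) {B : ℝ} (hB : ∀ X : Matrix ι ι ℂ, X.IsHermitian →
      2 * (flowDeriv L α β t ((θ ^ 2 : ℝ) : ℂ) ρ * X).trace.re
        - (flow L α β t ((θ ^ 2 : ℝ) : ℂ) ρ * (X * X)).trace.re ≤ B) :
    quantumFisher (fun θ : ℝ => flow L α β t ((θ ^ 2 : ℝ) : ℂ) ρ) θ
      ≤ ENNReal.ofReal (4 * θ ^ 2 * B) := by
  refine quantumFisher_le (hasDerivAt_flow_sq L α β t θ ρ)
    (posSemidef_flow hα hβ ht (sq_nonneg θ) hρ) fun X hX => ?_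
  have h2 : (2 * θ) ≠ 0 := by positivity
  set Z := (((2 * θ)⁻¹ : ℝ) : ℂ) • X with hZ
  have hZh : Z.IsHermitian := by
    rw [Matrix.IsHermitian, hZ, Matrix.conjTranspose_smul, hX.eq]; simp
  have hXZ : X = ((2 * θ : ℝ) : ℂ) • Z := by
    rw [hZ, smul_smul, ← Complex.ofReal_mul, mul_inv_cancel₀ h2]; simp
  have h := mul_le_mul_of_nonneg_left (hB Z hZh) (by positivity : 0 ≤ 4 * θ ^ 2)
  refine le_trans (le_of_eq ?_) h
  rw [hXZ]
  simp only [Matrix.smul_mul, Matrix.mul_smul, Matrix.trace_smul, smul_eq_mul,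
    Complex.re_ofReal_mul]
  ring

theorem le_quantumFisher_flow {X : Matrix ι ι ℂ} (hX : X.IsHermitian) :
    ENNReal.ofReal (4 * θ ^ 2 * (2 * (flowDeriv L α β t ((θ ^ 2 : ℝ) : ℂ) ρ * X).trace.re
        - (flow L α β t ((θ ^ 2 : ℝ) : ℂ) ρ * (X * X)).trace.re))
      ≤ quantumFisher (fun θ : ℝ => flow L α β t ((θ ^ 2 : ℝ) : ℂ) ρ) θ := by
  have hZh : (((2 * θ : ℝ) : ℂ) • X).IsHermitian := by
    rw [Matrix.IsHermitian, Matrix.conjTranspose_smul, hX.eq]; simp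
  refine le_trans (ENNReal.ofReal_le_ofReal (le_of_eq ?_))
    (le_quantumFisher (hasDerivAt_flow_sq L α β t θ ρ)
      (fun θ => posSemidef_flow hα hβ ht (sq_nonneg θ) hρ) hZh)
  simp only [Matrix.smul_mul, Matrix.mul_smul, Matrix.trace_smul, smul_eq_mul,
    Complex.re_ofReal_mul]
  ring

end QuantumFisher

/-- An X that annihilates ρ from both sides does not see the drift, so only the jumps contribute,
whatever their shifts. -/
theorem trace_genOp_mul_eq_shifted {L : κ → Matrix ι ι ℂ} (c : κ → ℂ) (w : κ → ℝ)
    {ρ X : Matrix ι ι ℂ} (h1 : X * ρ = 0) (h2 : ρ * X = 0) :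
    (genOp L (fun i => (w i : ℂ)) ρ * X).trace.re
      = ∑ i, w i * ((L i - c i • 1) * ρ * (L i - c i • 1)ᴴ * X).trace.re := by
  rw [genOp_apply_eq_shifted L w c, sub_mul, add_mul, mul_assoc _ ρ X, h2, mul_zero, zero_add,
    Matrix.trace_sub, mul_assoc ρ, Matrix.trace_mul_comm ρ, mul_assoc _ X ρ, h1, mul_zero,
    Matrix.trace_zero, sub_zero, Finset.sum_mul, Matrix.trace_sum, Complex.re_sum]
  refine Finset.sum_congr rfl fun i _ => ?_
  rw [Matrix.smul_mul, Matrix.trace_smul, smul_eq_mul, Complex.re_ofReal_mul]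

theorem hasDerivAt_trace_flowDeriv (L : κ → Matrix ι ι ℂ) (α β : κ → ℝ) (s : ℝ)
    (ρ X : Matrix ι ι ℂ) :
    HasDerivAt (fun t : ℝ => (flowDeriv L α β t s ρ * X).trace.re)
      (genOp L (fun i => (α i : ℂ)) ρ * X).trace.re 0 := by
  have h := hasDerivAt_expDeriv (genOp L fun i => (β i : ℂ)) (genOp L fun i => (α i : ℂ)) 0 s
  rw [expDeriv_zero, mul_zero, zero_add, zero_smul, NormedSpace.exp_zero, mul_one] at h
  have h2 := (traceMul X).hasFDerivAt.comp_hasDerivAt 0 (SuperOp.hasDerivAt_apply_const h ρ)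
  exact HasDerivAt.real_of_complex (z := 0) (by simpa [Function.comp_def] using h2)

theorem hasDerivAt_trace_flow (L : κ → Matrix ι ι ℂ) (α β : κ → ℝ) (s : ℝ)
    (ρ X : Matrix ι ι ℂ) :
    HasDerivAt (fun t : ℝ => (flow L α β t s ρ * X).trace.re)
      (genOp L (fun i => ((β i + s * α i : ℝ) : ℂ)) ρ * X).trace.re 0 := by
  have h := hasDerivAt_exp_time
    ((genOp L fun i => (β i : ℂ)) + (s : ℂ) • genOp L fun i => (α i : ℂ)) 0
  rw [zero_smul, NormedSpace.exp_zero, mul_one, ← genOp_real_add] at h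
  have h2 := (traceMul X).hasFDerivAt.comp_hasDerivAt 0 (SuperOp.hasDerivAt_apply_const h ρ)
  have h3 : HasDerivAt (fun z : ℂ => (flow L α β z s ρ * X).trace)
      (genOp L (fun i => ((β i + s * α i : ℝ) : ℂ)) ρ * X).trace ((0 : ℝ) : ℂ) := by
    simp only [flow]
    rw [← genOp_real_add]
    simpa [Function.comp_def] using h2
  exact h3.real_of_complex

theorem flow_zero (L : κ → Matrix ι ι ℂ) (α β : κ → ℝ) (s : ℂ) : flow L α β 0 s = 1 := by
  simp [flow]

theorem flowDeriv_zero (L : κ → Matrix ι ι ℂ) (α β : κ → ℝ) (s : ℂ) : flowDeriv L α β 0 s = 0 :=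
  expDeriv_zero _ _ _

theorem tendsto_div_nat_nhdsGT {T : ℝ} (hT : 0 < T) :
    Tendsto (fun M : ℕ => T / (M : ℝ)) atTop (𝓝[>] 0) := by
  refine tendsto_nhdsWithin_iff.2 ⟨tendsto_const_nhds.div_atTop tendsto_natCast_atTop_atTop, ?_⟩
  filter_upwards [eventually_gt_atTop 0] with M hM
  have : (0 : ℝ) < M := by exact_mod_cast hM
  exact div_pos hT this

/-- A function vanishing at `0` grows at the rate of its derivative. -/
theorem tendsto_nat_mul_of_hasDerivAt {h : ℝ → ℝ} {h' : ℝ} (hh : HasDerivAt h h' 0) (h0 : h 0 = 0)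
    {T : ℝ} (hT : 0 < T) :
    Tendsto (fun M : ℕ => (M : ℝ) * h (T / M)) atTop (𝓝 (T * h')) := by
  have h1 := (hasDerivAt_iff_tendsto_slope.1 hh).mono_left
    (nhdsWithin_mono 0 (fun x (hx : 0 < x) => hx.ne' : Set.Ioi (0 : ℝ) ⊆ {0}ᶜ))
  refine ((h1.comp (tendsto_div_nat_nhdsGT hT)).const_mul T).congr' ?_
  filter_upwards [eventually_gt_atTop 0] with M hM
  have : (0 : ℝ) < M := by exact_mod_cast hM
  simp only [Function.comp, slope_def_field, h0, sub_zero]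
  field_simp

theorem natCast_mul_ofReal (M : ℕ) (x : ℝ) :
    (M : ℝ≥0∞) * ENNReal.ofReal x = ENNReal.ofReal (M * x) := by
  rw [ENNReal.ofReal_mul (Nat.cast_nonneg M), ENNReal.ofReal_natCast]

/-- The upper bound is `exists_fisher_bound`, whose errors vanish with t = T/n. For the lower bound
a fixed X with Xρ = 0 is enough: its objective vanishes at t = 0 and has slope proportional to
`jumpFisher`, so n times it converges. -/
theorem tendsto_mul_quantumFisher [Nonempty ι] {L : κ → Matrix ι ι ℂ} {c : κ → ℂ} {α β : κ → ℝ}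
    (hα : ∀ i, 0 ≤ α i) (hβ : ∀ i, 0 ≤ β i) {θ : ℝ} (hθ : 0 < θ) {ρ M : Matrix ι ι ℂ}
    (hρ : ρ.PosSemidef) (hML : ∀ i, Commute M (L i))
    (hMK : Commute (drift L c fun i => β i + θ ^ 2 * α i) M)
    (hMρ : (drift L c fun i => β i + θ ^ 2 * α i) * ρ = M * ρ) {Φ : ℝ}
    (hΦ : ∀ X : Matrix ι ι ℂ, X.IsHermitian →
      jumpFisher (fun i => L i - c i • 1) α β ρ (θ ^ 2) X ≤ Φ)
    (hΦ' : ∀ a < Φ, ∃ X : Matrix ι ι ℂ, X.IsHermitian ∧ X * ρ = 0 ∧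
      a < jumpFisher (fun i => L i - c i • 1) α β ρ (θ ^ 2) X) {T : ℝ} (hT : 0 < T) :
    Tendsto (fun n : ℕ => (n : ℝ≥0∞) * quantumFisher
      (fun θ : ℝ => flow L α β ((T / n : ℝ) : ℂ) ((θ ^ 2 : ℝ) : ℂ) ρ) θ) atTop
      (𝓝 (ENNReal.ofReal (4 * θ ^ 2 * (T * Φ)))) := by
  have hθ2 : 0 < θ ^ 2 := by positivity
  obtain ⟨C, k, t₀, ht₀, hC⟩ := exists_fisher_bound hα hβ hθ2 hρ hML hMK hMρ hΦ
  have hlim := tendsto_div_nat_nhdsGT hT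
  have hlim0 : Tendsto (fun n : ℕ => T / (n : ℝ)) atTop (𝓝 0) :=
    tendsto_nhds_of_tendsto_nhdsWithin hlim
  have hup : Tendsto (fun n : ℕ => ENNReal.ofReal (4 * θ ^ 2 *
      (T * (Real.exp (k * (T / n)) / (1 - T / n) * Φ + C * (T / n))))) atTop
      (𝓝 (ENNReal.ofReal (4 * θ ^ 2 * (T * Φ)))) := by
    refine ENNReal.tendsto_ofReal ?_
    have hc : ContinuousAt (fun t : ℝ => 4 * θ ^ 2 *
        (T * (Real.exp (k * t) / (1 - t) * Φ + C * t))) 0 := by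
      have : ContinuousAt (fun t : ℝ => Real.exp (k * t) / (1 - t)) 0 :=
        ContinuousAt.div (by fun_prop) (by fun_prop) (by norm_num)
      fun_prop
    have := hc.tendsto.comp hlim0
    simpa [Function.comp_def] using this
  refine tendsto_order.2 ⟨fun a ha => ?_, fun a ha => ?_⟩
  · obtain ⟨b, hab, hb⟩ : ∃ b < Φ, a < ENNReal.ofReal (4 * θ ^ 2 * (T * b)) := by
      have hc : Tendsto (fun b : ℝ => ENNReal.ofReal (4 * θ ^ 2 * (T * b))) (𝓝[<] Φ)
          (𝓝 (ENNReal.ofReal (4 * θ ^ 2 * (T * Φ)))) := by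
        refine tendsto_nhdsWithin_of_tendsto_nhds (Continuous.tendsto ?_ Φ)
        exact ENNReal.continuous_ofReal.comp (by fun_prop)
      obtain ⟨b, hb1, hb2⟩ := ((hc.eventually (lt_mem_nhds ha)).and self_mem_nhdsWithin).exists
      exact ⟨b, hb2, hb1⟩
    obtain ⟨X, hX, hXρ, hbX⟩ := hΦ' b hab
    have hρX : ρ * X = 0 := by
      have := congrArg Matrix.conjTranspose hXρ
      rwa [Matrix.conjTranspose_mul, hX.eq, hρ.isHermitian.eq, Matrix.conjTranspose_zero] at this
    set h : ℝ → ℝ := fun t => 4 * θ ^ 2 *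
      (2 * (flowDeriv L α β t ((θ ^ 2 : ℝ) : ℂ) ρ * X).trace.re
        - (flow L α β t ((θ ^ 2 : ℝ) : ℂ) ρ * (X * X)).trace.re) with hh
    have hd : HasDerivAt h (4 * θ ^ 2 *
        jumpFisher (fun i => L i - c i • 1) α β ρ (θ ^ 2) X) 0 := by
      have := (((hasDerivAt_trace_flowDeriv L α β (θ ^ 2) ρ X).const_mul 2).sub
        (hasDerivAt_trace_flow L α β (θ ^ 2) ρ (X * X))).const_mul (4 * θ ^ 2)
      rw [trace_genOp_mul_eq_shifted c _ hXρ hρX, trace_genOp_mul_eq_shifted c _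
        (by rw [mul_assoc, hXρ, mul_zero]) (by rw [← mul_assoc, hρX, zero_mul])] at this
      exact this
    have h0 : h 0 = 0 := by
      simp only [hh, Complex.ofReal_zero, flow_zero, flowDeriv_zero, SuperOp.zero_apply,
        SuperOp.one_apply]
      rw [← mul_assoc, hρX]
      simp
    have hlow := ENNReal.tendsto_ofReal (tendsto_nat_mul_of_hasDerivAt hd h0 hT)
    have hlt : a < ENNReal.ofReal (T * (4 * θ ^ 2 *
        jumpFisher (fun i => L i - c i • 1) α β ρ (θ ^ 2) X)) := by
      refine hb.trans_le (ENNReal.ofReal_le_ofReal ?_)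
      calc 4 * θ ^ 2 * (T * b) = T * (4 * θ ^ 2 * b) := by ring
        _ ≤ _ := by gcongr
    filter_upwards [hlow.eventually (lt_mem_nhds hlt)] with n hn
    refine hn.trans_le ?_
    rw [← natCast_mul_ofReal]
    gcongr
    exact le_quantumFisher_flow hα hβ (by positivity) hρ hX
  · have hev : ∀ᶠ n : ℕ in atTop, T / (n : ℝ) ∈ Set.Ioc 0 t₀ :=
      hlim.eventually (Ioc_mem_nhdsGT ht₀)
    filter_upwards [hup.eventually (gt_mem_nhds ha), hev, eventually_gt_atTop 0] with n hn1 hn2 hn3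
    have hn3' : (0 : ℝ) < n := by exact_mod_cast hn3
    refine lt_of_le_of_lt ?_ hn1
    have := quantumFisher_flow_le hα hβ hn2.1.le hρ hθ (hC _ hn2.1 hn2.2).2
    calc _ ≤ (n : ℝ≥0∞) * _ := mul_le_mul_right this _
      _ = _ := by
        rw [natCast_mul_ofReal]
        congr 1
        field_simp

end MeasureReset

/-! ### The jump information for vanishing signal. -/

section VanishingSignal

variable {ι : Type} [Fintype ι] [DecidableEq ι]

omit [DecidableEq ι] in
theorem trace_jump_mul (Y ρ X : Matrix ι ι ℂ) :
    (Y * ρ * Yᴴ * X).trace = (ρ * (Yᴴ * (X * Y))).trace := by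
  rw [mul_assoc, mul_assoc, Matrix.trace_mul_comm]
  simp only [mul_assoc]

/-- Compressing `X` to the complement of the initial state does not decrease the objective. -/
theorem jumpFisher_le_compress {κ : Type*} [Fintype κ] {Y : κ → Matrix ι ι ℂ} {α β : κ → ℝ}
    (hα : ∀ i, 0 ≤ α i) (hβ : ∀ i, 0 ≤ β i) {ρ : Matrix ι ι ℂ} (hρ : ρ.PosSemidef)
    (hρ2 : ρ * ρ = ρ) (hY : ∀ i, ρ * Y i * ρ = 0) {s : ℝ} (hs : 0 ≤ s) {X : Matrix ι ι ℂ}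
    (hX : X.IsHermitian) :
    jumpFisher Y α β ρ s X ≤ jumpFisher Y α β ρ s ((1 - ρ) * X * (1 - ρ)) := by
  -- Centred jumps send ρ into its orthogonal complement, so compressing an observable to that
  -- complement does not change its trace against the states after a jump.
  have h1 : ∀ i, ρ * (Y i * ρ * (Y i)ᴴ) = 0 := fun i => by
    rw [← mul_assoc, ← mul_assoc, hY, zero_mul]
  have h2 : ∀ i, (Y i * ρ * (Y i)ᴴ) * ρ = 0 := fun i => by
    have := congrArg Matrix.conjTranspose (h1 i)
    simpa [Matrix.conjTranspose_mul, hρ.isHermitian.eq, mul_assoc] using this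
  have hQ1 : ∀ i, (1 - ρ) * (Y i * ρ * (Y i)ᴴ) = Y i * ρ * (Y i)ᴴ := fun i => by
    rw [sub_mul, one_mul, h1, sub_zero]
  have hQ2 : ∀ i, (Y i * ρ * (Y i)ᴴ) * (1 - ρ) = Y i * ρ * (Y i)ᴴ := fun i => by
    rw [mul_sub, mul_one, h2, sub_zero]
  have key : ∀ i (Z : Matrix ι ι ℂ), (Y i * ρ * (Y i)ᴴ * ((1 - ρ) * Z * (1 - ρ))).trace
      = (Y i * ρ * (Y i)ᴴ * Z).trace := fun i Z => by
    rw [← mul_assoc, ← mul_assoc, hQ2, Matrix.trace_mul_comm, ← mul_assoc, hQ1]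
  have hQQ : (1 - ρ) * (1 - ρ) = 1 - ρ := by
    rw [mul_sub, sub_mul, sub_mul, hρ2]; simp
  rw [jumpFisher, jumpFisher]
  refine sub_le_sub (le_of_eq ?_) (Finset.sum_le_sum fun i _ => ?_)
  · simp only [key]
  · refine mul_le_mul_of_nonneg_left ?_ (add_nonneg (hβ i) (mul_nonneg hs (hα i)))
    -- With Q = 1 - ρ, (QXQ)² = Q(X² - XρX)Q, and the subtracted term is positive: the quadratic
    -- cost can only fall.
    have e : (1 - ρ) * X * (1 - ρ) * ((1 - ρ) * X * (1 - ρ))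
        = (1 - ρ) * (X * X - (ρ * X)ᴴ * (ρ * X)) * (1 - ρ) := by
      have : (ρ * X)ᴴ * (ρ * X) = X * ρ * X := by
        rw [Matrix.conjTranspose_mul, hX.eq, hρ.isHermitian.eq, mul_assoc, ← mul_assoc ρ, hρ2,
          mul_assoc]
      rw [this]
      calc _ = (1 - ρ) * X * ((1 - ρ) * (1 - ρ)) * X * (1 - ρ) := by noncomm_ring
        _ = _ := by rw [hQQ]; noncomm_ring
    rw [e, key, mul_sub, Matrix.trace_sub, Complex.sub_re]
    have := trace_mul_conjTranspose_mul_nonneg (hρ.mul_mul_conjTranspose_same (Y i)) (ρ * X)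
    linarith

variable {K N : ℕ}

omit [DecidableEq ι] in
theorem jumpFisher_sum_elim (Y : Fin K → Matrix ι ι ℂ) (Z : Fin N → Matrix ι ι ℂ) (γ : Fin N → ℝ)
    (ρ : Matrix ι ι ℂ) (s : ℝ) (X : Matrix ι ι ℂ) :
    jumpFisher (Sum.elim Y Z) (Sum.elim 1 0) (Sum.elim 0 γ) ρ s X
      = ∑ j, (2 * (ρ * ((Y j)ᴴ * (X * Y j))).trace.re
        - s * (ρ * ((Y j)ᴴ * (X * X * Y j))).trace.re)
        - ∑ k, γ k * (ρ * ((Z k)ᴴ * (X * X * Z k))).trace.re := by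
  simp only [jumpFisher, Fintype.sum_sum_type, Sum.elim_inl, Sum.elim_inr, trace_jump_mul,
    Pi.one_apply, Pi.zero_apply, zero_mul, one_mul, Finset.sum_const_zero, add_zero, mul_one,
    zero_add, mul_zero, Finset.sum_sub_distrib, Finset.mul_sum]
  ring

/-- One factor Y_j of the linear term is split into B_j and noise operators. Cauchy–Schwarz charges
the B_j part to the signal term of weight s, at the price s⁻¹ tr(ρB†B), and the noise part to the
noise term, whose weight does not depend on s; the latter costs only a constant. -/
theorem exists_jumpFisher_bound {Y B : Fin K → Matrix ι ι ℂ} {Z : Fin N → Matrix ι ι ℂ}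
    {m : Fin K → Fin N → ℂ} (hY : ∀ j, Y j = B j + ∑ k, m j k • Z k) {γ : Fin N → ℝ}
    (hγ : ∀ k, 0 < γ k) {ρ : Matrix ι ι ℂ} (hρ : ρ.PosSemidef) :
    ∃ C : ℝ, ∀ s : ℝ, 0 < s → ∀ X : Matrix ι ι ℂ, X.IsHermitian →
      jumpFisher (Sum.elim Y Z) (Sum.elim 1 0) (Sum.elim 0 γ) ρ s X
        ≤ s⁻¹ * ∑ j, (ρ * ((B j)ᴴ * B j)).trace.re + C := by
  -- Each of the K signals uses the share γ k / (K + 1) of the noise term, so together they stay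
  -- below γ k; the denominator is nonzero also for K = 0.
  refine ⟨∑ j, ∑ k, (γ k / (K + 1))⁻¹ *
    (ρ * ((star (m j k) • Y j)ᴴ * (star (m j k) • Y j))).trace.re,
    fun s hs X hX => ?_⟩
  rw [jumpFisher_sum_elim]
  have hq : ∀ A : Matrix ι ι ℂ, Aᴴ * (X * X * A) = (X * A)ᴴ * (X * A) := fun A => by
    rw [Matrix.conjTranspose_mul, hX.eq]; simp only [mul_assoc]
  have hj : ∀ j, 2 * (ρ * ((Y j)ᴴ * (X * Y j))).trace.re
        - s * (ρ * ((Y j)ᴴ * (X * X * Y j))).trace.re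
      ≤ s⁻¹ * (ρ * ((B j)ᴴ * B j)).trace.re
        + ∑ k, (γ k / (K + 1) * (ρ * ((X * Z k)ᴴ * (X * Z k))).trace.re
          + (γ k / (K + 1))⁻¹ *
            (ρ * ((star (m j k) • Y j)ᴴ * (star (m j k) • Y j))).trace.re) := by
    intro j
    have e : (Y j)ᴴ * (X * Y j)
        = (B j)ᴴ * (X * Y j) + ∑ k, (X * Z k)ᴴ * (star (m j k) • Y j) := by
      conv_lhs => rw [hY j, Matrix.conjTranspose_add, add_mul, Matrix.conjTranspose_sum,
        Finset.sum_mul, ← hY j]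
      congr 1
      refine Finset.sum_congr rfl fun k _ => ?_
      rw [Matrix.conjTranspose_smul, Matrix.conjTranspose_mul, hX.eq]
      simp only [Matrix.smul_mul, Matrix.mul_smul, mul_assoc]
    have h1 := two_mul_trace_re_le hρ (B j) (X * Y j) (inv_pos.2 hs)
    have h2 := fun k => two_mul_trace_re_le hρ (X * Z k) (star (m j k) • Y j)
      (div_pos (hγ k) (by positivity : (0 : ℝ) < K + 1))
    have h3 := Finset.sum_le_sum fun k (_ : k ∈ Finset.univ) => h2 k
    rw [inv_inv] at h1
    rw [hq, e, mul_add, Matrix.trace_add, Complex.add_re, Finset.mul_sum, Matrix.trace_sum,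
      Complex.re_sum, mul_add, Finset.mul_sum]
    linarith
  have hk : ∀ k, 0 ≤ γ k * (ρ * ((X * Z k)ᴴ * (X * Z k))).trace.re
      - ∑ _j : Fin K, γ k / (K + 1) * (ρ * ((X * Z k)ᴴ * (X * Z k))).trace.re := fun k => by
    have h0 := trace_mul_conjTranspose_mul_nonneg hρ (X * Z k)
    have hK : (0 : ℝ) < K + 1 := by positivity
    rw [Finset.sum_const, Finset.card_univ, Fintype.card_fin, nsmul_eq_mul]
    have : γ k * (ρ * ((X * Z k)ᴴ * (X * Z k))).trace.re
        - (K : ℝ) * (γ k / (K + 1) * (ρ * ((X * Z k)ᴴ * (X * Z k))).trace.re)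
        = γ k / (K + 1) * (ρ * ((X * Z k)ᴴ * (X * Z k))).trace.re := by
      field_simp; ring
    rw [this]
    exact mul_nonneg (div_pos (hγ k) hK).le h0
  have h1 := Finset.sum_le_sum fun j (_ : j ∈ Finset.univ) => hj j
  have h2 := Finset.sum_nonneg fun k (_ : k ∈ Finset.univ) => hk k
  simp only [Finset.sum_add_distrib, Finset.sum_sub_distrib] at h1 h2
  rw [Finset.sum_comm (s := (Finset.univ : Finset (Fin N)))] at h2
  simp only [hq, ← Finset.mul_sum, Finset.sum_sub_distrib] at h1 h2 ⊢
  linarith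

/-- P erases the noise components of Y_j ρ and keeps B_j ρ. -/
theorem trace_jump_projector {Y B : Fin K → Matrix ι ι ℂ} {Z : Fin N → Matrix ι ι ℂ}
    {m : Fin K → Fin N → ℂ} (hY : ∀ j, Y j = B j + ∑ k, m j k • Z k)
    {ρ P : Matrix ι ι ℂ} (hPZ : ∀ k, P * (Z k * ρ) = 0)
    (hPB : ∀ j, P * (B j * ρ) = B j * ρ) (hρ : ρ.IsHermitian) (hP : P.IsHermitian) (j : Fin K) :
    (ρ * ((Y j)ᴴ * (P * Y j))).trace = (ρ * ((B j)ᴴ * B j)).trace := by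
  have hT : ∀ A : Matrix ι ι ℂ, (ρ * (Aᴴ * (P * A))).trace = (Aᴴ * (P * (A * ρ))).trace :=
    fun A => by rw [Matrix.trace_mul_comm]; simp only [mul_assoc]
  have hYρ : ∀ j, P * (Y j * ρ) = B j * ρ := fun j => by
    rw [hY j, add_mul, mul_add, hPB, Finset.sum_mul, Finset.mul_sum, Finset.sum_eq_zero, add_zero]
    intro k _
    rw [Matrix.smul_mul, Matrix.mul_smul, hPZ, smul_zero]
  have h := congrArg Matrix.conjTranspose (hYρ j)
  simp only [Matrix.conjTranspose_mul, hρ.eq, hP.eq] at h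
  calc _ = ((Y j)ᴴ * (P * (B j * ρ))).trace := by rw [hT, hYρ, hPB]
    _ = (ρ * (Y j)ᴴ * P * B j).trace := by
      rw [← mul_assoc, ← mul_assoc, Matrix.trace_mul_comm]; simp only [mul_assoc]
    _ = _ := by rw [h, mul_assoc]

/-- The multiple x = s⁻¹ of P maximizes 2x - sx² and attains the leading term of
`exists_jumpFisher_bound`. -/
theorem jumpFisher_projector {Y B : Fin K → Matrix ι ι ℂ} {Z : Fin N → Matrix ι ι ℂ}
    {m : Fin K → Fin N → ℂ} (hY : ∀ j, Y j = B j + ∑ k, m j k • Z k) (γ : Fin N → ℝ)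
    {ρ P : Matrix ι ι ℂ} (hP2 : P * P = P) (hPZ : ∀ k, P * (Z k * ρ) = 0)
    (hPB : ∀ j, P * (B j * ρ) = B j * ρ) (hρ : ρ.IsHermitian) (hP : P.IsHermitian)
    {s : ℝ} (hs : 0 < s) :
    jumpFisher (Sum.elim Y Z) (Sum.elim 1 0) (Sum.elim 0 γ) ρ s (((s⁻¹ : ℝ) : ℂ) • P)
      = s⁻¹ * ∑ j, (ρ * ((B j)ᴴ * B j)).trace.re := by
  rw [jumpFisher_sum_elim]
  have hs2 : ((s⁻¹ : ℝ) : ℂ) • P * ((s⁻¹ : ℝ) : ℂ) • P = ((s⁻¹ ^ 2 : ℝ) : ℂ) • P := by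
    rw [Matrix.smul_mul, Matrix.mul_smul, hP2, smul_smul, ← Complex.ofReal_mul, sq]
  simp only [hs2, Matrix.smul_mul, Matrix.mul_smul, Matrix.trace_smul, smul_eq_mul,
    Complex.re_ofReal_mul, trace_jump_projector hY hPZ hPB hρ hP]
  have hZ : ∀ k, (ρ * ((Z k)ᴴ * (P * Z k))).trace = 0 := fun k => by
    rw [Matrix.trace_mul_comm, mul_assoc, mul_assoc, hPZ, mul_zero, Matrix.trace_zero]
  simp only [hZ, Complex.zero_re, mul_zero, Finset.sum_const_zero, sub_zero]
  rw [Finset.mul_sum]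
  refine Finset.sum_congr rfl fun j _ => ?_
  field_simp
  ring

/-- The vanishing-signal limit of the measure-and-reset Fisher information. -/
theorem exists_tendsto_mul_quantumFisher [Nonempty ι] {κ : Type*} [Fintype κ]
    {L : κ → Matrix ι ι ℂ} {c : κ → ℂ}
    {α β : κ → ℝ} (hα : ∀ i, 0 ≤ α i) (hβ : ∀ i, 0 ≤ β i) {ρ : Matrix ι ι ℂ} (hρ : ρ.PosSemidef)
    (hρ2 : ρ * ρ = ρ) (hY : ∀ i, ρ * (L i - c i • 1) * ρ = 0)
    (hM : ∀ w : κ → ℝ, ∃ M, (∀ i, Commute M (L i)) ∧ Commute (drift L c w) M ∧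
      drift L c w * ρ = M * ρ) {b C : ℝ}
    (hup : ∀ s : ℝ, 0 < s → ∀ X : Matrix ι ι ℂ, X.IsHermitian →
      jumpFisher (fun i => L i - c i • 1) α β ρ s X ≤ s⁻¹ * b + C)
    (hlow : ∀ s : ℝ, 0 < s → ∃ X : Matrix ι ι ℂ, X.IsHermitian ∧
      jumpFisher (fun i => L i - c i • 1) α β ρ s X = s⁻¹ * b) {T : ℝ} (hT : 0 < T) :
    ∃ g : ℝ → ℝ≥0∞,
      (∀ θ : ℝ, 0 < θ → Tendsto (fun n : ℕ => (n : ℝ≥0∞) * quantumFisher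
        (fun θ : ℝ => flow L α β ((T / n : ℝ) : ℂ) ((θ ^ 2 : ℝ) : ℂ) ρ) θ) atTop (𝓝 (g θ))) ∧
      Tendsto g (𝓝[>] 0) (𝓝 (ENNReal.ofReal (4 * T * b))) := by
  set S : ℝ → Set ℝ := fun s =>
    jumpFisher (fun i => L i - c i • 1) α β ρ s '' {X | X.IsHermitian} with hS
  have hne : ∀ s, (S s).Nonempty := fun s => ⟨_, 0, Matrix.isHermitian_zero, rfl⟩
  have hbdd : ∀ s, 0 < s → BddAbove (S s) := fun s hs =>
    ⟨s⁻¹ * b + C, by rintro _ ⟨X, hX, rfl⟩; exact hup s hs X hX⟩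
  set Φ : ℝ → ℝ := fun s => sSup (S s) with hΦ
  have hΦup : ∀ s, 0 < s → Φ s ≤ s⁻¹ * b + C := fun s hs =>
    csSup_le (hne s) (by rintro _ ⟨X, hX, rfl⟩; exact hup s hs X hX)
  have hΦlow : ∀ s, 0 < s → s⁻¹ * b ≤ Φ s := fun s hs => by
    obtain ⟨X, hX, h⟩ := hlow s hs
    exact h ▸ le_csSup (hbdd s hs) ⟨X, hX, rfl⟩
  -- Multiplying s⁻¹b ≤ Φ s ≤ s⁻¹b + C by 4Ts at s = θ² confines the argument of `ENNReal.ofReal`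
  -- between 4Tb and 4Tb + 4TCθ².
  refine ⟨fun θ => ENNReal.ofReal (4 * θ ^ 2 * (T * Φ (θ ^ 2))), fun θ hθ => ?_, ?_⟩
  · have hθ2 : 0 < θ ^ 2 := by positivity
    obtain ⟨M, hML, hMK, hMρ⟩ := hM fun i => β i + θ ^ 2 * α i
    refine tendsto_mul_quantumFisher hα hβ hθ hρ hML hMK hMρ
      (fun X hX => le_csSup (hbdd _ hθ2) ⟨X, hX, rfl⟩) (fun a ha => ?_) hT
    obtain ⟨_, ⟨X, hX, rfl⟩, haX⟩ := exists_lt_of_lt_csSup (hne _) ha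
    have hX' : X.IsHermitian := hX
    refine ⟨(1 - ρ) * X * (1 - ρ), ?_, ?_,
      haX.trans_le (jumpFisher_le_compress hα hβ hρ hρ2 hY hθ2.le hX)⟩
    · rw [Matrix.IsHermitian, Matrix.conjTranspose_mul, Matrix.conjTranspose_mul, hX'.eq,
        Matrix.conjTranspose_sub, Matrix.conjTranspose_one, hρ.isHermitian.eq, mul_assoc]
    · rw [mul_assoc, sub_mul 1 ρ ρ, hρ2, one_mul, sub_self, mul_zero]
  · refine ENNReal.tendsto_ofReal ?_
    have h1 : Tendsto (fun θ : ℝ => 4 * T * b + 4 * T * C * θ ^ 2) (𝓝[>] 0) (𝓝 (4 * T * b)) := by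
      have : ContinuousAt (fun θ : ℝ => 4 * T * b + 4 * T * C * θ ^ 2) 0 := by fun_prop
      have := this.tendsto.mono_left (nhdsWithin_le_nhds (s := Set.Ioi (0 : ℝ)))
      simpa using this
    refine tendsto_of_tendsto_of_tendsto_of_le_of_le' tendsto_const_nhds h1 ?_ ?_
    · filter_upwards [self_mem_nhdsWithin] with θ (hθ : 0 < θ)
      have hθ2 : 0 < θ ^ 2 := by positivity
      have h2 : 4 * T * b = 4 * θ ^ 2 * (T * ((θ ^ 2)⁻¹ * b)) := by field_simp
      rw [h2]
      have := hΦlow _ hθ2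
      gcongr
    · filter_upwards [self_mem_nhdsWithin] with θ (hθ : 0 < θ)
      have hθ2 : 0 < θ ^ 2 := by positivity
      have h2 : 4 * T * b + 4 * T * C * θ ^ 2 = 4 * θ ^ 2 * (T * ((θ ^ 2)⁻¹ * b + C)) := by
        field_simp
      rw [h2]
      have := hΦup _ hθ2
      gcongr

end VanishingSignal

/-! ### Orthogonal projections and orthogonal components of operators. -/

section Projector

/-- The orthogonal projection onto the complement of a subspace, as a matrix. -/
theorem exists_orthogonal_projector {n : Type} [Fintype n] [DecidableEq n]
    (U : Submodule ℂ (n → ℂ)) :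
    ∃ P : Matrix n n ℂ, P.IsHermitian ∧ P * P = P ∧ (∀ u ∈ U, P *ᵥ u = 0) ∧
      ∀ v, v - P *ᵥ v ∈ U := by
  set U' : Submodule ℂ (EuclideanSpace ℂ n) := U.comap (WithLp.linearEquiv 2 ℂ (n → ℂ)).toLinearMap
  have hs : IsStarProjection U'ᗮ.starProjection := isStarProjection_starProjection
  set e := Matrix.toEuclideanCLM (n := n) (𝕜 := ℂ)
  obtain ⟨P, hP⟩ := e.surjective U'ᗮ.starProjection
  replace hP : e P = U'ᗮ.starProjection := hP
  have happ : ∀ v, P *ᵥ v = WithLp.ofLp (U'ᗮ.starProjection (WithLp.toLp 2 v)) := fun v => by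
    rw [← hP]; rfl
  refine ⟨P, ?_, ?_, fun u hu => ?_, fun v => ?_⟩
  · refine e.injective ?_
    change e _ = e _
    rw [← Matrix.star_eq_conjTranspose, map_star, hP, hs.isSelfAdjoint.star_eq]
  · refine e.injective ?_
    change e _ = e _
    rw [map_mul, hP, hs.isIdempotentElem.eq]
  · rw [happ, Submodule.starProjection_orthogonal_apply_eq_zero]
    · rfl
    · exact hu
  · have h : WithLp.toLp 2 v - U'ᗮ.starProjection (WithLp.toLp 2 v) ∈ U' := by
      have h2 := U'.starProjection_add_starProjection_orthogonal (WithLp.toLp 2 v)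
      have h3 : WithLp.toLp 2 v - U'ᗮ.starProjection (WithLp.toLp 2 v)
          = U'.starProjection (WithLp.toLp 2 v) := by
        rw [sub_eq_iff_eq_add]; exact h2.symm
      rw [h3]
      exact Submodule.starProjection_apply_mem _ _
    rw [happ]
    exact h

theorem projector_mulVec_eq_self {n : Type} [Fintype n] [DecidableEq n]
    {U : Submodule ℂ (n → ℂ)} {P : Matrix n n ℂ} (hP : P.IsHermitian)
    (hU : ∀ u ∈ U, P *ᵥ u = 0) (hP' : ∀ v, v - P *ᵥ v ∈ U) {v : n → ℂ}
    (hv : ∀ u ∈ U, star u ⬝ᵥ v = 0) : P *ᵥ v = v := by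
  have h1 := hv _ (hP' v)
  have h2 : star (v - P *ᵥ v) ⬝ᵥ (P *ᵥ v) = 0 := by
    have h := Matrix.star_mulVec P (v - P *ᵥ v)
    rw [hU _ (hP' v), star_zero, hP.eq] at h
    rw [Matrix.dotProduct_mulVec, ← h, zero_dotProduct]
  have h3 : star (v - P *ᵥ v) ⬝ᵥ (v - P *ᵥ v) = 0 := by
    rw [dotProduct_sub, h1, h2, sub_zero]
  exact (sub_eq_zero.1 (dotProduct_star_self_eq_zero.1 h3)).symm

/-- Vectorization turns tr(X†Y) into the standard inner product, where the projection onto the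
complement is available. -/
theorem exists_isOrthogonalComponent {d : ℕ} (S : Submodule ℂ (Matrix (Fin d) (Fin d) ℂ))
    (L : Matrix (Fin d) (Fin d) ℂ) : ∃ B, IsOrthogonalComponent S L B := by
  set f : Matrix (Fin d) (Fin d) ℂ →ₗ[ℂ] (Fin d × Fin d → ℂ) :=
    { toFun := Matrix.vec, map_add' := Matrix.vec_add, map_smul' := fun c A => Matrix.vec_smul c A }
  have hf : ∀ A, f A = Matrix.vec A := fun A => rfl
  obtain ⟨P, hP, -, hU, hP'⟩ := exists_orthogonal_projector (S.map f)
  obtain ⟨B, hB⟩ := Matrix.vec_bijective.2 (P *ᵥ f L)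
  refine ⟨B, ?_, fun X hX => ?_⟩
  · obtain ⟨Y, hY, hYL⟩ := hP' (f L)
    rw [← hB, hf, hf, ← Matrix.vec_sub] at hYL
    exact Matrix.vec_inj.1 hYL ▸ hY
  · rw [← Matrix.star_vec_dotProduct_vec, hB, Matrix.dotProduct_mulVec, ← hP.eq,
      ← Matrix.star_mulVec, ← hf, hU _ ⟨X, hX, rfl⟩, star_zero, zero_dotProduct]

theorem IsOrthogonalComponent.eq_zero_iff {d : ℕ} {S : Submodule ℂ (Matrix (Fin d) (Fin d) ℂ)}
    {L B : Matrix (Fin d) (Fin d) ℂ} (h : IsOrthogonalComponent S L B) : B = 0 ↔ L ∈ S := by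
  refine ⟨fun hB => by simpa [hB] using h.1, fun hL => ?_⟩
  have hB : B ∈ S := by simpa using S.sub_mem hL h.1
  exact Matrix.trace_conjTranspose_mul_self_eq_zero_iff.1 (h.2 B hB)

theorem trace_conjTranspose_mul_self_re_nonneg {n : Type*} [Fintype n] (B : Matrix n n ℂ) :
    0 ≤ (Bᴴ * B).trace.re :=
  (Complex.le_def.1 (Matrix.posSemidef_conjTranspose_mul_self B).trace_nonneg).1

theorem trace_conjTranspose_mul_self_re_pos {n : Type*} [Fintype n] {B : Matrix n n ℂ}
    (hB : B ≠ 0) : 0 < (Bᴴ * B).trace.re := by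
  refine lt_of_le_of_ne (trace_conjTranspose_mul_self_re_nonneg B) fun h => hB ?_
  refine Matrix.trace_conjTranspose_mul_self_eq_zero_iff.1 (Complex.ext h.symm ?_)
  exact (Complex.le_def.1 (Matrix.posSemidef_conjTranspose_mul_self B).trace_nonneg).2.symm

end Projector

/-! ### Maximally entangled states. -/

section Bell

variable {d : ℕ}

/-- The pure state with amplitudes `vec U / √d`. -/
def entangledState (U : Matrix (Fin d) (Fin d) ℂ) : Matrix (Fin d × Fin d) (Fin d × Fin d) ℂ :=
  (1 / d : ℂ) • Matrix.vecMulVec (Matrix.vec U) (star (Matrix.vec U))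

/-- With the basis vectors as columns of W, the amplitudes are √d⁻¹ times the entries of WWᵀ, which
is unitary. All Bell states are therefore covered by vec U with U unitary. -/
theorem exists_bellState_eq (e : OrthonormalBasis (Fin d) ℂ (EuclideanSpace ℂ (Fin d))) :
    ∃ U : Matrix (Fin d) (Fin d) ℂ, Uᴴ * U = 1 ∧ bellState e = entangledState U := by
  set W : Matrix (Fin d) (Fin d) ℂ := Matrix.of fun a j => e j a with hW
  have hW1 : Wᴴ * W = 1 := by
    ext i j
    have := e.inner_eq_ite i j
    rw [PiLp.inner_apply] at this
    rw [Matrix.mul_apply, Matrix.one_apply, ← this]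
    refine Finset.sum_congr rfl fun a _ => ?_
    simp [hW, mul_comm]
  have hW2 : Wᵀᴴ * Wᵀ = 1 := by
    have h := congrArg Matrix.transpose (mul_eq_one_comm.1 hW1)
    rw [Matrix.transpose_mul, Matrix.transpose_one] at h
    exact h
  refine ⟨W * Wᵀ, ?_, ?_⟩
  · rw [Matrix.conjTranspose_mul, mul_assoc, ← mul_assoc Wᴴ, hW1, one_mul, hW2]
  · have hψ : (fun p : Fin d × Fin d => ((1 / Real.sqrt d : ℝ) : ℂ) * ∑ j, e j p.1 * e j p.2)
        = ((1 / Real.sqrt d : ℝ) : ℂ) • Matrix.vec (W * Wᵀ) := by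
      funext p
      simp only [Pi.smul_apply, smul_eq_mul, Matrix.vec, Matrix.mul_apply, Matrix.transpose_apply,
        hW, Matrix.of_apply]
      congr 1
      exact Finset.sum_congr rfl fun j _ => mul_comm _ _
    have hc : ((1 / Real.sqrt d : ℝ) : ℂ) * ((1 / Real.sqrt d : ℝ) : ℂ) = 1 / d := by
      rw [← Complex.ofReal_mul, div_mul_div_comm, Real.mul_self_sqrt (Nat.cast_nonneg d)]
      simp
    rw [bellState, entangledState]
    simp only [hψ]
    rw [star_smul, Matrix.smul_vecMulVec, Matrix.vecMulVec_smul, smul_smul, Complex.star_def,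
      Complex.conj_ofReal, hc]

variable {U : Matrix (Fin d) (Fin d) ℂ}

theorem kronecker_one_mul_entangledState (M : Matrix (Fin d) (Fin d) ℂ) :
    (M ⊗ₖ (1 : Matrix (Fin d) (Fin d) ℂ)) * entangledState U
      = (1 / d : ℂ) • Matrix.vecMulVec (Matrix.vec (U * Mᵀ)) (star (Matrix.vec U)) := by
  rw [entangledState, Matrix.mul_smul, Matrix.mul_vecMulVec, Matrix.kronecker_mulVec_vec, one_mul]

theorem one_kronecker_mul_entangledState (M : Matrix (Fin d) (Fin d) ℂ) :
    ((1 : Matrix (Fin d) (Fin d) ℂ) ⊗ₖ M) * entangledState U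
      = (1 / d : ℂ) • Matrix.vecMulVec (Matrix.vec (M * U)) (star (Matrix.vec U)) := by
  rw [entangledState, Matrix.mul_smul, Matrix.mul_vecMulVec, Matrix.kronecker_mulVec_vec,
    Matrix.transpose_one, mul_one]

/-- The transpose trick: an operator on the system acts on the entangled state like one on the
ancilla, which commutes with all jump operators. It supplies the matrix M of `exists_fisher_bound`.
-/
theorem kronecker_one_mul_entangledState_eq (hU : Uᴴ * U = 1) (M : Matrix (Fin d) (Fin d) ℂ) :
    (M ⊗ₖ (1 : Matrix (Fin d) (Fin d) ℂ)) * entangledState U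
      = ((1 : Matrix (Fin d) (Fin d) ℂ) ⊗ₖ (U * Mᵀ * Uᴴ)) * entangledState U := by
  rw [kronecker_one_mul_entangledState, one_kronecker_mul_entangledState, mul_assoc, mul_assoc,
    hU, mul_one]

theorem posSemidef_entangledState : (entangledState U).PosSemidef :=
  (Matrix.posSemidef_vecMulVec_self_star _).smul (by positivity)

theorem trace_entangledState_mul (hU : Uᴴ * U = 1) (M : Matrix (Fin d) (Fin d) ℂ) :
    (entangledState U * (M ⊗ₖ (1 : Matrix (Fin d) (Fin d) ℂ))).trace = M.trace / d := by
  rw [Matrix.trace_mul_comm, kronecker_one_mul_entangledState, Matrix.trace_smul,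
    Matrix.trace_vecMulVec, dotProduct_comm, Matrix.star_vec_dotProduct_vec, ← mul_assoc, hU,
    one_mul, Matrix.trace_transpose, smul_eq_mul]
  ring

/-- The state is pure with maximally mixed marginal, so M ⊗ 1 has expectation tr M / d; subtracting
this value centres a jump operator. -/
theorem entangledState_mul_mul (hU : Uᴴ * U = 1) (M : Matrix (Fin d) (Fin d) ℂ) :
    entangledState U * (M ⊗ₖ (1 : Matrix (Fin d) (Fin d) ℂ)) * entangledState U
      = (M.trace / d) • entangledState U := by
  rw [mul_assoc, kronecker_one_mul_entangledState, entangledState, Matrix.smul_mul,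
    Matrix.mul_smul, Matrix.vecMulVec_mul_vecMulVec, Matrix.star_vec_dotProduct_vec, ← mul_assoc,
    hU, one_mul, Matrix.trace_transpose, smul_smul, smul_smul]
  rw [Matrix.vecMulVec_smul, smul_smul]
  congr 1
  ring

theorem entangledState_mul_self (hd : 0 < d) (hU : Uᴴ * U = 1) :
    entangledState U * entangledState U = entangledState U := by
  have := entangledState_mul_mul hU 1
  have hd' : (d : ℂ) ≠ 0 := by exact_mod_cast hd.ne'
  simpa [hd'] using this

theorem trace_entangledState (hd : 0 < d) (hU : Uᴴ * U = 1) : (entangledState U).trace = 1 := by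
  have := trace_entangledState_mul hU 1
  have hd' : (d : ℂ) ≠ 0 := by exact_mod_cast hd.ne'
  simpa [hd'] using this

/-- The projector detecting operators orthogonal to `S` on the entangled state. -/
theorem exists_detector (S : Submodule ℂ (Matrix (Fin d) (Fin d) ℂ)) (hU : Uᴴ * U = 1) :
    ∃ P : Matrix (Fin d × Fin d) (Fin d × Fin d) ℂ, P.IsHermitian ∧ P * P = P ∧
      (∀ X ∈ S, P * ((X ⊗ₖ (1 : Matrix (Fin d) (Fin d) ℂ)) * entangledState U) = 0) ∧
      ∀ B, (∀ X ∈ S, (Xᴴ * B).trace = 0) →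
        P * ((B ⊗ₖ (1 : Matrix (Fin d) (Fin d) ℂ)) * entangledState U)
          = (B ⊗ₖ (1 : Matrix (Fin d) (Fin d) ℂ)) * entangledState U := by
  -- Since U is unitary, X ↦ vec (U Xᵀ) preserves inner products, so operators orthogonal to S
  -- become vectors orthogonal to the image of S.
  set f : Matrix (Fin d) (Fin d) ℂ →ₗ[ℂ] (Fin d × Fin d → ℂ) :=
    { toFun := fun X => Matrix.vec (U * Xᵀ)
      map_add' := fun X Y => by rw [Matrix.transpose_add, mul_add, Matrix.vec_add]
      map_smul' := fun c X => by
        rw [Matrix.transpose_smul, Matrix.mul_smul, Matrix.vec_smul]; rfl }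
  obtain ⟨P, hP, hP2, hPU, hP'⟩ := exists_orthogonal_projector (S.map f)
  refine ⟨P, hP, hP2, fun X hX => ?_, fun B hB => ?_⟩
  · have h0 : P *ᵥ Matrix.vec (U * Xᵀ) = 0 := hPU _ ⟨X, hX, rfl⟩
    rw [kronecker_one_mul_entangledState, Matrix.mul_smul, Matrix.mul_vecMulVec, h0,
      Matrix.zero_vecMulVec, smul_zero]
  · rw [kronecker_one_mul_entangledState, Matrix.mul_smul, Matrix.mul_vecMulVec,
      projector_mulVec_eq_self hP hPU hP']
    rintro _ ⟨X, hX, rfl⟩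
    change star (Matrix.vec (U * Xᵀ)) ⬝ᵥ _ = 0
    rw [Matrix.star_vec_dotProduct_vec, Matrix.conjTranspose_mul, mul_assoc, ← mul_assoc Uᴴ, hU,
      one_mul, ← hB X hX, ← Matrix.trace_transpose (Xᴴ * B), Matrix.transpose_mul,
      Matrix.trace_mul_comm]
    rfl

end Bell

/-! ### The encoding channel and the rate attained by the Bell state. -/

section Encode

variable {d K N : ℕ}

theorem signalRate_nonneg (i : Fin K ⊕ Fin N) : 0 ≤ (Sum.elim 1 0 : Fin K ⊕ Fin N → ℝ) i := by
  rcases i with j | k <;> simp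

theorem noiseRate_nonneg {γ : Fin N → ℝ} (hγ : ∀ k, 0 ≤ γ k) (i : Fin K ⊕ Fin N) :
    0 ≤ (Sum.elim 0 γ : Fin K ⊕ Fin N → ℝ) i := by
  rcases i with j | k
  · simp
  · exact hγ k

/-- The jump operators of signal and noise on system and ancilla. -/
def jointJump (A : Type) [DecidableEq A] (Ls : Fin K → Matrix (Fin d) (Fin d) ℂ)
    (Ln : Fin N → Matrix (Fin d) (Fin d) ℂ) (i : Fin K ⊕ Fin N) :
    Matrix (Fin d × A) (Fin d × A) ℂ :=
  Sum.elim Ls Ln i ⊗ₖ (1 : Matrix A A ℂ)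

theorem genOp_jointJump (A : Type) [Fintype A] [DecidableEq A]
    (Ls : Fin K → Matrix (Fin d) (Fin d) ℂ) (Ln : Fin N → Matrix (Fin d) (Fin d) ℂ)
    (γ : Fin N → ℝ) (z : ℂ) :
    (genOp (jointJump A Ls Ln) fun i => ((Sum.elim 0 γ i : ℝ) : ℂ))
        + z • (genOp (jointJump A Ls Ln) fun i => ((Sum.elim 1 0 i : ℝ) : ℂ))
      = genOp (jointJump A Ls Ln) (Sum.elim (fun _ => z) fun k => (γ k : ℂ)) := by
  rw [← genOp_add_smul]
  congr 1
  funext i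
  rcases i with j | k <;> simp

theorem encode_eq_flow {A : Type} [Fintype A] [DecidableEq A]
    (Ls : Fin K → Matrix (Fin d) (Fin d) ℂ) (Ln : Fin N → Matrix (Fin d) (Fin d) ℂ)
    (γ : Fin N → ℝ) (t θ : ℝ) (ρ : Matrix (Fin d × A) (Fin d × A) ℂ) :
    encode A Ls Ln γ t θ ρ
      = flow (jointJump A Ls Ln) (Sum.elim 1 0) (Sum.elim 0 γ) t ((θ ^ 2 : ℝ) : ℂ) ρ := by
  rw [encode, evolve_eq_exp, flow, genOp_jointJump]
  congr 4
  funext i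
  rcases i with j | k <;> rfl

theorem kronecker_one_sub_smul (A : Type) [Fintype A] [DecidableEq A]
    (L : Matrix (Fin d) (Fin d) ℂ) (c : ℂ) :
    L ⊗ₖ (1 : Matrix A A ℂ) - c • 1 = (L - c • 1) ⊗ₖ (1 : Matrix A A ℂ) := by
  rw [sub_eq_add_neg, sub_eq_add_neg, Matrix.add_kronecker, ← neg_smul, ← neg_smul,
    Matrix.smul_kronecker, Matrix.one_kronecker_one]

theorem kronecker_one_mul (A : Type) [Fintype A] [DecidableEq A] (L M : Matrix (Fin d) (Fin d) ℂ) :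
    (L * M) ⊗ₖ (1 : Matrix A A ℂ) = (L ⊗ₖ (1 : Matrix A A ℂ)) * (M ⊗ₖ (1 : Matrix A A ℂ)) := by
  rw [← Matrix.mul_kronecker_mul, one_mul]

theorem conjTranspose_kronecker_one (A : Type) [DecidableEq A] (L : Matrix (Fin d) (Fin d) ℂ) :
    (L ⊗ₖ (1 : Matrix A A ℂ))ᴴ = Lᴴ ⊗ₖ (1 : Matrix A A ℂ) := by
  rw [Matrix.conjTranspose_kronecker, Matrix.conjTranspose_one]

/-- Extension of operators on the system to system and ancilla. -/
def extendHom (d : ℕ) (A : Type) [Fintype A] [DecidableEq A] :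
    Matrix (Fin d) (Fin d) ℂ →⋆ₐ[ℂ] Matrix (Fin d × A) (Fin d × A) ℂ where
  toFun := fun L => L ⊗ₖ (1 : Matrix A A ℂ)
  map_one' := Matrix.one_kronecker_one
  map_mul' := kronecker_one_mul A
  map_zero' := Matrix.zero_kronecker _
  map_add' := fun L M => Matrix.add_kronecker L M _
  commutes' := fun c => by
    rw [Algebra.algebraMap_eq_smul_one, Algebra.algebraMap_eq_smul_one, Matrix.smul_kronecker,
      Matrix.one_kronecker_one]
  map_star' := fun L => (conjTranspose_kronecker_one A L).symm

theorem extendHom_apply (A : Type) [Fintype A] [DecidableEq A] (L : Matrix (Fin d) (Fin d) ℂ) :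
    extendHom d A L = L ⊗ₖ (1 : Matrix A A ℂ) := rfl

theorem drift_jointJump (A : Type) [Fintype A] [DecidableEq A]
    (Ls : Fin K → Matrix (Fin d) (Fin d) ℂ) (Ln : Fin N → Matrix (Fin d) (Fin d) ℂ)
    (c : Fin K ⊕ Fin N → ℂ) (w : Fin K ⊕ Fin N → ℝ) :
    drift (jointJump A Ls Ln) c w = drift (Sum.elim Ls Ln) c w ⊗ₖ (1 : Matrix A A ℂ) := by
  rw [← extendHom_apply, drift, drift, map_sum]
  refine Finset.sum_congr rfl fun i _ => ?_
  rw [map_smul, shiftedDrift, shiftedDrift, map_add, map_sub, map_smul, map_smul, map_smul,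
    map_mul, map_one, ← Matrix.star_eq_conjTranspose, ← Matrix.star_eq_conjTranspose, map_star]
  rfl

theorem exists_noiseSpan_coeff {Ln : Fin N → Matrix (Fin d) (Fin d) ℂ}
    {X : Matrix (Fin d) (Fin d) ℂ} (hX : X ∈ noiseSpan Ln) :
    ∃ (a : ℂ) (m : Fin N → ℂ), X = a • 1 + ∑ k, m k • Ln k := by
  obtain ⟨a, z, hz, rfl⟩ := Submodule.mem_span_insert.1 hX
  obtain ⟨m, rfl⟩ := (Submodule.mem_span_range_iff_exists_fun ℂ).1 hz
  exact ⟨a, m, rfl⟩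

theorem one_mem_noiseSpan (Ln : Fin N → Matrix (Fin d) (Fin d) ℂ) : 1 ∈ noiseSpan Ln :=
  Submodule.subset_span (Set.mem_insert _ _)

theorem mem_noiseSpan (Ln : Fin N → Matrix (Fin d) (Fin d) ℂ) (k : Fin N) :
    Ln k ∈ noiseSpan Ln :=
  Submodule.subset_span (Set.mem_insert_of_mem _ ⟨k, rfl⟩)

/-- Centering removes the component along the identity. -/
theorem exists_centered_coeff (hd : 0 < d) {Ln : Fin N → Matrix (Fin d) (Fin d) ℂ}
    {L B : Matrix (Fin d) (Fin d) ℂ} (hB : IsOrthogonalComponent (noiseSpan Ln) L B) :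
    ∃ m : Fin N → ℂ, L - (L.trace / d) • 1
      = B + ∑ k, m k • (Ln k - ((Ln k).trace / d) • 1) := by
  obtain ⟨a, m, h⟩ := exists_noiseSpan_coeff hB.1
  have hd' : (d : ℂ) ≠ 0 := by exact_mod_cast hd.ne'
  -- B is traceless because the identity lies in S, so taking traces identifies the scalar part of
  -- L.
  have hB0 : B.trace = 0 := by simpa using hB.2 1 (one_mem_noiseSpan Ln)
  have hL : L = B + (a • 1 + ∑ k, m k • Ln k) := by rw [← h]; abel
  have htr : L.trace = a * d + ∑ k, m k * (Ln k).trace := by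
    rw [hL]
    simp [Matrix.trace_add, hB0, Matrix.trace_sum]
  refine ⟨m, ?_⟩
  have h2 : L.trace / d = a + ∑ k, m k * ((Ln k).trace / d) := by
    rw [htr, add_div, mul_div_cancel_right₀ _ hd', Finset.sum_div]
    simp only [mul_div_assoc]
  rw [h2]
  simp only [smul_sub, Finset.sum_sub_distrib, smul_smul, add_smul, Finset.sum_smul]
  conv_lhs => rw [hL]
  abel

/-- The Bell state attains the stated rate in the vanishing-signal limit. -/
theorem exists_tendsto_measureResetQFI (hd : 0 < d) (Ls : Fin K → Matrix (Fin d) (Fin d) ℂ)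
    (Ln : Fin N → Matrix (Fin d) (Fin d) ℂ) {γ : Fin N → ℝ} (hγ : ∀ k, 0 < γ k) {T : ℝ}
    (hT : 0 < T) {B : Fin K → Matrix (Fin d) (Fin d) ℂ}
    (hB : ∀ j, IsOrthogonalComponent (noiseSpan Ln) (Ls j) (B j))
    (e : OrthonormalBasis (Fin d) ℂ (EuclideanSpace ℂ (Fin d))) :
    ∃ g : ℝ → ℝ≥0∞,
      (∀ θ : ℝ, 0 < θ →
        Tendsto (fun M : ℕ => measureResetQFI Ls Ln γ T (bellState e) M θ) atTop (𝓝 (g θ))) ∧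
      Tendsto g (𝓝[>] 0)
        (𝓝 (ENNReal.ofReal (4 * T * (1 / d) * ∑ j, ((B j)ᴴ * B j).trace.re))) := by
  have : Nonempty (Fin d) := ⟨⟨0, hd⟩⟩
  obtain ⟨U, hU, hbell⟩ := exists_bellState_eq e
  set ρ := entangledState U
  have hρ2 : ρ * ρ = ρ := entangledState_mul_self hd hU
  set L := jointJump (Fin d) Ls Ln with hL
  set c : Fin K ⊕ Fin N → ℂ := fun i => (Sum.elim Ls Ln i).trace / d with hc
  have hshift : ∀ i, L i - c i • 1 =
      (Sum.elim Ls Ln i - c i • 1) ⊗ₖ (1 : Matrix (Fin d) (Fin d) ℂ) :=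
    fun i => kronecker_one_sub_smul _ _ _
  have hY : ∀ i, ρ * (L i - c i • 1) * ρ = 0 := fun i => by
    rw [mul_sub, sub_mul, Matrix.mul_smul, Matrix.smul_mul, mul_one, hρ2, hL, jointJump,
      entangledState_mul_mul hU, sub_self]
  have hM : ∀ w : Fin K ⊕ Fin N → ℝ, ∃ M, (∀ i, Commute M (L i)) ∧ Commute (drift L c w) M ∧
      drift L c w * ρ = M * ρ := fun w => by
    -- The drift moved to the ancilla by the transpose trick.
    refine ⟨1 ⊗ₖ (U * (drift (Sum.elim Ls Ln) c w)ᵀ * Uᴴ), fun i => ?_, ?_, ?_⟩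
    · rw [hL, jointJump, Commute, SemiconjBy, ← Matrix.mul_kronecker_mul,
        ← Matrix.mul_kronecker_mul, one_mul, one_mul, mul_one, mul_one]
    · rw [hL, drift_jointJump, Commute, SemiconjBy, ← Matrix.mul_kronecker_mul,
        ← Matrix.mul_kronecker_mul, one_mul, one_mul, mul_one, mul_one]
    · rw [hL, drift_jointJump, kronecker_one_mul_entangledState_eq hU]
  have hLsum : (fun i => L i - c i • 1) = Sum.elim
      (fun j => (Ls j - ((Ls j).trace / d) • 1) ⊗ₖ (1 : Matrix (Fin d) (Fin d) ℂ))
      (fun k => (Ln k - ((Ln k).trace / d) • 1) ⊗ₖ (1 : Matrix (Fin d) (Fin d) ℂ)) := by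
    funext i
    rw [hshift]
    rcases i with j | k <;> rfl
  choose m hm using fun j => exists_centered_coeff hd (hB j)
  have hm' : ∀ j, (Ls j - ((Ls j).trace / d) • 1) ⊗ₖ (1 : Matrix (Fin d) (Fin d) ℂ)
      = B j ⊗ₖ (1 : Matrix (Fin d) (Fin d) ℂ)
        + ∑ k, m j k • ((Ln k - ((Ln k).trace / d) • 1) ⊗ₖ (1 : Matrix (Fin d) (Fin d) ℂ)) :=
    fun j => by
    rw [hm, ← extendHom_apply, map_add, map_sum]
    simp only [map_smul, extendHom_apply]
  have hb : ∑ j, (ρ * ((B j ⊗ₖ (1 : Matrix (Fin d) (Fin d) ℂ))ᴴ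
      * (B j ⊗ₖ (1 : Matrix (Fin d) (Fin d) ℂ)))).trace.re
      = (1 / d) * ∑ j, ((B j)ᴴ * B j).trace.re := by
    rw [Finset.mul_sum]
    refine Finset.sum_congr rfl fun j _ => ?_
    rw [conjTranspose_kronecker_one, ← kronecker_one_mul, trace_entangledState_mul hU,
      Complex.div_natCast_re]
    ring
  obtain ⟨C, hC⟩ := exists_jumpFisher_bound hm' hγ (posSemidef_entangledState (U := U))
  obtain ⟨P, hP, hP2, hPS, hPB⟩ := exists_detector (noiseSpan Ln) hU
  rw [hb] at hC
  obtain ⟨g, hg1, hg2⟩ := exists_tendsto_mul_quantumFisher (L := L) (c := c) signalRate_nonneg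
    (noiseRate_nonneg fun k => (hγ k).le)
    (posSemidef_entangledState (U := U)) hρ2 hY hM
    (b := (1 / d) * ∑ j, ((B j)ᴴ * B j).trace.re) (C := C)
    (fun s hs X hX => by rw [hLsum]; exact hC s hs X hX)
    (fun s hs => by
      refine ⟨((s⁻¹ : ℝ) : ℂ) • P, ?_, ?_⟩
      · rw [Matrix.IsHermitian, Matrix.conjTranspose_smul, hP.eq]; simp
      · rw [hLsum, jumpFisher_projector hm' γ hP2 (fun k => ?_) (fun j => ?_)
          (posSemidef_entangledState (U := U)).isHermitian hP hs, hb]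
        · exact hPS _ ((noiseSpan Ln).sub_mem (mem_noiseSpan Ln k)
            ((noiseSpan Ln).smul_mem _ (one_mem_noiseSpan Ln)))
        · exact hPB _ (hB j).2) hT
  refine ⟨g, fun θ hθ => ?_, ?_⟩
  · simp only [measureResetQFI, encode_eq_flow, hbell]
    exact hg1 θ hθ
  · rw [mul_assoc (4 * T)]
    exact hg2

end Encode

/-! ### Norms of Kraus maps and the trace norm. -/

section KrausNorm

/-- For w the image of v, ‖w‖² is the sum of ⟨V_i w, X_i V_i v⟩. Cauchy–Schwarz over i and Σ ‖V_i
v‖² ≤ b‖v‖² conclude; the X_i need not be Hermitian. -/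
theorem norm_sum_adjoint_mul_mul_le {H : Type*} [NormedAddCommGroup H] [InnerProductSpace ℂ H]
    [CompleteSpace H] {κ : Type*} [Fintype κ] (V X : κ → H →L[ℂ] H) {b c : ℝ}
    (hb : ‖∑ i, star (V i) * V i‖ ≤ b) (hc : 0 ≤ c) (hX : ∀ i, ‖X i‖ ≤ c) :
    ‖∑ i, star (V i) * X i * V i‖ ≤ b * c := by
  have hb0 : 0 ≤ b := (norm_nonneg _).trans hb
  have hV : ∀ v : H, ∑ i, ‖V i v‖ ^ 2 ≤ b * ‖v‖ ^ 2 := fun v => by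
    have h : ∑ i, ‖V i v‖ ^ 2 = (inner ℂ v ((∑ i, star (V i) * V i) v)).re := by
      rw [_root_.sum_apply, inner_sum, Complex.re_sum]
      refine Finset.sum_congr rfl fun i _ => ?_
      change _ = (inner ℂ v (star (V i) (V i v))).re
      rw [ContinuousLinearMap.star_eq_adjoint, ContinuousLinearMap.adjoint_inner_right,
        inner_self_eq_norm_sq_to_K]
      norm_cast
    rw [h]
    calc _ ≤ ‖inner ℂ v ((∑ i, star (V i) * V i) v)‖ := Complex.re_le_norm _
      _ ≤ ‖v‖ * (‖∑ i, star (V i) * V i‖ * ‖v‖) := (norm_inner_le_norm _ _).trans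
          (mul_le_mul_of_nonneg_left (ContinuousLinearMap.le_opNorm _ _) (norm_nonneg _))
      _ ≤ ‖v‖ * (b * ‖v‖) := by gcongr
      _ = _ := by ring
  refine ContinuousLinearMap.opNorm_le_bound _ (mul_nonneg hb0 hc) fun v => ?_
  set w := (∑ i, star (V i) * X i * V i) v with hw
  have h1 : ‖w‖ ^ 2 ≤ c * ∑ i, ‖V i w‖ * ‖V i v‖ := by
    have h : ‖w‖ ^ 2 = (inner ℂ w ((∑ i, star (V i) * X i * V i) v)).re := by
      rw [← hw, inner_self_eq_norm_sq_to_K]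
      norm_cast
    rw [h, _root_.sum_apply, inner_sum, Complex.re_sum, Finset.mul_sum]
    refine Finset.sum_le_sum fun i _ => ?_
    change (inner ℂ w (star (V i) (X i (V i v)))).re ≤ _
    rw [ContinuousLinearMap.star_eq_adjoint, ContinuousLinearMap.adjoint_inner_right]
    calc _ ≤ ‖inner ℂ (V i w) (X i (V i v))‖ := Complex.re_le_norm _
      _ ≤ ‖V i w‖ * (‖X i‖ * ‖V i v‖) := (norm_inner_le_norm _ _).trans
          (mul_le_mul_of_nonneg_left (ContinuousLinearMap.le_opNorm _ _) (norm_nonneg _))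
      _ ≤ ‖V i w‖ * (c * ‖V i v‖) := by gcongr; exact hX i
      _ = _ := by ring
  have h2 : ∑ i, ‖V i w‖ * ‖V i v‖ ≤ b * (‖w‖ * ‖v‖) := by
    refine (Real.sum_mul_le_sqrt_mul_sqrt _ _ _).trans ?_
    calc _ ≤ √(b * ‖w‖ ^ 2) * √(b * ‖v‖ ^ 2) :=
          mul_le_mul (Real.sqrt_le_sqrt (hV w)) (Real.sqrt_le_sqrt (hV v)) (Real.sqrt_nonneg _)
            (Real.sqrt_nonneg _)
      _ = _ := by
          rw [Real.sqrt_mul hb0, Real.sqrt_mul hb0, Real.sqrt_sq (norm_nonneg _),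
            Real.sqrt_sq (norm_nonneg _)]
          rw [mul_mul_mul_comm, Real.mul_self_sqrt hb0]
  rcases (norm_nonneg w).eq_or_lt with h0 | h0
  · rw [← h0]; positivity
  · have h3 : ‖w‖ * ‖w‖ ≤ ‖w‖ * (b * c * ‖v‖) := by
      calc ‖w‖ * ‖w‖ = ‖w‖ ^ 2 := (sq _).symm
        _ ≤ c * (b * (‖w‖ * ‖v‖)) := h1.trans (mul_le_mul_of_nonneg_left h2 hc)
        _ = _ := by ring
    exact le_of_mul_le_mul_left h3 h0

variable {ι : Type} [Fintype ι] [DecidableEq ι]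

theorem norm_sum_conjTranspose_mul_mul_le {κ : Type*} [Fintype κ] (V X : κ → Matrix ι ι ℂ)
    {b c : ℝ} (hb : ‖∑ i, (V i)ᴴ * V i‖ ≤ b) (hc : 0 ≤ c) (hX : ∀ i, ‖X i‖ ≤ c) :
    ‖∑ i, (V i)ᴴ * X i * V i‖ ≤ b * c := by
  set e := Matrix.toEuclideanCLM (n := ι) (𝕜 := ℂ)
  have hn : ∀ A : Matrix ι ι ℂ, ‖A‖ = ‖e A‖ := fun A => rfl
  have hs : ∀ A : Matrix ι ι ℂ, e Aᴴ = star (e A) := fun A => map_star e A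
  have h := norm_sum_adjoint_mul_mul_le (fun i => e (V i)) (fun i => e (X i)) (b := b) (c := c)
    (by
      rw [hn, map_sum] at hb
      simpa only [map_mul, hs] using hb) hc hX
  rw [hn, map_sum]
  simpa only [map_mul, hs] using h

/-- Factoring each effect as B†B gives a Kraus sum with scalar matrices in the middle. -/
theorem norm_sum_smul_effect_le {m : ℕ} [Nonempty ι] (E : POVM ι m) {u : Fin m → ℂ}
    (hu : ∀ x, ‖u x‖ ≤ 1) : ‖∑ x, u x • E.effect x‖ ≤ 1 := by
  choose B hB using fun x => exists_conjTranspose_mul_self (E.posSemidef x)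
  have h := norm_sum_conjTranspose_mul_mul_le B (fun x => u x • (1 : Matrix ι ι ℂ)) (b := 1)
    (c := 1) (by simp only [← hB, E.sum_eq_one, norm_one, le_refl]) zero_le_one
    (fun x => by rw [norm_smul, norm_one, mul_one]; exact hu x)
  simpa only [Matrix.mul_smul, mul_one, Matrix.smul_mul, ← hB] using h

/-- The trace norm of `ρ` is at most `c`. -/
def TraceNormLE (ρ : Matrix ι ι ℂ) (c : ℝ) : Prop := ∀ X : Matrix ι ι ℂ, ‖(ρ * X).trace‖ ≤ c * ‖X‖

theorem IsDensity.traceNormLE {ρ : Matrix ι ι ℂ} (hρ : IsDensity ρ) : TraceNormLE ρ 1 := by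
  have key : ∀ X : Matrix ι ι ℂ, (ρ * X).trace.re ≤ ‖X‖ := fun X => by
    -- Cauchy–Schwarz needs a positive weight; an ε above ‖X‖ provides it even for X = 0.
    refine le_of_forall_gt_imp_ge_of_dense fun ε hε => ?_
    have hε0 : 0 < ε := (norm_nonneg X).trans_lt hε
    have h1 := two_mul_trace_re_le hρ.1 1 X hε0
    have h2 := trace_mul_re_nonneg hρ.1 (posSemidef_smul_one_sub (B := Xᴴ) (b := ε)
      (by rw [Matrix.l2_opNorm_conjTranspose]; exact hε.le))
    rw [mul_sub, Matrix.trace_sub, Complex.sub_re, Matrix.mul_smul, mul_one, Matrix.trace_smul,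
      hρ.2, Matrix.conjTranspose_conjTranspose, smul_eq_mul, mul_one, Complex.ofReal_re] at h2
    simp only [Matrix.conjTranspose_one, one_mul, mul_one, hρ.2, Complex.one_re] at h1
    have h3 : ε⁻¹ * (ρ * (Xᴴ * X)).trace.re ≤ ε := by
      rw [inv_mul_le_iff₀ hε0]; nlinarith
    linarith
  intro X
  obtain ⟨u, hu, huX⟩ : ∃ u : ℂ, ‖u‖ = 1 ∧ u * (ρ * X).trace = ‖(ρ * X).trace‖ := by
    rcases eq_or_ne (ρ * X).trace 0 with h | h
    · exact ⟨1, by simp, by simp [h]⟩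
    · refine ⟨‖(ρ * X).trace‖ / (ρ * X).trace, ?_, div_mul_cancel₀ _ h⟩
      rw [norm_div, Complex.norm_real, norm_norm, div_self (norm_ne_zero_iff.2 h)]
  have h := key (u • X)
  rw [Matrix.mul_smul, Matrix.trace_smul, smul_eq_mul, huX, norm_smul, hu, Complex.ofReal_re] at h
  rwa [one_mul] at h ⊢

theorem TraceNormLE.exp {ρ : Matrix ι ι ℂ} {c : ℝ} (hρ : TraceNormLE ρ c) (hc : 0 ≤ c)
    {G G' : SuperOp ι} (hG : ∀ ρ X, (G ρ * X).trace = (ρ * G' X).trace) {z : ℂ} {k : ℝ}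
    (hk : ‖NormedSpace.exp (z • G')‖ ≤ k) : TraceNormLE (NormedSpace.exp (z • G) ρ) (c * k) := by
  intro X
  rw [trace_exp_mul hG]
  refine (hρ _).trans ?_
  rw [mul_assoc]
  refine mul_le_mul_of_nonneg_left ((SuperOp.le_opNorm _ _).trans ?_) hc
  gcongr

theorem TraceNormLE.channel [Nonempty ι] {ρ : Matrix ι ι ℂ} {c : ℝ} (hρ : TraceNormLE ρ c)
    (hc : 0 ≤ c) {Φ : Matrix ι ι ℂ → Matrix ι ι ℂ} (hΦ : IsChannel Φ) : TraceNormLE (Φ ρ) c := by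
  obtain ⟨r, V, hV, hΦ⟩ := hΦ
  intro X
  have h : (Φ ρ * X).trace = (ρ * ∑ i, (V i)ᴴ * X * V i).trace := by
    rw [hΦ, Finset.sum_mul, Finset.mul_sum, Matrix.trace_sum, Matrix.trace_sum]
    refine Finset.sum_congr rfl fun i _ => ?_
    rw [trace_jump_mul, mul_assoc]
  rw [h]
  refine (hρ _).trans (mul_le_mul_of_nonneg_left ?_ hc)
  have := norm_sum_conjTranspose_mul_mul_le V (fun _ => X) (b := 1) (c := ‖X‖)
    (by rw [hV, norm_one]) (norm_nonneg X) (fun _ => le_rfl)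
  rwa [one_mul] at this

/-- Suitable phases u x turn the sum of absolute values into a single trace against Σ u x E_x, which
has norm at most 1. This controls the outcomes also at complex signal strength, where ρ is not a
state. -/
theorem TraceNormLE.sum_norm_trace_le [Nonempty ι] {ρ : Matrix ι ι ℂ} {c : ℝ}
    (hρ : TraceNormLE ρ c) (hc : 0 ≤ c) {m : ℕ} (E : POVM ι m) :
    ∑ x, ‖(ρ * E.effect x).trace‖ ≤ c := by
  have : ∀ y : ℂ, ∃ u : ℂ, ‖u‖ ≤ 1 ∧ u * y = ‖y‖ := fun y => by
    rcases eq_or_ne y 0 with h | h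
    · exact ⟨1, by simp, by simp [h]⟩
    · refine ⟨‖y‖ / y, ?_, div_mul_cancel₀ _ h⟩
      rw [norm_div, Complex.norm_real, norm_norm, div_self (norm_ne_zero_iff.2 h)]
  choose u hu huy using this
  have h := hρ (∑ x, u (ρ * E.effect x).trace • E.effect x)
  have e : (ρ * ∑ x, u (ρ * E.effect x).trace • E.effect x).trace
      = ((∑ x, ‖(ρ * E.effect x).trace‖ : ℝ) : ℂ) := by
    rw [Finset.mul_sum, Matrix.trace_sum, Complex.ofReal_sum]
    refine Finset.sum_congr rfl fun x _ => ?_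
    rw [Matrix.mul_smul, Matrix.trace_smul, smul_eq_mul, huy]
  rw [e, Complex.norm_real, Real.norm_of_nonneg (Finset.sum_nonneg fun _ _ => norm_nonneg _)] at h
  refine h.trans (mul_le_of_le_one_right hc (norm_sum_smul_effect_le E fun x => hu _))

end KrausNorm

/-! ### Lindblad semigroups as contractions, and their bounded perturbations. -/

section Contraction

variable {ι : Type} [Fintype ι] [DecidableEq ι] {κ : Type*} [Fintype κ] {J : κ → Matrix ι ι ℂ}
  {K : Matrix ι ι ℂ}

omit [DecidableEq ι] in
/-- Extensionality of matrices by traces against all matrices. -/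
theorem eq_of_forall_trace_mul_eq {A B : Matrix ι ι ℂ}
    (h : ∀ ρ : Matrix ι ι ℂ, (ρ * A).trace = (ρ * B).trace) : A = B := by
  rw [← sub_eq_zero, ← Matrix.trace_conjTranspose_mul_self_eq_zero_iff, mul_sub, Matrix.trace_sub,
    h, sub_self]

theorem adjoint_apply_of_kraus {G G' : SuperOp ι}
    (hGG : ∀ ρ X, (G ρ * X).trace = (ρ * G' X).trace)
    (hG : ∀ ρ, G ρ = ∑ i, J i * ρ * (J i)ᴴ - (K * ρ + ρ * Kᴴ)) (X : Matrix ι ι ℂ) :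
    G' X = ∑ i, (J i)ᴴ * X * J i - (X * K + Kᴴ * X) := by
  refine eq_of_forall_trace_mul_eq fun ρ => ?_
  rw [← hGG, hG, sub_mul, mul_sub, Finset.sum_mul, Finset.mul_sum, add_mul, mul_add]
  simp only [Matrix.trace_sub, Matrix.trace_add, Matrix.trace_sum, trace_jump_mul]
  congr 1
  · simp only [mul_assoc]
  · congr 1
    · rw [mul_assoc, Matrix.trace_mul_comm, mul_assoc]
    · rw [mul_assoc]

/-- Up to h² K†XK, the map 1 + hG' is the Kraus map with operators 1 - hK and √h J_i. As G' 1 = 0,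
that map sends 1 to 1 + h² K†K, which bounds its norm. -/
theorem norm_one_add_smul_le [Nonempty ι] {G' : SuperOp ι}
    (hG : ∀ X, G' X = ∑ i, (J i)ᴴ * X * J i - (X * K + Kᴴ * X)) (h1 : G' 1 = 0) {h : ℝ}
    (hh : 0 ≤ h) : ‖1 + (h : ℂ) • G'‖ ≤ 1 + 2 * ‖K‖ ^ 2 * h ^ 2 := by
  refine SuperOp.opNorm_le_bound _ (by positivity) fun X => ?_
  set V : Option κ → Matrix ι ι ℂ := fun o =>
    o.elim (1 - (h : ℂ) • K) fun i => ((√h : ℝ) : ℂ) • J i with hV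
  have hsq : ((√h : ℝ) : ℂ) * ((√h : ℝ) : ℂ) = h := by
    rw [← Complex.ofReal_mul, Real.mul_self_sqrt hh]
  have hVX : ∀ X : Matrix ι ι ℂ, ∑ o, (V o)ᴴ * X * V o
      = (1 + (h : ℂ) • G') X + ((h ^ 2 : ℝ) : ℂ) • (Kᴴ * X * K) := fun X => by
    rw [Fintype.sum_option]
    have : ∀ i, (V (some i))ᴴ * X * V (some i) = (h : ℂ) • ((J i)ᴴ * X * J i) := fun i => by
      simp only [hV, Option.elim, Matrix.conjTranspose_smul, Complex.star_def, Complex.conj_ofReal,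
        Matrix.smul_mul, Matrix.mul_smul, smul_smul, hsq]
    simp only [this, ← Finset.smul_sum]
    simp only [hV, Option.elim, SuperOp.add_apply, SuperOp.smul_apply, SuperOp.one_apply, hG,
      Matrix.conjTranspose_sub, Matrix.conjTranspose_smul, Matrix.conjTranspose_one,
      Complex.star_def, Complex.conj_ofReal, sub_mul, mul_sub, one_mul, mul_one, Matrix.smul_mul,
      Matrix.mul_smul, smul_smul, smul_sub, smul_add, Complex.ofReal_mul, sq]
    abel
  have hKK : ‖Kᴴ * K‖ ≤ ‖K‖ ^ 2 := by rw [Matrix.l2_opNorm_conjTranspose_mul_self, sq]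
  have hb : ‖∑ o, (V o)ᴴ * V o‖ ≤ 1 + ‖K‖ ^ 2 * h ^ 2 := by
    have := hVX 1
    simp only [mul_one, SuperOp.add_apply, SuperOp.smul_apply, SuperOp.one_apply, h1, smul_zero,
      add_zero] at this
    rw [this]
    refine (norm_add_le _ _).trans ?_
    rw [norm_one, norm_smul, Complex.norm_real, Real.norm_of_nonneg (sq_nonneg h), mul_comm]
    gcongr
  have h2 := norm_sum_conjTranspose_mul_mul_le V (fun _ => X) hb (norm_nonneg X) fun _ => le_rfl
  have h3 : (1 + (h : ℂ) • G') X
      = ∑ o, (V o)ᴴ * X * V o - ((h ^ 2 : ℝ) : ℂ) • (Kᴴ * X * K) := by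
    rw [hVX]; abel
  have h4 : ‖Kᴴ * X * K‖ ≤ ‖K‖ ^ 2 * ‖X‖ := by
    refine (norm_mul_le _ _).trans ?_
    have := mul_le_mul_of_nonneg_right (norm_mul_le Kᴴ X) (norm_nonneg K)
    rw [Matrix.l2_opNorm_conjTranspose] at this
    linarith [this, (by ring : ‖K‖ * ‖X‖ * ‖K‖ = ‖K‖ ^ 2 * ‖X‖)]
  rw [h3]
  refine (norm_sub_le _ _).trans ?_
  rw [norm_smul, Complex.norm_real, Real.norm_of_nonneg (sq_nonneg h)]
  have := mul_le_mul_of_nonneg_left h4 (sq_nonneg h)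
  nlinarith

/-- Perturbation of a Lindblad semigroup in the Heisenberg picture. -/
theorem norm_exp_add_le [Nonempty ι] {G' H : SuperOp ι}
    (hG : ∀ X, G' X = ∑ i, (J i)ᴴ * X * J i - (X * K + Kᴴ * X)) (h1 : G' 1 = 0) {ω : ℝ}
    (hH : ‖H‖ ≤ ω) {t : ℝ} (ht : 0 ≤ t) :
    ‖NormedSpace.exp ((t : ℂ) • (G' + H))‖ ≤ Real.exp (ω * t) := by
  refine norm_exp_smul_le (C := 2 * ‖K‖ ^ 2) (fun h hh => ?_) ht
  have e : 1 + (h : ℂ) • (G' + H) = (1 + (h : ℂ) • G') + (h : ℂ) • H := by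
    rw [smul_add, add_assoc]
  rw [e]
  refine (norm_add_le _ _).trans ?_
  rw [norm_smul, Complex.norm_real, Real.norm_of_nonneg hh]
  have := norm_one_add_smul_le hG h1 hh
  have := mul_le_mul_of_nonneg_left hH hh
  linarith

end Contraction

/-! ### Glaeser's inequality and Fisher information of holomorphic families. -/

section Glaeser

/-- A function nonnegative on both sides of s cannot be steep where it is small. Cauchy's estimates
bound the Taylor remainder by 2m(h/r)². The mean of |f| over the circle, rather than the maximum,
makes the estimate summable over outcomes. -/
theorem sq_deriv_le {f : ℂ → ℂ} (hf : Differentiable ℂ f) {s r m : ℝ} (hr : 0 < r)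
    (hpos : ∀ h : ℝ, |h| ≤ r / 2 → 0 ≤ (f ((s + h : ℝ) : ℂ)).re)
    (hm : (2 * Real.pi)⁻¹ * ∫ φ in 0..2 * Real.pi, ‖f (circleMap s r φ)‖ ≤ m) :
    ((deriv f s).re) ^ 2 ≤ 8 * m / r ^ 2 * (f s).re := by
  lift r to NNReal using hr.le
  have hp := (hf.differentiableOn (s := Metric.closedBall (s : ℂ) r)).hasFPowerSeriesOnBall
    (by exact_mod_cast hr)
  set p := cauchyPowerSeries f s r
  have hpn : ∀ n, ‖p n‖ ≤ m * (r : ℝ)⁻¹ ^ n := fun n => by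
    refine (norm_cauchyPowerSeries_le f s r n).trans ?_
    rw [abs_of_pos hr]
    gcongr
  have hm0 : 0 ≤ m := by
    have := (norm_nonneg _).trans (hpn 0); simpa using this
  have hexp : ∀ h : ℝ, |h| ≤ r / 2 →
      (f ((s + h : ℝ) : ℂ)).re ≤ (f s).re + (deriv f s).re * h + 2 * m * (h / r) ^ 2 := by
    intro h hh
    have hh1 : ‖(h : ℂ)‖ < r := by
      rw [Complex.norm_real, Real.norm_eq_abs]; linarith
    have hsum := hp.hasSum (y := (h : ℂ)) (by simpa [← ofReal_norm] using hh1)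
    rw [← hasSum_nat_add_iff' 2] at hsum
    set q : ℝ := |h| / r with hq
    have hq0 : 0 ≤ q := by positivity
    have hq2 : q ≤ 1 / 2 := by rw [hq, div_le_iff₀ hr]; linarith
    have hgeo : HasSum (fun n : ℕ => m * q ^ 2 * q ^ n) (m * q ^ 2 * (1 - q)⁻¹) :=
      (hasSum_geometric_of_lt_one hq0 (by linarith)).mul_left _
    have hle := hsum.norm_le_of_bounded hgeo fun n => by
      refine ((p (n + 2)).le_opNorm _).trans ?_
      rw [Finset.prod_const, Finset.card_univ, Fintype.card_fin, Complex.norm_real,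
        Real.norm_eq_abs]
      calc _ ≤ m * (r : ℝ)⁻¹ ^ (n + 2) * |h| ^ (n + 2) := by gcongr; exact hpn _
        _ = _ := by rw [hq, div_eq_mul_inv]; ring
    have h0 : p 0 (fun _ => (h : ℂ)) = f s := hp.coeff_zero _
    have h1 : p 1 (fun _ => (h : ℂ)) = deriv f s * h := by
      have e : (fun _ : Fin 1 => (h : ℂ)) = fun i => (h : ℂ) • (1 : ℂ) := by simp
      rw [e, (p 1).map_smul_univ, hp.hasFPowerSeriesAt.deriv]
      simp [mul_comm]
    rw [Finset.sum_range_succ, Finset.sum_range_one, h0, h1] at hle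
    have h2 := (Complex.re_le_norm _).trans hle
    have h3 : (1 - q)⁻¹ ≤ 2 := by
      rw [inv_le_comm₀ (by linarith) (by norm_num)]; linarith
    have h4 : m * q ^ 2 * (1 - q)⁻¹ ≤ m * q ^ 2 * 2 := by gcongr
    have h5 : q ^ 2 = (h / r) ^ 2 := by rw [hq, div_pow, div_pow, sq_abs]
    rw [h5] at h4 h2
    simp only [Complex.sub_re, Complex.add_re, Complex.re_mul_ofReal] at h2
    push_cast
    linarith
  have hd : |(deriv f s).re| ≤ m / r := by
    have h1 : ‖deriv f s‖ ≤ m / r := by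
      rw [hp.hasFPowerSeriesAt.deriv]
      refine ((p 1).le_opNorm _).trans ?_
      have := hpn 1
      simpa [div_eq_mul_inv] using this
    exact (Complex.abs_re_le_norm _).trans h1
  rcases hm0.eq_or_lt with h0 | h0
  · rw [← h0, zero_div] at hd
    have : (deriv f s).re = 0 := abs_nonpos_iff.1 hd
    rw [this, ← h0]; simp
  · set y := (deriv f s).re
    -- The step h = -yr²/(4m) minimizes the quadratic upper bound, and |y| ≤ m/r keeps it in the
    -- admissible range.
    have hh : |-(y * (r : ℝ) ^ 2 / (4 * m))| ≤ (r : ℝ) / 2 := by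
      rw [abs_neg, abs_div, abs_mul, abs_of_pos (by positivity : (0 : ℝ) < r ^ 2),
        abs_of_pos (by positivity : 0 < 4 * m), div_le_iff₀ (by positivity)]
      calc _ ≤ m / r * r ^ 2 := by gcongr
        _ = m * r := by field_simp
        _ ≤ _ := by nlinarith
    have h1 := (hpos _ hh).trans (hexp _ hh)
    have h2 : (f s).re + y * -(y * r ^ 2 / (4 * m)) + 2 * m * (-(y * r ^ 2 / (4 * m)) / r) ^ 2
        = (f s).re - y ^ 2 * r ^ 2 / (8 * m) := by
      field_simp; ring
    rw [h2, sub_nonneg, div_le_iff₀ (by positivity)] at h1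
    rw [div_mul_eq_mul_div, le_div_iff₀ (by positivity)]
    linarith

/-- Fisher information about the parameter `z` for nonnegative families extending holomorphically
with bounded total variation. -/
theorem sum_sq_deriv_div_le {m : ℕ} {p : Fin m → ℂ → ℂ} (hp : ∀ x, Differentiable ℂ (p x))
    {s r C : ℝ} (hr : 0 < r) (hpos : ∀ x, ∀ h : ℝ, |h| ≤ r / 2 → 0 ≤ (p x ((s + h : ℝ) : ℂ)).re)
    (hC : ∀ φ, ∑ x, ‖p x (circleMap s r φ)‖ ≤ C) :
    ∑ x, ((deriv (p x) s).re) ^ 2 / (p x s).re ≤ 8 * C / r ^ 2 := by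
  set μ : Fin m → ℝ := fun x =>
    (2 * Real.pi)⁻¹ * ∫ φ in 0..2 * Real.pi, ‖p x (circleMap s r φ)‖ with hμ
  have hint : ∀ x, IntervalIntegrable (fun φ => ‖p x (circleMap s r φ)‖) MeasureTheory.volume 0
      (2 * Real.pi) := fun x =>
    (((hp x).continuous.comp (continuous_circleMap _ _)).norm).intervalIntegrable _ _
  have hsum : ∑ x, μ x ≤ C := by
    rw [hμ, ← Finset.mul_sum, ← intervalIntegral.integral_finsetSum fun x _ => hint x]
    have h1 : ∫ φ in 0..2 * Real.pi, ∑ x, ‖p x (circleMap s r φ)‖ ≤ ∫ _ in 0..2 * Real.pi, C := by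
      refine intervalIntegral.integral_mono_on Real.two_pi_pos.le ?_
        intervalIntegrable_const fun φ _ => hC φ
      exact (continuous_finsetSum _ fun x _ =>
        ((hp x).continuous.comp (continuous_circleMap _ _)).norm).intervalIntegrable _ _
    rw [intervalIntegral.integral_const, sub_zero, smul_eq_mul] at h1
    rw [inv_mul_le_iff₀ Real.two_pi_pos]
    exact h1
  have hx : ∀ x, ((deriv (p x) s).re) ^ 2 / (p x s).re ≤ 8 * μ x / r ^ 2 := fun x => by
    have h0 : 0 ≤ (p x s).re := by simpa using hpos x 0 (by simpa using (half_pos hr).le)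
    have hμ0 : 0 ≤ μ x := by
      refine mul_nonneg (by positivity) ?_
      exact intervalIntegral.integral_nonneg Real.two_pi_pos.le fun _ _ => norm_nonneg _
    exact div_le_of_le_mul₀ h0 (by positivity) (sq_deriv_le (hp x) hr (hpos x) le_rfl)
  refine (Finset.sum_le_sum fun x _ => hx x).trans ?_
  rw [← Finset.sum_div, ← Finset.mul_sum]
  gcongr

end Glaeser

/-! ### Extension of the Lindblad form to negative signal strength. -/

section Extension

variable {ι : Type} [Fintype ι] [DecidableEq ι] {K N : ℕ}

/-- The coefficient matrix of the quadratic part of the generator with signal strength `s`, when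
the signal operators are combinations of noise operators with coefficients `a`. -/
def rateMatrix (a : Fin K → Fin N → ℂ) (γ : Fin N → ℝ) (s : ℝ) : Matrix (Fin N) (Fin N) ℂ :=
  (s : ℂ) • (∑ j, Matrix.vecMulVec (a j) (star (a j))) + Matrix.diagonal fun k => (γ k : ℂ)

theorem exists_rateMatrix_posSemidef (a : Fin K → Fin N → ℂ) {γ : Fin N → ℝ} (hγ : ∀ k, 0 < γ k) :
    ∃ δ : ℝ, 0 < δ ∧ ∀ s : ℝ, |s| ≤ δ → (rateMatrix a γ s).PosSemidef := by
  set A : Matrix (Fin N) (Fin N) ℂ := ∑ j, Matrix.vecMulVec (a j) (star (a j)) with hA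
  have hAh : A.IsHermitian := by
    rw [Matrix.IsHermitian, hA, Matrix.conjTranspose_sum]
    exact Finset.sum_congr rfl fun j _ => (Matrix.posSemidef_vecMulVec_self_star _).isHermitian.eq
  -- A positive lower bound for all γ k that makes sense also for N = 0.
  set g : ℝ := (1 + ∑ k, (γ k)⁻¹)⁻¹ with hg
  have hsum : 0 ≤ ∑ k, (γ k)⁻¹ := Finset.sum_nonneg fun k _ => (inv_pos.2 (hγ k)).le
  have hg0 : 0 < g := by positivity
  have hgk : ∀ k, g ≤ γ k := fun k => by
    rw [hg, inv_le_comm₀ (by positivity) (hγ k)]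
    have := Finset.single_le_sum (f := fun k => (γ k)⁻¹) (fun k _ => (inv_pos.2 (hγ k)).le)
      (Finset.mem_univ k)
    linarith
  refine ⟨g / (1 + ‖A‖), by positivity, fun s hs => ?_⟩
  have hsA : ‖(s : ℂ) • A‖ ≤ g := by
    rw [norm_smul, Complex.norm_real, Real.norm_eq_abs]
    calc _ ≤ g / (1 + ‖A‖) * (1 + ‖A‖) := by gcongr; linarith
      _ = g := by field_simp
  have hsAh : IsSelfAdjoint ((s : ℂ) • A) := by
    change ((s : ℂ) • A)ᴴ = _
    rw [Matrix.conjTranspose_smul, hAh.eq]; simp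
  have h1 : ((s : ℂ) • A + algebraMap ℝ (Matrix (Fin N) (Fin N) ℂ) ‖(s : ℂ) • A‖).PosSemidef := by
    open scoped MatrixOrder in
    have := hsAh.neg_algebraMap_norm_le_self
    rw [← sub_nonneg, sub_neg_eq_add] at this
    exact Matrix.nonneg_iff_posSemidef.1 this
  have h2 : (Matrix.diagonal fun k => ((γ k - ‖(s : ℂ) • A‖ : ℝ) : ℂ)).PosSemidef :=
    Matrix.PosSemidef.diagonal fun k => by
      have := hgk k
      simp only [Pi.zero_apply]
      exact_mod_cast (by linarith : 0 ≤ γ k - ‖(s : ℂ) • A‖)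
  convert h1.add h2 using 1
  rw [rateMatrix, add_assoc]
  congr 1
  ext i j
  rw [Algebra.algebraMap_eq_smul_one, Matrix.add_apply, Matrix.smul_apply, Matrix.one_apply,
    Matrix.diagonal_apply, Matrix.diagonal_apply]
  split <;> simp

/-- The generator remains of Lindblad form where the rate matrix is positive. -/
theorem exists_kraus_of_rateMatrix {Ls : Fin K → Matrix ι ι ℂ} {Ln : Fin N → Matrix ι ι ℂ}
    {c : Fin K → ℂ} {a : Fin K → Fin N → ℂ} (hL : ∀ j, Ls j = c j • 1 + ∑ k, a j k • Ln k)
    {γ : Fin N → ℝ} {s : ℝ} (hQ : (rateMatrix a γ s).PosSemidef) :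
    ∃ (J : Fin N → Matrix ι ι ℂ) (D : Matrix ι ι ℂ), ∀ ρ,
      genOp (Sum.elim Ls Ln) (Sum.elim (fun _ => (s : ℂ)) fun k => (γ k : ℂ)) ρ
        = ∑ i, J i * ρ * (J i)ᴴ - (D * ρ + ρ * Dᴴ) := by
  obtain ⟨B, hB⟩ := exists_conjTranspose_mul_self hQ
  set w : Fin K ⊕ Fin N → ℝ := Sum.elim (fun _ => s) γ with hw
  have hw' : (Sum.elim (fun _ => (s : ℂ)) fun k => (γ k : ℂ)) = fun i => ((w i : ℝ) : ℂ) := by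
    funext i; rcases i with j | k <;> rfl
  -- The factorization B†B of the rate matrix diagonalizes the quadratic form of the jumps; the
  -- shifts c j enter only through the drift.
  refine ⟨fun m => ∑ k, star (B m k) • Ln k, drift (Sum.elim Ls Ln) (Sum.elim c 0) w, fun ρ => ?_⟩
  rw [hw', genOp_apply_eq_shifted _ _ (Sum.elim c 0), ← drift]
  congr 1
  have hZ : ∀ j, Ls j - c j • 1 = ∑ k, a j k • Ln k := fun j => by rw [hL]; abel
  have hquad : ∀ b : Fin N → ℂ, (∑ k, b k • Ln k) * ρ * (∑ k, b k • Ln k)ᴴ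
      = ∑ k, ∑ l, (b k * star (b l)) • (Ln k * ρ * (Ln l)ᴴ) := fun b => by
    simp only [Matrix.conjTranspose_sum, Matrix.conjTranspose_smul, Finset.sum_mul, Finset.mul_sum,
      Matrix.smul_mul, Matrix.mul_smul, smul_smul]
    rw [Finset.sum_comm]
    simp only [mul_comm]
  have hlhs : ∑ i, (w i : ℂ) • (((Sum.elim Ls Ln) i - (Sum.elim c 0 : Fin K ⊕ Fin N → ℂ) i • 1) * ρ
        * ((Sum.elim Ls Ln) i - (Sum.elim c 0 : Fin K ⊕ Fin N → ℂ) i • 1)ᴴ)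
      = ∑ k, ∑ l, rateMatrix a γ s k l • (Ln k * ρ * (Ln l)ᴴ) := by
    simp only [rateMatrix, Fintype.sum_sum_type, hw, Sum.elim_inl, Sum.elim_inr, hZ, hquad,
      Pi.zero_apply, zero_smul, sub_zero, Matrix.add_apply, add_smul, Finset.sum_add_distrib,
      Matrix.smul_apply, Matrix.sum_apply, Matrix.vecMulVec_apply, Pi.star_apply,
      Matrix.diagonal_apply]
    congr 1
    · simp only [Finset.smul_sum, Finset.sum_smul, smul_smul, smul_eq_mul, Finset.mul_sum]
      rw [Finset.sum_comm]
      refine Finset.sum_congr rfl fun k _ => Finset.sum_comm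
    · simp [ite_smul]
  rw [hlhs, hB]
  simp only [hquad, Matrix.mul_apply, Finset.sum_smul, Matrix.conjTranspose_apply, star_star]
  symm
  rw [Finset.sum_comm]
  exact Finset.sum_congr rfl fun k _ => Finset.sum_comm

end Extension

/-! ### Second-order bound when the signal operators lie in the noise span. -/

section Sequential

variable {d K N : ℕ}

theorem IsDensity.nonempty {ι : Type} [Fintype ι] {ρ : Matrix ι ι ℂ} (hρ : IsDensity ρ) :
    Nonempty ι := by
  by_contra h
  rw [not_nonempty_iff] at h
  have := hρ.2
  simp [Matrix.trace] at this

theorem IsChannel.posSemidef {ι : Type} [Fintype ι] [DecidableEq ι]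
    {Φ : Matrix ι ι ℂ → Matrix ι ι ℂ} (hΦ : IsChannel Φ) {ρ : Matrix ι ι ℂ}
    (hρ : ρ.PosSemidef) : (Φ ρ).PosSemidef := by
  obtain ⟨r, V, -, h⟩ := hΦ
  rw [h]
  exact Matrix.posSemidef_sum _ fun i _ => hρ.mul_mul_conjTranspose_same (V i)

theorem IsChannel.hasDerivAt {ι : Type} [Fintype ι] [DecidableEq ι]
    {Φ : Matrix ι ι ℂ → Matrix ι ι ℂ} (hΦ : IsChannel Φ) {ρ : ℂ → Matrix ι ι ℂ}
    (hρ : Differentiable ℂ ρ) : Differentiable ℂ fun z => Φ (ρ z) := by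
  obtain ⟨r, V, -, h⟩ := hΦ
  simp only [h]
  exact Differentiable.fun_sum fun i _ => (hρ.const_mul (V i)).mul_const _

theorem differentiable_flow_apply {ι : Type} [Fintype ι] [DecidableEq ι] {κ : Type*} [Fintype κ]
    (L : κ → Matrix ι ι ℂ) (α β : κ → ℝ) (t : ℂ) {ρ : ℂ → Matrix ι ι ℂ}
    (hρ : Differentiable ℂ ρ) : Differentiable ℂ fun z => flow L α β t z (ρ z) := fun z =>
  (SuperOp.hasDerivAt_apply (G := fun z => flow L α β t z)
    (hasDerivAt_exp_parameter _ _ t z) (hρ z).hasDerivAt).differentiableAt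

theorem genAdj_one {ι : Type} [Fintype ι] [DecidableEq ι] {κ : Type*} [Fintype κ]
    (L : κ → Matrix ι ι ℂ) (w : κ → ℂ) : genAdj L w 1 = 0 := by
  rw [genAdj_apply]
  refine Finset.sum_eq_zero fun i _ => ?_
  rw [dissAdj_apply, mul_one, mul_one, one_mul, ← two_smul ℂ (_ * _), smul_smul]
  simp

/-- The state of a strategy for complex signal strength `z = θ ^ 2`. -/
def Strategy.complexState (σ : Strategy d) (Ls : Fin K → Matrix (Fin d) (Fin d) ℂ)
    (Ln : Fin N → Matrix (Fin d) (Fin d) ℂ) (γ : Fin N → ℝ) (t : ℝ) :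
    ℕ → ℂ → Matrix (Fin d × σ.Ancilla) (Fin d × σ.Ancilla) ℂ
  | 0, _ => σ.init
  | M + 1, z => σ.control M (flow (jointJump σ.Ancilla Ls Ln) (Sum.elim 1 0) (Sum.elim 0 γ) t z
      (σ.complexState Ls Ln γ t M z))

variable (σ : Strategy d) {Ls : Fin K → Matrix (Fin d) (Fin d) ℂ}
  {Ln : Fin N → Matrix (Fin d) (Fin d) ℂ} {γ : Fin N → ℝ}

theorem Strategy.state_eq_complexState (t θ : ℝ) (M : ℕ) :
    σ.state Ls Ln γ t θ M = σ.complexState Ls Ln γ t M ((θ ^ 2 : ℝ) : ℂ) := by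
  induction M with
  | zero => rfl
  | succ M ih => rw [Strategy.state, Strategy.complexState, ih, encode_eq_flow]

theorem Strategy.differentiable_complexState (t : ℝ) (M : ℕ) :
    Differentiable ℂ (σ.complexState Ls Ln γ t M) := by
  induction M with
  | zero => exact differentiable_const _
  | succ M ih => exact (σ.isChannel_control M).hasDerivAt (differentiable_flow_apply _ _ _ _ ih)

/-- A star homomorphism of C⋆-algebras is contractive; this keeps all constants independent of the
ancilla. -/
theorem norm_kronecker_one_le (A : Type) [Fintype A] [DecidableEq A]
    (L : Matrix (Fin d) (Fin d) ℂ) : ‖L ⊗ₖ (1 : Matrix A A ℂ)‖ ≤ ‖L‖ :=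
  NonUnitalStarAlgHom.norm_apply_le (extendHom d A) L

theorem norm_genAdj_signal_le (A : Type) [Fintype A] [DecidableEq A] [Nonempty (Fin d × A)] :
    ‖genAdj (jointJump A Ls Ln) fun i => ((Sum.elim 1 0 i : ℝ) : ℂ)‖ ≤ ∑ j, 2 * ‖Ls j‖ ^ 2 := by
  rw [genAdj, Fintype.sum_sum_type]
  simp only [Sum.elim_inl, Sum.elim_inr, Pi.one_apply, Pi.zero_apply, Complex.ofReal_one,
    Complex.ofReal_zero, one_smul, zero_smul, Finset.sum_const_zero, add_zero]
  refine (norm_sum_le _ _).trans (Finset.sum_le_sum fun j _ => ?_)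
  refine (norm_dissAdj_le _).trans ?_
  have := norm_kronecker_one_le A (Ls j)
  rw [jointJump, Sum.elim_inl]
  gcongr

theorem jointJump_eq (A : Type) [Fintype A] [DecidableEq A] :
    jointJump A Ls Ln = Sum.elim (fun j => Ls j ⊗ₖ (1 : Matrix A A ℂ))
      fun k => Ln k ⊗ₖ (1 : Matrix A A ℂ) := by
  funext i; rcases i with j | k <;> rfl

section Span

variable {c : Fin K → ℂ} {a : Fin K → Fin N → ℂ}
  (hL : ∀ j, Ls j = c j • 1 + ∑ k, a j k • Ln k) {δ : ℝ}
  (hQ : ∀ s : ℝ, |s| ≤ δ → (rateMatrix a γ s).PosSemidef)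

include hL hQ

theorem exists_kraus_jointJump (A : Type) [Fintype A] [DecidableEq A] {s : ℝ} (hs : |s| ≤ δ) :
    ∃ (J : Fin N → Matrix (Fin d × A) (Fin d × A) ℂ) (D : Matrix (Fin d × A) (Fin d × A) ℂ), ∀ ρ,
      genOp (jointJump A Ls Ln) (Sum.elim (fun _ => (s : ℂ)) fun k => (γ k : ℂ)) ρ
        = ∑ i, J i * ρ * (J i)ᴴ - (D * ρ + ρ * Dᴴ) := by
  rw [jointJump_eq]
  refine exists_kraus_of_rateMatrix (c := c) (a := a) (fun j => ?_) (hQ s hs)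
  rw [hL, ← extendHom_apply, map_add, map_sum, map_smul, map_one]
  simp only [map_smul, extendHom_apply]

/-- At signal strength Re z the generator has Lindblad form, hence generates contractions; the
imaginary part of z adds a perturbation of norm at most δ Σ 2‖L_j‖². -/
theorem norm_exp_genAdj_jointJump_le (A : Type) [Fintype A] [DecidableEq A]
    [Nonempty (Fin d × A)] {z : ℂ} (hz : |z.re| ≤ δ) (hz' : |z.im| ≤ δ) {t : ℝ} (ht : 0 ≤ t) :
    ‖NormedSpace.exp ((t : ℂ) • genAdj (jointJump A Ls Ln)
        (Sum.elim (fun _ => z) fun k => (γ k : ℂ)))‖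
      ≤ Real.exp (δ * (∑ j, 2 * ‖Ls j‖ ^ 2) * t) := by
  obtain ⟨J, D, hJ⟩ := exists_kraus_jointJump hL hQ A hz
  have e : genAdj (jointJump A Ls Ln) (Sum.elim (fun _ => z) fun k => (γ k : ℂ))
      = genAdj (jointJump A Ls Ln) (Sum.elim (fun _ => (z.re : ℂ)) fun k => (γ k : ℂ))
        + (z.im * Complex.I) •
          genAdj (jointJump A Ls Ln) fun i => ((Sum.elim 1 0 i : ℝ) : ℂ) := by
    rw [← genAdj_add_smul]
    congr 1
    funext i
    rcases i with j | k <;> simp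
  rw [e]
  refine norm_exp_add_le (adjoint_apply_of_kraus (trace_genOp_mul _ _) hJ) (genAdj_one _ _) ?_ ht
  rw [norm_smul, norm_mul, Complex.norm_I, mul_one, Complex.norm_real, Real.norm_eq_abs]
  exact mul_le_mul hz' (norm_genAdj_signal_le A) (norm_nonneg _) ((abs_nonneg _).trans hz')

/-- Controls do not increase the trace norm, and each query costs a factor exponential in its
duration. With t = T/M the product no longer depends on M. -/
theorem Strategy.traceNormLE_complexState {z : ℂ} (hz : |z.re| ≤ δ) (hz' : |z.im| ≤ δ) {t : ℝ}
    (ht : 0 ≤ t) (M : ℕ) : TraceNormLE (σ.complexState Ls Ln γ t M z)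
      (Real.exp (δ * (∑ j, 2 * ‖Ls j‖ ^ 2) * t) ^ M) := by
  have := σ.isDensity_init.nonempty
  induction M with
  | zero => rw [pow_zero]; exact σ.isDensity_init.traceNormLE
  | succ M ih =>
    rw [Strategy.complexState, pow_succ]
    refine TraceNormLE.channel ?_ (by positivity) (σ.isChannel_control M)
    rw [flow, genOp_jointJump]
    exact ih.exp (by positivity) (trace_genOp_mul _ _)
      (norm_exp_genAdj_jointJump_le hL hQ _ hz hz' ht)

theorem Strategy.posSemidef_complexState {s : ℝ} (hs : |s| ≤ δ) {t : ℝ} (ht : 0 ≤ t) (M : ℕ) :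
    (σ.complexState Ls Ln γ t M s).PosSemidef := by
  have := σ.isDensity_init.nonempty
  induction M with
  | zero => exact σ.isDensity_init.1
  | succ M ih =>
    rw [Strategy.complexState]
    refine (σ.isChannel_control M).posSemidef ?_
    rw [flow, genOp_jointJump]
    obtain ⟨J, D, hJ⟩ := exists_kraus_jointJump hL hQ σ.Ancilla hs
    exact posSemidef_exp (w := fun _ => 1) (J := J) (K := D) (fun _ => zero_le_one)
      (by simpa using hJ) ht ih

end Span

theorem hasDerivAt_re_comp_sq {f : ℂ → ℂ} (hf : Differentiable ℂ f) (θ : ℝ) :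
    HasDerivAt (fun θ : ℝ => (f ((θ ^ 2 : ℝ) : ℂ)).re)
      (2 * θ * (deriv f ((θ ^ 2 : ℝ) : ℂ)).re) θ := by
  have h1 : HasDerivAt (fun x : ℝ => (f x).re) (deriv f ((θ ^ 2 : ℝ) : ℂ)).re (θ ^ 2) :=
    (hf ((θ ^ 2 : ℝ) : ℂ)).hasDerivAt.real_of_complex
  have h2 : HasDerivAt (fun θ : ℝ => θ ^ 2) (2 * θ) θ := by simpa using hasDerivAt_pow 2 θ
  have := HasDerivAt.comp (h := fun θ : ℝ => θ ^ 2) θ h1 h2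
  simpa [Function.comp_def, mul_comm] using this

/-- When the signal operators lie in the noise span, the Fisher information is of second order. -/
theorem exists_sequentialQFI_bound (hS : ∀ j, Ls j ∈ noiseSpan Ln) (hγ : ∀ k, 0 < γ k) {T : ℝ}
    (hT : 0 < T) : ∃ C δ : ℝ, 0 < δ ∧ ∀ θ : ℝ, θ ^ 2 ≤ δ → ∀ M : ℕ,
      sequentialQFI Ls Ln γ T M θ ≤ ENNReal.ofReal (4 * θ ^ 2 * C) := by
  choose c a hL using fun j => exists_noiseSpan_coeff (hS j)
  obtain ⟨δ, hδ, hQ⟩ := exists_rateMatrix_posSemidef a hγ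
  set ω := ∑ j, 2 * ‖Ls j‖ ^ 2 with hω
  have hω0 : 0 ≤ ω := Finset.sum_nonneg fun _ _ => by positivity
  -- The circle of radius δ/2 around θ² ≤ δ/2 stays in |z| ≤ δ, where the total variation is at most
  -- exp(δωT).
  refine ⟨8 * Real.exp (δ * ω * T) / (δ / 2) ^ 2, δ / 2, half_pos hδ, fun θ hθ M => ?_⟩
  refine iSup_le fun σ => iSup_le fun m => iSup_le fun E => ENNReal.ofReal_le_ofReal ?_
  have hne := σ.isDensity_init.nonempty
  have ht : 0 ≤ T / (M : ℝ) := by positivity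
  set p : Fin m → ℂ → ℂ := fun x z => (σ.complexState Ls Ln γ (T / M) M z * E.effect x).trace
  have hp : ∀ x, Differentiable ℂ (p x) := fun x z =>
    ((traceMul (E.effect x)).hasFDerivAt.comp_hasDerivAt z
      (σ.differentiable_complexState (T / M) M z).hasDerivAt).differentiableAt
  have hprob : ∀ x, (fun s => E.prob (σ.state Ls Ln γ (T / M) s M) x)
      = fun s : ℝ => (p x ((s ^ 2 : ℝ) : ℂ)).re := fun x => by
    funext s
    rw [POVM.prob, Strategy.state_eq_complexState]
  have hF : classicalFisher (fun s => E.prob (σ.state Ls Ln γ (T / M) s M)) θ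
      = 4 * θ ^ 2 * ∑ x, ((deriv (p x) ((θ ^ 2 : ℝ) : ℂ)).re) ^ 2
        / (p x ((θ ^ 2 : ℝ) : ℂ)).re := by
    rw [classicalFisher, Finset.mul_sum]
    refine Finset.sum_congr rfl fun x _ => ?_
    rw [hprob, (hasDerivAt_re_comp_sq (hp x) θ).deriv, congrFun (hprob x) θ]
    ring
  rw [hF]
  refine mul_le_mul_of_nonneg_left (sum_sq_deriv_div_le hp (half_pos hδ) ?_ ?_) (by positivity)
  · intro x h hh
    refine trace_mul_re_nonneg (σ.posSemidef_complexState hL hQ ?_ ht M) (E.posSemidef x)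
    rw [abs_le] at hh ⊢
    constructor <;> nlinarith [sq_nonneg θ]
  · intro φ
    set z := circleMap ((θ ^ 2 : ℝ) : ℂ) (δ / 2) φ with hz
    have hz1 : ‖z - ((θ ^ 2 : ℝ) : ℂ)‖ = δ / 2 := by
      rw [hz, circleMap_sub_center, norm_circleMap_zero, abs_of_pos (half_pos hδ)]
    have hz2 : ‖z‖ ≤ δ := by
      calc ‖z‖ = ‖(z - ((θ ^ 2 : ℝ) : ℂ)) + ((θ ^ 2 : ℝ) : ℂ)‖ := by rw [sub_add_cancel]
        _ ≤ δ / 2 + θ ^ 2 := by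
          refine (norm_add_le _ _).trans ?_
          rw [hz1, Complex.norm_real, Real.norm_of_nonneg (sq_nonneg θ)]
        _ ≤ δ := by linarith
    have h := (σ.traceNormLE_complexState hL hQ ((Complex.abs_re_le_norm z).trans hz2)
      ((Complex.abs_im_le_norm z).trans hz2) ht M).sum_norm_trace_le (by positivity) E
    refine h.trans ?_
    rw [← Real.exp_nat_mul, Real.exp_le_exp, ← hω]
    rcases M.eq_zero_or_pos with rfl | hM
    · simp only [Nat.cast_zero, zero_mul]; positivity
    · have : (M : ℝ) ≠ 0 := by exact_mod_cast hM.ne'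
      refine le_of_eq ?_
      field_simp

theorem tendsto_iSup_sequentialQFI (hS : ∀ j, Ls j ∈ noiseSpan Ln) (hγ : ∀ k, 0 < γ k) {T : ℝ}
    (hT : 0 < T) :
    Tendsto (fun θ : ℝ => ⨆ M : ℕ, sequentialQFI Ls Ln γ T M θ) (𝓝[>] 0) (𝓝 0) := by
  obtain ⟨C, δ, hδ, h⟩ := exists_sequentialQFI_bound (γ := γ) hS hγ hT
  have h1 : Tendsto (fun θ : ℝ => ENNReal.ofReal (4 * θ ^ 2 * C)) (𝓝[>] 0) (𝓝 0) := by
    have hc : Continuous fun θ : ℝ => ENNReal.ofReal (4 * θ ^ 2 * C) :=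
      ENNReal.continuous_ofReal.comp (by fun_prop)
    have := (hc.tendsto 0).mono_left (nhdsWithin_le_nhds (s := Set.Ioi (0 : ℝ)))
    simpa using this
  refine tendsto_of_tendsto_of_tendsto_of_le_of_le' tendsto_const_nhds h1
    (Eventually.of_forall fun _ => zero_le) ?_
  have h2 : ∀ᶠ θ : ℝ in 𝓝[>] 0, θ ^ 2 ≤ δ := by
    have hc : Tendsto (fun θ : ℝ => θ ^ 2) (𝓝[>] 0) (𝓝 0) := by
      have := ((continuous_pow 2).tendsto (0 : ℝ)).mono_left
        (nhdsWithin_le_nhds (s := Set.Ioi (0 : ℝ)))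
      simpa using this
    exact hc.eventually_le_const hδ
  filter_upwards [h2] with θ hθ
  exact iSup_le fun M => h θ hθ M

end Sequential

/-! ### Measure-and-prepare channels. -/

section MeasurePrepare

variable {ι : Type} [Fintype ι] [DecidableEq ι]

theorem isChannel_of_kraus {κ : Type*} [Fintype κ] {Φ : Matrix ι ι ℂ → Matrix ι ι ℂ}
    (V : κ → Matrix ι ι ℂ) (hV : ∑ i, (V i)ᴴ * V i = 1) (hΦ : ∀ ρ, Φ ρ = ∑ i, V i * ρ * (V i)ᴴ) :
    IsChannel Φ := by
  refine ⟨Fintype.card κ, fun i => V ((Fintype.equivFin κ).symm i), ?_, fun ρ => ?_⟩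
  · rw [(Fintype.equivFin κ).symm.sum_comp fun i => (V i)ᴴ * V i, hV]
  · rw [(Fintype.equivFin κ).symm.sum_comp fun i => V i * ρ * (V i)ᴴ, hΦ]

/-- Measuring with Kraus operators `E x` and preparing the state `τ x` after the outcome `x`. -/
theorem isChannel_measure_prepare {κ : Type*} [Fintype κ] {E τ : κ → Matrix ι ι ℂ}
    (hE : ∑ x, (E x)ᴴ * E x = 1) (hτ : ∀ x, IsDensity (τ x)) :
    IsChannel fun ρ => ∑ x, (E x * ρ * (E x)ᴴ).trace • τ x := by
  choose B hB using fun x => exists_conjTranspose_mul_self (hτ x).1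
  have hcol : ∀ x, ∑ k, Matrix.vecMulVec (fun p => (B x)ᴴ p k) (star fun p => (B x)ᴴ p k) = τ x :=
    fun x => by
    rw [hB x]
    ext i j
    simp only [Matrix.sum_apply, Matrix.vecMulVec_apply, Matrix.mul_apply, Pi.star_apply,
      Matrix.conjTranspose_apply, star_star]
  -- One Kraus operator of rank at most one for each outcome x, row q of E x and column k of the
  -- factor B† in τ x = B†B.
  refine isChannel_of_kraus (κ := κ × ι × ι)
    (fun i => Matrix.vecMulVec (fun p => (B i.1)ᴴ p i.2.2) (E i.1 i.2.1)) ?_ fun ρ => ?_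
  · rw [Fintype.sum_prod_type, ← hE]
    refine Finset.sum_congr rfl fun x _ => ?_
    rw [Fintype.sum_prod_type]
    have h1 : ∑ k, (star fun p => (B x)ᴴ p k) ⬝ᵥ (fun p => (B x)ᴴ p k) = 1 := by
      have := congrArg Matrix.trace (hcol x)
      rw [Matrix.trace_sum, (hτ x).2] at this
      rw [← this]
      exact Finset.sum_congr rfl fun k _ => by rw [Matrix.trace_vecMulVec, dotProduct_comm]
    have h2 : ∀ q k, (Matrix.vecMulVec (fun p => (B x)ᴴ p k) (E x q))ᴴ
        * Matrix.vecMulVec (fun p => (B x)ᴴ p k) (E x q)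
        = ((star fun p => (B x)ᴴ p k) ⬝ᵥ (fun p => (B x)ᴴ p k)) •
          Matrix.vecMulVec (star (E x q)) (E x q) := fun q k => by
      rw [Matrix.conjTranspose_vecMulVec, Matrix.vecMulVec_mul_vecMulVec, Matrix.vecMulVec_smul]
    simp only [h2, ← Finset.sum_smul, h1, one_smul]
    ext i j
    simp only [Matrix.sum_apply, Matrix.vecMulVec_apply, Matrix.mul_apply, Pi.star_apply,
      Matrix.conjTranspose_apply]
  · rw [Fintype.sum_prod_type]
    refine Finset.sum_congr rfl fun x _ => ?_
    rw [Fintype.sum_prod_type, Matrix.trace, Finset.sum_smul]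
    refine Finset.sum_congr rfl fun q _ => ?_
    rw [← hcol x, Finset.smul_sum]
    refine Finset.sum_congr rfl fun k _ => ?_
    rw [Matrix.conjTranspose_vecMulVec, Matrix.vecMulVec_mul, Matrix.vecMulVec_mul_vecMulVec,
      Matrix.vecMulVec_smul]
    congr 1

end MeasurePrepare

/-! ### Trace preservation and conserved quantities. -/

section TracePreserving

variable {ι : Type} [Fintype ι] [DecidableEq ι] {κ : Type*} [Fintype κ]

theorem exp_apply_of_apply_eq_zero {G : SuperOp ι} {X : Matrix ι ι ℂ} (h : G X = 0) (z : ℂ) :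
    NormedSpace.exp (z • G) X = X := by
  refine (exp_smul_apply G z X).unique ?_
  have h2 := hasSum_single (f := fun n : ℕ => (z ^ n / (n.factorial : ℂ)) • (G ^ n) X) 0 (by
    intro n hn
    obtain ⟨k, rfl⟩ := Nat.exists_eq_succ_of_ne_zero hn
    rw [pow_succ G k, SuperOp.mul_apply, h]
    have : (G ^ k) 0 = 0 := by simpa using SuperOp.map_sub (G ^ k) 0 0
    rw [this, smul_zero])
  simpa using h2

theorem trace_flow (L : κ → Matrix ι ι ℂ) (α β : κ → ℝ) (t z : ℂ) (ρ : Matrix ι ι ℂ) :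
    (flow L α β t z ρ).trace = ρ.trace := by
  have h : ∀ ρ X, (((genOp L fun i => (β i : ℂ)) + z • genOp L fun i => (α i : ℂ)) ρ * X).trace
      = (ρ * ((genAdj L fun i => (β i : ℂ)) + z • genAdj L fun i => (α i : ℂ)) X).trace := by
    intro ρ X
    rw [← genOp_add_smul, ← genAdj_add_smul, trace_genOp_mul]
  have h1 := trace_exp_mul h t ρ 1
  have h0 : ((genAdj L fun i => (β i : ℂ)) + z • genAdj L fun i => (α i : ℂ)) 1 = 0 := by
    rw [← genAdj_add_smul, genAdj_one]
  rw [exp_apply_of_apply_eq_zero h0, mul_one, mul_one] at h1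
  exact h1

/-- Conserved quantities of the jump operators factor out of the evolution. -/
theorem flow_mul_of_commute {L : κ → Matrix ι ι ℂ} {D : Matrix ι ι ℂ} (h1 : ∀ i, Commute (L i) D)
    (h2 : ∀ i, Commute (L i)ᴴ D) (α β : κ → ℝ) (t z : ℂ) (ρ : Matrix ι ι ℂ) :
    flow L α β t z (ρ * D) = flow L α β t z ρ * D := by
  have hG : ∀ w : κ → ℂ, Commute (genOp L w) (sandwich 1 D) := fun w => by
    refine SuperOp.ext fun ρ => ?_
    rw [SuperOp.mul_apply, SuperOp.mul_apply, sandwich_apply, sandwich_apply, one_mul, one_mul,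
      genOp_apply, genOp_apply, Finset.sum_mul]
    refine Finset.sum_congr rfl fun i _ => ?_
    rw [Matrix.smul_mul, dissOp_apply, dissOp_apply, dissipator, dissipator, sub_mul,
      Matrix.smul_mul, add_mul]
    have e1 : L i * (ρ * D) * (L i)ᴴ = L i * ρ * (L i)ᴴ * D := by
      simp only [mul_assoc]; rw [← (h2 i).eq]
    have e2 : ρ * D * ((L i)ᴴ * L i) = ρ * ((L i)ᴴ * L i) * D := by
      rw [mul_assoc, mul_assoc ρ, ((h2 i).mul_left (h1 i)).eq]
    rw [e1, e2, ← mul_assoc ((L i)ᴴ * L i)]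
  have hc : Commute (flow L α β t z) (sandwich 1 D) := by
    let _ : NormedAlgebra ℚ (SuperOp ι) := NormedAlgebra.restrictScalars ℚ ℂ (SuperOp ι)
    exact Commute.exp_left (((hG _).add_left ((hG _).smul_left z)).smul_left t)
  have := DFunLike.congr_fun hc.eq ρ
  simpa [SuperOp.mul_apply] using this

end TracePreserving

/-! ### Click rate of a detector. -/

section Projector

variable {ι : Type} [Fintype ι] [DecidableEq ι] {K N : ℕ}

/-- P is blind to ρ and to the shifted noise jumps, so only the components B_j contribute to the
initial rate. -/
theorem trace_genOp_mul_projector {Ls : Fin K → Matrix ι ι ℂ} {Ln : Fin N → Matrix ι ι ℂ}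
    {c : Fin K ⊕ Fin N → ℂ} {B : Fin K → Matrix ι ι ℂ} {m : Fin K → Fin N → ℂ}
    (hY : ∀ j, Ls j - c (Sum.inl j) • 1 = B j + ∑ k, m j k • (Ln k - c (Sum.inr k) • 1))
    {ρ P : Matrix ι ι ℂ} (hPρ : P * ρ = 0)
    (hPZ : ∀ k, P * ((Ln k - c (Sum.inr k) • 1) * ρ) = 0)
    (hPB : ∀ j, P * (B j * ρ) = B j * ρ) (hρ : ρ.IsHermitian) (hP : P.IsHermitian)
    (w : Fin K ⊕ Fin N → ℝ) :
    (genOp (Sum.elim Ls Ln) (fun i => (w i : ℂ)) ρ * P).trace.re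
      = ∑ j, w (Sum.inl j) * (ρ * ((B j)ᴴ * B j)).trace.re := by
  have hρP : ρ * P = 0 := by
    have := congrArg Matrix.conjTranspose hPρ
    rwa [Matrix.conjTranspose_mul, hP.eq, hρ.eq, Matrix.conjTranspose_zero] at this
  rw [trace_genOp_mul_eq_shifted c w hPρ hρP, Fintype.sum_sum_type]
  simp only [Sum.elim_inl, Sum.elim_inr, trace_jump_mul]
  rw [Finset.sum_congr rfl fun j _ => by rw [trace_jump_projector hY hPZ hPB hρ hP j],
    Finset.sum_eq_zero (s := (Finset.univ : Finset (Fin N))) fun k _ => by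
      rw [Matrix.trace_mul_comm, mul_assoc, mul_assoc, hPZ, mul_zero, Matrix.trace_zero,
        Complex.zero_re, mul_zero], add_zero]

end Projector

/-! ### Repeated detection with reset. -/

section Reset

variable {d K N : ℕ} {A : Type} [Fintype A] [DecidableEq A]

/-- The strategy that measures the projectors `1 - C` and `C` after every query and prepares
`τ true` resp. `τ false`, starting from `τ true`. -/
def resetStrategy {C : Matrix (Fin d × A) (Fin d × A) ℂ} (hC : C.IsHermitian) (hC2 : C * C = C)
    {τ : Bool → Matrix (Fin d × A) (Fin d × A) ℂ} (hτ : ∀ x, IsDensity (τ x)) : Strategy d where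
  Ancilla := A
  init := τ true
  isDensity_init := hτ true
  control := fun _ ρ => ∑ x : Bool, (cond x (1 - C) C * ρ * (cond x (1 - C) C)ᴴ).trace • τ x
  isChannel_control := fun _ => isChannel_measure_prepare (E := fun x => cond x (1 - C) C) (by
    have h : (1 - C)ᴴ * (1 - C) = 1 - C := by
      rw [Matrix.conjTranspose_sub, Matrix.conjTranspose_one, hC.eq, mul_sub, sub_mul, sub_mul, hC2]
      simp
    simp only [Fintype.sum_bool, cond_true, cond_false]
    rw [h, hC.eq, hC2, sub_add_cancel]) hτ

variable {C D : Matrix (Fin d × A) (Fin d × A) ℂ} (hC : C.IsHermitian) (hC2 : C * C = C)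
  {τ : Bool → Matrix (Fin d × A) (Fin d × A) ℂ} (hτ : ∀ x, IsDensity (τ x))
  {Ls : Fin K → Matrix (Fin d) (Fin d) ℂ} {Ln : Fin N → Matrix (Fin d) (Fin d) ℂ}
  {γ : Fin N → ℝ} (hγ : ∀ k, 0 ≤ γ k)

/-- The probability of the outcome `C` in the first round. -/
def clickProb (C ρ : Matrix (Fin d × A) (Fin d × A) ℂ) (Ls : Fin K → Matrix (Fin d) (Fin d) ℂ)
    (Ln : Fin N → Matrix (Fin d) (Fin d) ℂ) (γ : Fin N → ℝ) (t θ : ℝ) : ℝ :=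
  (flow (jointJump A Ls Ln) (Sum.elim 1 0) (Sum.elim 0 γ) t ((θ ^ 2 : ℝ) : ℂ) ρ * C).trace.re

include hC2 hγ in
-- Without a click the initial state is restored. After a click the state is absorbed in τ false: it
-- is supported in D, which the evolution conserves, and D lies below C, so C clicks with certainty
-- in all later rounds. The weight of τ true is the probability of no click so far.
theorem resetStrategy_state
    (hD : ∀ L : Matrix (Fin d) (Fin d) ℂ, Commute (L ⊗ₖ (1 : Matrix A A ℂ)) D)
    (hτD : τ false * D = τ false) (hDC : D * C = D) {t : ℝ} (ht : 0 ≤ t) (θ : ℝ) (M : ℕ) :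
    (resetStrategy hC hC2 hτ).state Ls Ln γ t θ M
      = (((1 - clickProb C (τ true) Ls Ln γ t θ) ^ M : ℝ) : ℂ) • τ true
        + ((1 - (1 - clickProb C (τ true) Ls Ln γ t θ) ^ M : ℝ) : ℂ) • τ false := by
  have := (hτ true).nonempty
  set F := flow (jointJump A Ls Ln) (Sum.elim 1 0) (Sum.elim 0 γ) t ((θ ^ 2 : ℝ) : ℂ) with hF
  set p := clickProb C (τ true) Ls Ln γ t θ with hp
  have hp1 : (F (τ true) * C).trace = p := by
    refine Complex.ext rfl ?_
    rw [trace_mul_im_eq_zero (posSemidef_flow signalRate_nonneg (noiseRate_nonneg hγ) ht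
      (sq_nonneg θ) (hτ true).1).isHermitian hC, Complex.ofReal_im]
  have hp0 : (F (τ true) * (1 - C)).trace = 1 - p := by
    rw [mul_sub, mul_one, Matrix.trace_sub, hp1, hF, trace_flow, (hτ true).2]
  have hq : F (τ false) = F (τ false) * D := by
    conv_lhs => rw [← hτD]
    refine flow_mul_of_commute (fun i => hD _) (fun i => ?_) _ _ _ _ _
    change Commute (Sum.elim Ls Ln i ⊗ₖ (1 : Matrix A A ℂ))ᴴ D
    rw [conjTranspose_kronecker_one]
    exact hD _
  have hq1 : (F (τ false) * C).trace = 1 := by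
    rw [hq, mul_assoc, hDC, ← hq, hF, trace_flow, (hτ false).2]
  have hq0 : (F (τ false) * (1 - C)).trace = 0 := by
    rw [mul_sub, mul_one, Matrix.trace_sub, hq1, hF, trace_flow, (hτ false).2, sub_self]
  have hE : ∀ (x : Bool) (ρ : Matrix (Fin d × A) (Fin d × A) ℂ),
      (cond x (1 - C) C * ρ * (cond x (1 - C) C)ᴴ).trace = (ρ * cond x (1 - C) C).trace := by
    intro x ρ
    rw [mul_assoc, Matrix.trace_mul_comm, mul_assoc]
    congr 2
    cases x
    · rw [cond_false, hC.eq, hC2]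
    · rw [cond_true, Matrix.conjTranspose_sub, Matrix.conjTranspose_one, hC.eq, mul_sub, sub_mul,
        sub_mul, hC2]
      simp
  induction M with
  | zero =>
    rw [pow_zero, sub_self, Complex.ofReal_one, Complex.ofReal_zero, one_smul, zero_smul, add_zero]
    rfl
  | succ M ih =>
    rw [Strategy.state, ih]
    change ∑ x : Bool, (cond x (1 - C) C * encode A Ls Ln γ t θ _ * (cond x (1 - C) C)ᴴ).trace • τ x
      = _
    simp only [hE]
    rw [encode_eq_flow, ← hF, SuperOp.map_add, SuperOp.map_smul, SuperOp.map_smul,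
      Fintype.sum_bool]
    simp only [cond_true, cond_false, add_mul, Matrix.smul_mul, Matrix.trace_add,
      Matrix.trace_smul, hp1, hp0, hq1, hq0, smul_eq_mul, mul_zero, add_zero, mul_one]
    congr 2
    · push_cast; ring
    · push_cast; ring

include hC hC2 hτ hγ in
-- The test matrix is a multiple of D, which records whether a click has occurred. With r = (1 -
-- p)^M it yields r'²/(1 - r), and Bernoulli's inequality gives 1 - r ≤ Mp.
theorem le_sequentialQFI
    (hD : ∀ L : Matrix (Fin d) (Fin d) ℂ, Commute (L ⊗ₖ (1 : Matrix A A ℂ)) D)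
    (hτD : τ false * D = τ false) (hDC : D * C = D) (hDh : D.IsHermitian) (hD2 : D * D = D)
    (hDτ : τ true * D = 0) {T : ℝ} (hT : 0 ≤ T) {θ : ℝ} {M : ℕ}
    {p p' : ℝ} (hp : clickProb C (τ true) Ls Ln γ (T / M) θ = p)
    (hp' : HasDerivAt (fun θ => clickProb C (τ true) Ls Ln γ (T / M) θ) p' θ)
    (hp0 : 0 < p) (hp1 : p < 1) (hM : 0 < M) :
    ENNReal.ofReal (((1 - p) ^ M) ^ 2 * (M * p') ^ 2 / (M * p)) ≤ sequentialQFI Ls Ln γ T M θ := by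
  have ht : 0 ≤ T / (M : ℝ) := by positivity
  have := (hτ true).nonempty
  set r : ℝ → ℝ := fun θ => (1 - clickProb C (τ true) Ls Ln γ (T / M) θ) ^ M with hr
  set r' : ℝ := M * (1 - p) ^ (M - 1) * -p' with hr'
  have hrd : HasDerivAt r r' θ := by
    have := (hp'.const_sub 1).pow M
    rw [hp] at this
    exact this
  set σ : Strategy d := resetStrategy hC hC2 hτ
  set S : ℝ → Matrix (Fin d × A) (Fin d × A) ℂ := fun θ => σ.state Ls Ln γ (T / M) θ M with hS
  have hst : ∀ θ, S θ
      = ((r θ : ℝ) : ℂ) • τ true + ((1 - r θ : ℝ) : ℂ) • τ false := fun θ =>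
    resetStrategy_state hC hC2 hτ hγ hD hτD hDC ht θ M
  have hpos : ∀ θ, (S θ).PosSemidef := by
    intro θ
    have : ∀ n, (σ.state Ls Ln γ (T / M) θ n).PosSemidef := fun n => by
      induction n with
      | zero => exact (hτ true).1
      | succ n ih =>
        rw [Strategy.state, encode_eq_flow]
        have := σ.isDensity_init.nonempty
        exact (σ.isChannel_control n).posSemidef (posSemidef_flow signalRate_nonneg
          (noiseRate_nonneg hγ) ht (sq_nonneg θ) ih)
    exact this M
  have htr : ∀ (x y : ℝ) (X : Matrix (Fin d × A) (Fin d × A) ℂ),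
      (((x : ℂ) • τ true + (y : ℂ) • τ false) * X).trace.re
        = x * (τ true * X).trace.re + y * (τ false * X).trace.re := fun x y X => by
    rw [add_mul, Matrix.smul_mul, Matrix.smul_mul, Matrix.trace_add, Matrix.trace_smul,
      Matrix.trace_smul, smul_eq_mul, smul_eq_mul, Complex.add_re, Complex.re_ofReal_mul,
      Complex.re_ofReal_mul]
  have hd : ∀ X, HasDerivAt (fun θ => (S θ * X).trace.re)
      (((r' : ℂ) • τ true + ((-r' : ℝ) : ℂ) • τ false) * X).trace.re θ := fun X => by
    simp only [hst]
    have h := (hrd.mul_const (τ true * X).trace.re).add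
      ((hrd.const_sub 1).mul_const (τ false * X).trace.re)
    rw [htr]
    refine h.congr_of_eventuallyEq (Eventually.of_forall fun s => ?_)
    exact htr _ _ X
  have hq1 : 0 < 1 - p := by linarith
  have hrθ : r θ = (1 - p) ^ M := by rw [hr]; simp only [hp]
  have hr1 : 0 < 1 - r θ := by
    rw [hrθ, sub_pos]
    exact pow_lt_one₀ hq1.le (by linarith) hM.ne'
  have hr2 : 1 - r θ ≤ M * p := by
    have := one_add_mul_le_pow (a := -p) (by linarith) M
    rw [hrθ]
    rw [← sub_eq_add_neg] at this
    linarith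
  have hfin : ((1 - p) ^ M) ^ 2 * (M * p') ^ 2 / (M * p) ≤ r' ^ 2 / (1 - r θ) := by
    refine div_le_div₀ (sq_nonneg _) ?_ hr1 hr2
    have : (1 - p) ^ M ≤ (1 - p) ^ (M - 1) :=
      pow_le_pow_of_le_one hq1.le (by linarith) (Nat.sub_le _ _)
    calc _ = ((1 - p) ^ M) ^ 2 * (M * p') ^ 2 := rfl
      _ ≤ ((1 - p) ^ (M - 1)) ^ 2 * (M * p') ^ 2 := by gcongr
      _ = _ := by rw [hr']; ring
  have hX : (((-r' / (1 - r θ) : ℝ) : ℂ) • D).IsHermitian := by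
    rw [Matrix.IsHermitian, Matrix.conjTranspose_smul, hDh.eq]; simp
  have hle := le_quantumFisher hd hpos hX
  refine (ENNReal.ofReal_le_ofReal (hfin.trans (le_of_eq ?_))).trans
    (hle.trans (le_iSup (fun σ : Strategy d =>
      quantumFisher (fun s => σ.state Ls Ln γ (T / M) s M) θ) σ))
  have hf1 : (τ false).trace.re = 1 := by rw [(hτ false).2, Complex.one_re]
  rw [hst, htr, htr]
  simp only [Matrix.smul_mul, Matrix.mul_smul, hD2, hDτ, hτD, smul_zero, Matrix.trace_zero,
    Complex.zero_re, mul_zero, zero_add, Matrix.trace_smul, smul_eq_mul, Complex.re_ofReal_mul,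
    hf1, mul_one]
  field_simp
  ring

end Reset

/-! ### Asymptotics of many rounds. -/

section Limit

/-- The information of repeated detection in the limit of many rounds. -/
theorem tendsto_repeated_detection {p u : ℝ → ℝ} {θ b T : ℝ} (hθ : 0 < θ) (hb : 0 < b) (hT : 0 < T)
    (hp : HasDerivAt p (θ ^ 2 * b) 0) (hp0 : p 0 = 0) (hu : HasDerivAt u b 0) (hu0 : u 0 = 0) :
    (∀ᶠ M : ℕ in atTop, 0 < p (T / M) ∧ p (T / M) < 1) ∧
    Tendsto (fun M : ℕ => ((1 - p (T / M)) ^ M) ^ 2 * (M * (2 * θ * u (T / M))) ^ 2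
      / (M * p (T / M))) atTop (𝓝 (4 * T * b * Real.exp (-(2 * T * b * θ ^ 2)))) := by
  have h1 := tendsto_nat_mul_of_hasDerivAt hp hp0 hT
  have h2 := tendsto_nat_mul_of_hasDerivAt hu hu0 hT
  have hpT : 0 < T * (θ ^ 2 * b) := by positivity
  have hlim : Tendsto (fun M : ℕ => p (T / M)) atTop (𝓝 0) := by
    have := hp.continuousAt.tendsto.comp
      (tendsto_nhds_of_tendsto_nhdsWithin (tendsto_div_nat_nhdsGT hT))
    rwa [hp0] at this
  refine ⟨?_, ?_⟩
  · filter_upwards [h1.eventually_const_lt hpT, hlim.eventually_lt_const one_pos,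
      eventually_gt_atTop 0] with M hM1 hM2 hM3
    exact ⟨(mul_pos_iff_of_pos_left (by exact_mod_cast hM3)).1 hM1, hM2⟩
  · have h3 : Tendsto (fun M : ℕ => (1 - p (T / M)) ^ M) atTop
        (𝓝 (Real.exp (-(T * (θ ^ 2 * b))))) := by
      have : Tendsto (fun M : ℕ => (M : ℝ) * -p (T / M)) atTop (𝓝 (-(T * (θ ^ 2 * b)))) := by
        simpa only [mul_neg] using h1.neg
      simpa only [← sub_eq_add_neg] using Real.tendsto_one_add_pow_exp_of_tendsto this
    have h4 : Tendsto (fun M : ℕ => (M : ℝ) * (2 * θ * u (T / M))) atTop (𝓝 (2 * θ * (T * b))) := by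
      have := h2.const_mul (2 * θ)
      refine this.congr fun M => by ring
    -- The limit is exp(-Tθ²b)² (2θTb)² / (Tθ²b), in which the powers of θ outside the exponential
    -- cancel.
    have h5 := ((h3.pow 2).mul (h4.pow 2)).div h1 hpT.ne'
    refine h5.congr' (Eventually.of_forall fun M => rfl) |>.trans (le_of_eq ?_)
    congr 1
    rw [← Real.exp_nat_mul]
    have : ((2 : ℕ) : ℝ) * -(T * (θ ^ 2 * b)) = -(2 * T * b * θ ^ 2) := by push_cast; ring
    rw [this]
    field_simp
    ring

end Limit

/-! ### An ancilla with a flag level and the lower bound on the optimal information. -/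

section FlaggedAncilla

variable {d K N : ℕ}

/-- The isometric embedding of the ancilla into the ancilla with an additional flag level. -/
def flagEmbed (d : ℕ) : Matrix (Option (Fin d)) (Fin d) ℂ :=
  Matrix.of fun (o : Option (Fin d)) a => if o = some a then 1 else 0

theorem flagEmbed_conjTranspose_mul_self : (flagEmbed d)ᴴ * flagEmbed d = 1 := by
  ext i j
  rw [Matrix.mul_apply, Fintype.sum_option]
  simp [flagEmbed, Matrix.one_apply, eq_comm]

theorem single_none_mul_flagEmbed :
    (Matrix.single none none 1 : Matrix (Option (Fin d)) (Option (Fin d)) ℂ) * flagEmbed d = 0 := by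
  ext o j
  rw [Matrix.mul_apply, Fintype.sum_option]
  simp [flagEmbed, Matrix.single_apply]

/-- The embedding of system and ancilla. -/
def jointEmbed (d : ℕ) : Matrix (Fin d × Option (Fin d)) (Fin d × Fin d) ℂ :=
  (1 : Matrix (Fin d) (Fin d) ℂ) ⊗ₖ flagEmbed d

theorem jointEmbed_conjTranspose_mul_self : (jointEmbed d)ᴴ * jointEmbed d = 1 := by
  rw [jointEmbed, Matrix.conjTranspose_kronecker, ← Matrix.mul_kronecker_mul,
    flagEmbed_conjTranspose_mul_self, Matrix.conjTranspose_one, one_mul, Matrix.one_kronecker_one]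

theorem kronecker_one_mul_jointEmbed (L : Matrix (Fin d) (Fin d) ℂ) :
    (L ⊗ₖ (1 : Matrix (Option (Fin d)) (Option (Fin d)) ℂ)) * jointEmbed d
      = jointEmbed d * (L ⊗ₖ (1 : Matrix (Fin d) (Fin d) ℂ)) := by
  rw [jointEmbed, ← Matrix.mul_kronecker_mul, ← Matrix.mul_kronecker_mul, one_mul, mul_one,
    Matrix.one_mul, Matrix.mul_one]

/-- The projector onto the flag level. -/
def flagProjector (d : ℕ) : Matrix (Fin d × Option (Fin d)) (Fin d × Option (Fin d)) ℂ :=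
  (1 : Matrix (Fin d) (Fin d) ℂ) ⊗ₖ Matrix.single none none 1

theorem flagProjector_mul_jointEmbed : flagProjector d * jointEmbed d = 0 := by
  rw [flagProjector, jointEmbed, ← Matrix.mul_kronecker_mul, single_none_mul_flagEmbed,
    Matrix.kronecker_zero]

theorem flagProjector_isHermitian : (flagProjector d).IsHermitian := by
  rw [Matrix.IsHermitian, flagProjector, Matrix.conjTranspose_kronecker, Matrix.conjTranspose_one,
    Matrix.conjTranspose_single, star_one]

theorem flagProjector_mul_self : flagProjector d * flagProjector d = flagProjector d := by
  rw [flagProjector, ← Matrix.mul_kronecker_mul, Matrix.single_mul_single_same, one_mul, one_mul]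

theorem commute_flagProjector (L : Matrix (Fin d) (Fin d) ℂ) :
    Commute (L ⊗ₖ (1 : Matrix (Option (Fin d)) (Option (Fin d)) ℂ)) (flagProjector d) := by
  rw [flagProjector, Commute, SemiconjBy, ← Matrix.mul_kronecker_mul, ← Matrix.mul_kronecker_mul,
    one_mul, mul_one, one_mul, mul_one]

theorem jointEmbed_conjTranspose_mul_flagProjector :
    (jointEmbed d)ᴴ * flagProjector d = 0 := by
  have := congrArg Matrix.conjTranspose (flagProjector_mul_jointEmbed (d := d))
  rwa [Matrix.conjTranspose_mul, flagProjector_isHermitian.eq, Matrix.conjTranspose_zero] at this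

/-- Lower bound on the optimal information by repeated detection with reset. -/
theorem exists_le_liminf_sequentialQFI (hd : 0 < d) {Ls : Fin K → Matrix (Fin d) (Fin d) ℂ}
    {Ln : Fin N → Matrix (Fin d) (Fin d) ℂ} {γ : Fin N → ℝ} (hγ : ∀ k, 0 < γ k)
    (hS : ∃ j, Ls j ∉ noiseSpan Ln) {T : ℝ} (hT : 0 < T) :
    ∃ b : ℝ, 0 < b ∧ ∀ θ : ℝ, 0 < θ →
      ENNReal.ofReal (4 * T * b * Real.exp (-(2 * T * b * θ ^ 2)))
        ≤ liminf (fun M : ℕ => sequentialQFI Ls Ln γ T M θ) atTop := by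
  choose B hB using fun j => exists_isOrthogonalComponent (noiseSpan Ln) (Ls j)
  choose m hm using fun j => exists_centered_coeff hd (hB j)
  have hU : (1 : Matrix (Fin d) (Fin d) ℂ)ᴴ * 1 = 1 := by simp
  obtain ⟨P, hP, hP2, hPS, hPB⟩ := exists_detector (noiseSpan Ln) hU
  set ρ := entangledState (1 : Matrix (Fin d) (Fin d) ℂ) with hρ
  have hρp : ρ.PosSemidef := posSemidef_entangledState
  set W := jointEmbed d with hW
  have hWW : Wᴴ * W = 1 := jointEmbed_conjTranspose_mul_self
  have hLW : ∀ L : Matrix (Fin d) (Fin d) ℂ,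
      (L ⊗ₖ (1 : Matrix (Option (Fin d)) (Option (Fin d)) ℂ)) * (W * ρ * Wᴴ)
        = W * ((L ⊗ₖ (1 : Matrix (Fin d) (Fin d) ℂ)) * ρ) * Wᴴ := fun L => by
    rw [← Matrix.mul_assoc, ← Matrix.mul_assoc, kronecker_one_mul_jointEmbed]
    simp only [Matrix.mul_assoc, hW]
  set D := flagProjector d
  -- No click means lying in the embedded block and in the kernel of P. The complement is taken in
  -- the enlarged space, so that the flag level always clicks.
  set C := 1 - W * (1 - P) * Wᴴ with hCdef
  have hCW : ∀ X : Matrix (Fin d × Fin d) (Fin d × Fin d) ℂ,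
      C * (W * X * Wᴴ) = W * (P * X) * Wᴴ := fun X => by
    have : W * (1 - P) * Wᴴ * (W * X * Wᴴ) = W * ((1 - P) * (Wᴴ * W) * X) * Wᴴ := by
      simp only [Matrix.mul_assoc]
    rw [hCdef, Matrix.sub_mul, this, hWW, Matrix.mul_one, Matrix.sub_mul, Matrix.one_mul,
      Matrix.one_mul, Matrix.mul_sub, Matrix.sub_mul]
    abel
  have hC : C.IsHermitian := by
    rw [Matrix.IsHermitian, hCdef, Matrix.conjTranspose_sub, Matrix.conjTranspose_one,
      Matrix.conjTranspose_mul, Matrix.conjTranspose_mul, Matrix.conjTranspose_conjTranspose,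
      Matrix.conjTranspose_sub, Matrix.conjTranspose_one, hP.eq, Matrix.mul_assoc]
  have hC2 : C * C = C := by
    have h1 : C * (W * (1 - P) * Wᴴ) = 0 := by
      rw [hCW, Matrix.mul_sub, Matrix.mul_one, hP2, sub_self, Matrix.mul_zero, Matrix.zero_mul]
    conv_lhs => rw [hCdef, Matrix.mul_sub, Matrix.mul_one, ← hCdef, h1, sub_zero]
  have hDC : D * C = D := by
    rw [hCdef, Matrix.mul_sub, Matrix.mul_one, ← Matrix.mul_assoc, ← Matrix.mul_assoc,
      flagProjector_mul_jointEmbed, Matrix.zero_mul,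
      Matrix.zero_mul, sub_zero]
  set i₀ : Fin d × Option (Fin d) := (⟨0, hd⟩, none) with hi
  set τ : Bool → Matrix (Fin d × Option (Fin d)) (Fin d × Option (Fin d)) ℂ :=
    fun x => cond x (W * ρ * Wᴴ) (Matrix.single i₀ i₀ 1) with hτdef
  have hτ : ∀ x, IsDensity (τ x) := by
    rintro (_ | _)
    · refine ⟨?_, ?_⟩
      · have h := Matrix.posSemidef_conjTranspose_mul_self (Matrix.single i₀ i₀ (1 : ℂ))
        rwa [Matrix.conjTranspose_single, star_one, Matrix.single_mul_single_same, one_mul] at h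
      · exact Matrix.trace_single_eq_same _ _
    · refine ⟨hρp.mul_mul_conjTranspose_same W, ?_⟩
      change (W * ρ * Wᴴ).trace = 1
      rw [Matrix.trace_mul_comm, ← Matrix.mul_assoc, hWW, Matrix.one_mul,
        trace_entangledState hd hU]
  have hτD : τ false * D = τ false := by
    change Matrix.single i₀ i₀ (1 : ℂ) * flagProjector d = Matrix.single i₀ i₀ 1
    have h : Matrix.single i₀ i₀ (1 : ℂ) = Matrix.single ⟨0, hd⟩ ⟨0, hd⟩ 1 ⊗ₖ
        Matrix.single (none : Option (Fin d)) none 1 := by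
      rw [Matrix.single_kronecker_single, mul_one]
    rw [h, flagProjector, ← Matrix.mul_kronecker_mul, Matrix.single_mul_single_same, Matrix.mul_one,
      mul_one]
  have hDτ : τ true * D = 0 := by
    change W * ρ * Wᴴ * flagProjector d = 0
    rw [Matrix.mul_assoc, jointEmbed_conjTranspose_mul_flagProjector, Matrix.mul_zero]
  set b : ℝ := ∑ j, (τ true * ((B j ⊗ₖ (1 : Matrix (Option (Fin d)) (Option (Fin d)) ℂ))ᴴ
    * (B j ⊗ₖ (1 : Matrix (Option (Fin d)) (Option (Fin d)) ℂ)))).trace.re with hbdef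
  have hb : b = ∑ j, ((B j)ᴴ * B j).trace.re / d := by
    refine Finset.sum_congr rfl fun j _ => ?_
    rw [conjTranspose_kronecker_one, ← kronecker_one_mul, Matrix.trace_mul_comm]
    change (_ * (W * ρ * Wᴴ)).trace.re = _
    rw [hLW, Matrix.trace_mul_comm, ← Matrix.mul_assoc, hWW, Matrix.one_mul, Matrix.trace_mul_comm,
      trace_entangledState_mul hU, Complex.div_natCast_re]
  have hb0 : 0 < b := by
    obtain ⟨j, hj⟩ := hS
    have hd' : (0 : ℝ) < d := by exact_mod_cast hd
    rw [hb]
    refine Finset.sum_pos' (fun j _ => div_nonneg (trace_conjTranspose_mul_self_re_nonneg _) hd'.le)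
      ⟨j, Finset.mem_univ j, div_pos (trace_conjTranspose_mul_self_re_pos fun h => ?_) hd'⟩
    exact hj ((hB j).eq_zero_iff.1 h)
  refine ⟨b, hb0, fun θ hθ => ?_⟩
  set c : Fin K ⊕ Fin N → ℂ := fun i => (Sum.elim Ls Ln i).trace / d with hc
  have hY : ∀ j, Ls j ⊗ₖ (1 : Matrix (Option (Fin d)) (Option (Fin d)) ℂ) - c (Sum.inl j) • 1
      = B j ⊗ₖ (1 : Matrix (Option (Fin d)) (Option (Fin d)) ℂ)
        + ∑ k, m j k • (Ln k ⊗ₖ (1 : Matrix (Option (Fin d)) (Option (Fin d)) ℂ)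
          - c (Sum.inr k) • 1) := fun j => by
    simp only [kronecker_one_sub_smul]
    change (Ls j - ((Ls j).trace / d) • 1) ⊗ₖ _ = _
    rw [hm, ← extendHom_apply, map_add, map_sum]
    simp only [map_smul, extendHom_apply]
    rfl
  have hCτ : C * τ true = 0 := by
    change C * (W * ρ * Wᴴ) = 0
    have := hPS 1 (one_mem_noiseSpan Ln)
    rw [Matrix.one_kronecker_one, Matrix.one_mul] at this
    rw [hCW, this, Matrix.mul_zero, Matrix.zero_mul]
  have hgen : ∀ w : Fin K ⊕ Fin N → ℝ,
      (genOp (jointJump (Option (Fin d)) Ls Ln) (fun i => (w i : ℂ)) (τ true) * C).trace.re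
        = ∑ j, w (Sum.inl j) * (τ true * ((B j ⊗ₖ (1 : Matrix (Option (Fin d)) (Option (Fin d)) ℂ))ᴴ
          * (B j ⊗ₖ (1 : Matrix (Option (Fin d)) (Option (Fin d)) ℂ)))).trace.re := fun w => by
    rw [jointJump_eq]
    refine trace_genOp_mul_projector hY hCτ (fun k => ?_) (fun j => ?_) (hτ true).1.isHermitian hC w
    · change C * (_ * (W * ρ * Wᴴ)) = 0
      rw [kronecker_one_sub_smul, hLW, hCW, hPS _ ((noiseSpan Ln).sub_mem (mem_noiseSpan Ln k)
        ((noiseSpan Ln).smul_mem _ (one_mem_noiseSpan Ln))), Matrix.mul_zero, Matrix.zero_mul]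
    · change C * (_ * (W * ρ * Wᴴ)) = _ * (W * ρ * Wᴴ)
      rw [hLW, hCW, hPB _ (hB j).2]
  set p : ℝ → ℝ := fun t => clickProb C (τ true) Ls Ln γ t θ with hp
  set u : ℝ → ℝ := fun t => (flowDeriv (jointJump (Option (Fin d)) Ls Ln) (Sum.elim 1 0)
    (Sum.elim 0 γ) t ((θ ^ 2 : ℝ) : ℂ) (τ true) * C).trace.re with hu
  have hτC : τ true * C = 0 := by
    have := congrArg Matrix.conjTranspose hCτ
    rwa [Matrix.conjTranspose_mul, hC.eq, (hτ true).1.isHermitian.eq,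
      Matrix.conjTranspose_zero] at this
  have hpd : HasDerivAt p (θ ^ 2 * b) 0 := by
    have h := hasDerivAt_trace_flow (jointJump (Option (Fin d)) Ls Ln) (Sum.elim 1 0)
      (Sum.elim 0 γ) (θ ^ 2) (τ true) C
    rw [hgen] at h
    simp only [Sum.elim_inl, Pi.zero_apply, Pi.one_apply, zero_add, mul_one] at h
    rw [← Finset.mul_sum] at h
    exact h
  have hud : HasDerivAt u b 0 := by
    have h := hasDerivAt_trace_flowDeriv (jointJump (Option (Fin d)) Ls Ln) (Sum.elim 1 0)
      (Sum.elim 0 γ) (θ ^ 2) (τ true) C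
    rw [hgen] at h
    simp only [Sum.elim_inl, Pi.one_apply, one_mul] at h
    exact h
  have hp0 : p 0 = 0 := by
    simp only [hp, clickProb, Complex.ofReal_zero, flow_zero, SuperOp.one_apply, hτC,
      Matrix.trace_zero, Complex.zero_re]
  have hu0 : u 0 = 0 := by
    simp only [hu, Complex.ofReal_zero, flowDeriv_zero, SuperOp.zero_apply, Matrix.zero_mul,
      Matrix.trace_zero, Complex.zero_re]
  obtain ⟨hev, hlim⟩ := tendsto_repeated_detection hθ hb0 hT hpd hp0 hud hu0
  rw [← (ENNReal.tendsto_ofReal hlim).liminf_eq]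
  refine liminf_le_liminf ?_
  filter_upwards [hev, eventually_gt_atTop 0] with M hM hM0
  refine le_sequentialQFI hC hC2 hτ (fun k => (hγ k).le) commute_flagProjector hτD hDC
    flagProjector_isHermitian flagProjector_mul_self hDτ hT.le (p := p (T / M)) rfl ?_ hM.1 hM.2 hM0
  have h := hasDerivAt_flow_sq (jointJump (Option (Fin d)) Ls Ln) (Sum.elim 1 0)
    (Sum.elim 0 γ) (T / M) θ (τ true) C
  rw [Matrix.smul_mul, Matrix.trace_smul, smul_eq_mul, Complex.re_ofReal_mul] at h
  exact h

theorem liminf_liminf_sequentialQFI_pos (hd : 0 < d) {Ls : Fin K → Matrix (Fin d) (Fin d) ℂ}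
    {Ln : Fin N → Matrix (Fin d) (Fin d) ℂ} {γ : Fin N → ℝ} (hγ : ∀ k, 0 < γ k)
    (hS : ∃ j, Ls j ∉ noiseSpan Ln) {T : ℝ} (hT : 0 < T) :
    0 < liminf (fun θ : ℝ => liminf (fun M : ℕ => sequentialQFI Ls Ln γ T M θ) atTop) (𝓝[>] 0) := by
  obtain ⟨b, hb, h⟩ := exists_le_liminf_sequentialQFI hd hγ hS hT
  have hlim : Tendsto (fun θ : ℝ => ENNReal.ofReal (4 * T * b * Real.exp (-(2 * T * b * θ ^ 2))))
      (𝓝[>] 0) (𝓝 (ENNReal.ofReal (4 * T * b))) := by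
    have hc : Continuous fun θ : ℝ =>
        ENNReal.ofReal (4 * T * b * Real.exp (-(2 * T * b * θ ^ 2))) :=
      ENNReal.continuous_ofReal.comp (by fun_prop)
    have := (hc.tendsto 0).mono_left (nhdsWithin_le_nhds (s := Set.Ioi (0 : ℝ)))
    simpa using this
  refine lt_of_lt_of_le (ENNReal.ofReal_pos.2 (by positivity : 0 < 4 * T * b)) ?_
  rw [← hlim.liminf_eq]
  refine liminf_le_liminf ?_
  filter_upwards [self_mem_nhdsWithin] with θ hθ
  exact h θ hθ

end FlaggedAncilla

end LindbladEstimation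

end

open LindbladEstimation in
theorem mainTheorem3 (d K N : ℕ) (hd : 0 < d)
    (Ls : Fin K → Matrix (Fin d) (Fin d) ℂ) (Ln : Fin N → Matrix (Fin d) (Fin d) ℂ)
    (γ : Fin N → ℝ) (hγ : ∀ k, 0 < γ k) (T : ℝ) (hT : 0 < T) :
    -- the optimal QFI in the limit of fast control, then of vanishing signal
    (0 < liminf (fun θ : ℝ => liminf (fun M : ℕ => sequentialQFI Ls Ln γ T M θ) atTop) (𝓝[>] 0) ↔
      ∃ j, Ls j ∉ noiseSpan Ln) ∧
    (0 < limsup (fun θ : ℝ => ⨆ M : ℕ, sequentialQFI Ls Ln γ T M θ) (𝓝[>] 0) ↔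
      ∃ j, Ls j ∉ noiseSpan Ln) ∧
    -- the QFI of the Bell state, with the limits taken in the same order
    ∃ B : Fin K → Matrix (Fin d) (Fin d) ℂ,
      (∀ j, IsOrthogonalComponent (noiseSpan Ln) (Ls j) (B j)) ∧
      ((∃ j, Ls j ∉ noiseSpan Ln) → 0 < 4 * T * (1 / d) * ∑ j, ((B j)ᴴ * B j).trace.re) ∧
      ∀ e : OrthonormalBasis (Fin d) ℂ (EuclideanSpace ℂ (Fin d)), ∃ g : ℝ → ℝ≥0∞,
        (∀ θ : ℝ, 0 < θ →
          Tendsto (fun M : ℕ => measureResetQFI Ls Ln γ T (bellState e) M θ) atTop (𝓝 (g θ))) ∧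
        Tendsto g (𝓝[>] 0)
          (𝓝 (ENNReal.ofReal (4 * T * (1 / d) * ∑ j, ((B j)ᴴ * B j).trace.re))) := by
  -- The two criteria are the ends of one chain of inequalities. Positivity of the lower end outside
  -- S and vanishing of the upper end inside S settle both equivalences.
  have hle : liminf (fun θ : ℝ => liminf (fun M : ℕ => sequentialQFI Ls Ln γ T M θ) atTop) (𝓝[>] 0)
      ≤ limsup (fun θ : ℝ => ⨆ M : ℕ, sequentialQFI Ls Ln γ T M θ) (𝓝[>] 0) :=
    le_trans liminf_le_limsup (limsup_le_limsup (Eventually.of_forall fun _ =>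
      le_trans liminf_le_limsup limsup_le_iSup))
  have hpos := fun hS => liminf_liminf_sequentialQFI_pos (T := T) hd (Ls := Ls) (Ln := Ln) hγ hS hT
  have hzero : 0 < limsup (fun θ : ℝ => ⨆ M : ℕ, sequentialQFI Ls Ln γ T M θ) (𝓝[>] 0) →
      ∃ j, Ls j ∉ noiseSpan Ln := fun h => by
    by_contra! hS
    rw [(tendsto_iSup_sequentialQFI hS hγ hT).limsup_eq] at h
    exact lt_irrefl _ h
  refine ⟨⟨fun h => hzero (h.trans_le hle), hpos⟩, ⟨hzero, fun hS => (hpos hS).trans_le hle⟩, ?_⟩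
  choose B hB using fun j => exists_isOrthogonalComponent (noiseSpan Ln) (Ls j)
  refine ⟨B, hB, fun ⟨j, hj⟩ => ?_, exists_tendsto_measureResetQFI hd Ls Ln hγ hT hB⟩
  have hd' : (0 : ℝ) < d := by exact_mod_cast hd
  refine mul_pos (by positivity) (Finset.sum_pos'
    (fun j _ => trace_conjTranspose_mul_self_re_nonneg _) ⟨j, Finset.mem_univ j, ?_⟩)
  exact trace_conjTranspose_mul_self_re_pos fun h => hj ((hB j).eq_zero_iff.1 h)
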